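/- Let $n,N\ge 0$ be integers and let $\mathbb D=\mathbb D_1\times\cdots\times\mathbb D_N\subset\mathbb C^N$ be a polydisc, where $\mathbb D_i$ is an open disc of positive radius centred at $u_i^0$ and the closed discs $\overline{\mathbb D}_i$ are pairwise disjoint. Let $A_1,\dots,A_N:\mathbb D\to \mathrm{Mat}_n(\mathbb C)$ be holomorphic with $\sum_i A_i(u)=0$, put $$\mathcal E=\big(\mathbb P^1\times\mathbb D\big)\setminus\bigcup_{i=1}^N\{z=u_i\},$$ and let $\omega$ be a matrix-valued $1$-form, holomorphic on $\mathcal E$, such that $\mathrm d\omega=\omega\wedge\omega$ and, for each fixed $u\in\mathbb D$, $\omega|_u=\sum_{i}\frac{A_i(u)}{z-u_i}\,\mathrm dz$. (Such an $\omega$ defines an isomonodromic deformation of the Fuchsian system $\frac{\mathrm dY}{\mathrm dz}=\sum_i\frac{A_i(u)}{z-u_i}Y$.) The deformation is called Schlesinger (possibly non-normalized) if there are holomorphic $\gamma_1,\dots,\gamma_N:\mathbb D\to\mathrm{Mat}_n(\mathbb C)$ with $$\omega=\omega_s+\sum_{i=1}^N\gamma_i(u)\,\mathrm du_i,\qquad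 \omega_s:=\sum_{i=1}^N\frac{A_i(u)}{z-u_i}\,\mathrm d(z-u_i)$$ (normalized if $\omega=\omega_s$). An isomonodromic fundamental matrix is an invertible matrix $Y(z,u)$, holomorphic on the universal covering of $\mathcal E$, with $\mathrm dY=\omega Y$ and with monodromy matrices independent of $u$. A Levelt form of $Y$ at $z=u_i$ is a representation, on a branch over a punctured neighbourhood of $\{z=u_i\}$ of the form $\{0<|z-u_i|<\rho,\ u\in\mathbb D\}$, $$Y(z,u)=\widehat Y_i(z,u)\,(z-u_i)^{D_i}(z-u_i)^{L_i(u)}\,C_i(u),$$ such that * $\widehat Y_i$ is holomorphic and invertible on $\{|z-u_i|<\rho,\ u\in\mathbb D\}$, and $\widehat Y_i(u_i,u)^{-1}A_i(u)\widehat Y_i(u_i,u)$ is in (upper triangular) Jordan form; * $L_i(u)$ is holomorphic in $u$ and is block-diagonal with upper triangular blocks; each block has a single eigenvalue, whose real part lies in $[0,1)$, and distinct blocks have distinct eigenvalues; * $D_i$ (a priori depending on $u$) is a diagonal matrix of integers, which are non-increasing along each block of $L_i$; * $C_i(u)$ is holomorphic in $u$ and invertible; * $\displaystyle\lim_{z\to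 u_i}\widehat Y_i\big(D_i+(z-u_i)^{D_i}L_i(z-u_i)^{-D_i}\big)\widehat Y_i^{-1}=A_i(u)$. An isomonodromic fundamental matrix is strongly isomonodromic if at every pole $z=u_i$ it has a Levelt form with $D_i$, $L_i$ and $C_i$ all independent of $u\in\mathbb D$; the deformation is strong if $\mathrm dY=\omega Y$ has a strongly isomonodromic fundamental matrix. Then: 1. The deformation is Schlesinger (possibly non-normalized) if and only if $\mathrm dY=\omega Y$ has an isomonodromic fundamental matrix which at every pole $z=u_i$ has a Levelt form with $L_i$ and $C_i$ independent of $u\in\mathbb D$. 2. The deformation is strong if and only if it is Schlesinger (possibly non-normalized). -/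

import Mathlib

open Topology

noncomputable section

namespace Fuchsian

/-- The space of deformation parameters `u = (u₁, …, u_N)`. -/
abbrev Par (N : ℕ) : Type := Fin N → ℂ

/-- Complex `n × n` matrices (with the product topology). -/
abbrev Mat (n : ℕ) : Type := Matrix (Fin n) (Fin n) ℂ

/-- The open polydisc with centre `u₀` and polyradius `r`. -/
def polydisc {N : ℕ} (u₀ : Par N) (r : Fin N → ℝ) : Set (Par N) :=
  {u | ∀ i, u i ∈ Metric.ball (u₀ i) (r i)}

/-! ### The space `(ℙ¹ × polydisc) \ ⋃ᵢ {z = uᵢ}` and its two charts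

The projective line is `OnePoint ℂ`, with the charts `z` and `w = 1 / z`. -/

/-- The point of the projective line with coordinate `w = 1 / z`. -/
def invPoint (w : ℂ) : OnePoint ℂ := if w = 0 then OnePoint.infty else ((w⁻¹ : ℂ) : OnePoint ℂ)

/-- The parametrization `(z, u) ↦ (z, u)` of the finite part of `ℙ¹ × ℂᴺ`. -/
def affineChart {N : ℕ} (p : ℂ × Par N) : OnePoint ℂ × Par N := ((p.1 : OnePoint ℂ), p.2)

/-- The parametrization `(w, u) ↦ (1 / w, u)` of the neighbourhood of infinity in `ℙ¹ × ℂᴺ`. -/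
def infinityChart {N : ℕ} (p : ℂ × Par N) : OnePoint ℂ × Par N := (invPoint p.1, p.2)

/-- The space `(ℙ¹ × polydisc) \ ⋃ᵢ {z = uᵢ}`, as a subset of `ℙ¹ × ℂᴺ`. -/
def totalSpace {N : ℕ} (u₀ : Par N) (r : Fin N → ℝ) : Set (OnePoint ℂ × Par N) :=
  {e | e.2 ∈ polydisc u₀ r ∧ ∀ i, e.1 ≠ ((e.2 i : ℂ) : OnePoint ℂ)}

/-- The total space in the chart `(z, u)`. -/
def affinePart {N : ℕ} (u₀ : Par N) (r : Fin N → ℝ) : Set (ℂ × Par N) :=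
  affineChart ⁻¹' totalSpace u₀ r

/-- The total space in the chart `(w, u)`, `w = 1 / z`. -/
def infinityPart {N : ℕ} (u₀ : Par N) (r : Fin N → ℝ) : Set (ℂ × Par N) :=
  infinityChart ⁻¹' totalSpace u₀ r

/-- Holomorphy of a matrix function on an open subset of `ℙ¹ × ℂᴺ`: it is holomorphic in
both charts. -/
def HolomorphicOn {n N : ℕ} (F : OnePoint ℂ × Par N → Mat n) (U : Set (OnePoint ℂ × Par N)) :
    Prop :=
  DifferentiableOn ℂ (F ∘ affineChart) (affineChart ⁻¹' U) ∧
    DifferentiableOn ℂ (F ∘ infinityChart) (infinityChart ⁻¹' U)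

/-! ### Matrix-valued 1-forms -/

/-- Matrix-valued 1-forms of type `(1, 0)` in the variables `(z, u)`: `ω p v` is the value of the
form at the point `p` on the tangent vector `v`.  Only the values at points of the affine part
of the total space matter. -/
abbrev Form (n N : ℕ) : Type := ℂ × Par N → (ℂ × Par N) →L[ℂ] Mat n

/-- The exterior derivative `dω`, evaluated on two tangent vectors. -/
def extDer {n N : ℕ} (ω : Form n N) (p v w : ℂ × Par N) : Mat n :=
  fderiv ℂ (fun q => ω q w) p v - fderiv ℂ (fun q => ω q v) p w

/-- The product `ω ∧ ω`, evaluated on two tangent vectors. -/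
def wedgeSelf {n N : ℕ} (ω : Form n N) (p v w : ℂ × Par N) : Mat n :=
  ω p v * ω p w - ω p w * ω p v

/-- The 1-form `ω`, given in the coordinates `(z, u)`, is holomorphic on the total space: it is
holomorphic on the affine part, and its pull-back by `(w, u) ↦ (1 / w, u)`, for which
`dz = - dw / w²`, extends to a form `η` which is holomorphic also at the points at infinity
(`w = 0`). -/
def IsHolomorphicForm {n N : ℕ} (u₀ : Par N) (r : Fin N → ℝ) (ω : Form n N) : Prop :=
  (∀ v, DifferentiableOn ℂ (fun p => ω p v) (affinePart u₀ r)) ∧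
  ∃ η : Form n N,
    (∀ v, DifferentiableOn ℂ (fun p => η p v) (infinityPart u₀ r)) ∧
    ∀ p ∈ infinityPart u₀ r, p.1 ≠ 0 →
      ∀ v : ℂ × Par N, η p v = ω (p.1⁻¹, p.2) (-(p.1 ^ 2)⁻¹ * v.1, v.2)

/-- `ω` is an integrable holomorphic form on the total space whose restriction to fixed `u` is
`∑ᵢ Aᵢ(u) / (z - uᵢ) dz`. -/
structure IsDeformationForm {n N : ℕ} (u₀ : Par N) (r : Fin N → ℝ) (A : Fin N → Par N → Mat n)
    (ω : Form n N) : Prop where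
  holomorphic : IsHolomorphicForm u₀ r ω
  restriction : ∀ p ∈ affinePart u₀ r, ω p (1, 0) = ∑ i, (p.1 - p.2 i)⁻¹ • A i p.2
  integrable : ∀ p ∈ affinePart u₀ r, ∀ v w, extDer ω p v w = wedgeSelf ω p v w

/-- The coordinate 1-form `dz` on `ℂ × ℂᴺ`. -/
def dz (N : ℕ) : (ℂ × Par N) →L[ℂ] ℂ := ContinuousLinearMap.fst ℂ ℂ (Par N)

/-- The coordinate 1-form `duᵢ` on `ℂ × ℂᴺ`. -/
def du {N : ℕ} (i : Fin N) : (ℂ × Par N) →L[ℂ] ℂ :=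
  (ContinuousLinearMap.proj i).comp (ContinuousLinearMap.snd ℂ ℂ (Par N))

/-- The form `ω_s = ∑ᵢ Aᵢ(u) / (z - uᵢ) d(z - uᵢ)`. -/
def schlesingerForm {n N : ℕ} (A : Fin N → Par N → Mat n) : Form n N := fun p =>
  ∑ i, (dz N - du i).smulRight ((p.1 - p.2 i)⁻¹ • A i p.2)

/-- The form `∑ᵢ γᵢ(u) duᵢ`. -/
def normalizationForm {n N : ℕ} (γ : Fin N → Par N → Mat n) : Form n N := fun p =>
  ∑ i, (du i).smulRight (γ i p.2)

/-- The deformation given by `ω` is Schlesinger, possibly non-normalized: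
`ω = ω_s + ∑ᵢ γᵢ(u) duᵢ` with `γᵢ` holomorphic on the polydisc (`γ = 0` is the normalized
case `ω = ω_s`). -/
def IsSchlesinger {n N : ℕ} (u₀ : Par N) (r : Fin N → ℝ) (A : Fin N → Par N → Mat n)
    (ω : Form n N) : Prop :=
  ∃ γ : Fin N → Par N → Mat n, (∀ i, DifferentiableOn ℂ (γ i) (polydisc u₀ r)) ∧
    ∀ p ∈ affinePart u₀ r, ω p = schlesingerForm A p + normalizationForm γ p

/-! ### Universal coverings -/

/-- The universal covering of `E` with base point `e₀`, as a set: homotopy classes of paths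
which start at `e₀`, indexed by their end points. -/
abbrev UCover {E : Type*} [TopologicalSpace E] (e₀ : E) : Type _ :=
  Σ e : E, Path.Homotopic.Quotient e₀ e

/-- The family `ℓ` is a lift of the continuous map `φ : X → E` to the universal covering of `E`:
along a path in `X` it changes by the image of this path. -/
def IsLift {X E : Type*} [TopologicalSpace X] [TopologicalSpace E] {e₀ : E} (φ : C(X, E))
    (ℓ : ∀ x, Path.Homotopic.Quotient e₀ (φ x)) : Prop :=
  ∀ (x x' : X) (c : Path x x'),
    ℓ x' = (ℓ x).trans (Path.Homotopic.Quotient.mk (c.map φ.continuous))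

/-! ### Fundamental matrices and their monodromy -/

section

variable {n N : ℕ} {u₀ : Par N} {r : Fin N → ℝ} {e₀ : totalSpace u₀ r}

/-- `Y` is a fundamental matrix of the Pfaffian system `dY = ω Y`, holomorphic on the universal
covering of the total space: its values are invertible, and near every point of the universal
covering it is given by a single-valued holomorphic matrix `F` with `dF = ω F` (at the points at
infinity this equation is implied by continuity). -/
structure IsFundamentalMatrix (ω : Form n N) (Y : UCover e₀ → Mat n) : Prop where
  invertible : ∀ q, IsUnit (Y q)
  solution : ∀ (e : totalSpace u₀ r) (q : Path.Homotopic.Quotient e₀ e),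
    ∃ U : Set (OnePoint ℂ × Par N), IsOpen U ∧ U ⊆ totalSpace u₀ r ∧ (e : OnePoint ℂ × Par N) ∈ U ∧
    ∃ F : OnePoint ℂ × Par N → Mat n, HolomorphicOn F U ∧
      (∀ p, affineChart p ∈ U → ∀ v,
        fderiv ℂ (F ∘ affineChart) p v = ω p v * F (affineChart p)) ∧
      ∀ (e' : totalSpace u₀ r) (c : Path e e'), (∀ t, (c t : OnePoint ℂ × Par N) ∈ U) →
        Y ⟨e', q.trans (Path.Homotopic.Quotient.mk c)⟩ = F e'

/-- Every loop at the base point has a monodromy matrix, independent of `(z, u)`. -/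
def HasConstantMonodromy (Y : UCover e₀ → Mat n) : Prop :=
  ∀ g : Path.Homotopic.Quotient e₀ e₀, ∃ M : Mat n,
    ∀ (e : totalSpace u₀ r) (q : Path.Homotopic.Quotient e₀ e), Y ⟨e, g.trans q⟩ = Y ⟨e, q⟩ * M

/-- Isomonodromic fundamental matrices of `dY = ω Y`. -/
structure IsIsomonodromicFundamentalMatrix (ω : Form n N) (Y : UCover e₀ → Mat n) : Prop where
  fundamental : IsFundamentalMatrix ω Y
  monodromy : HasConstantMonodromy Y

end

/-! ### Levelt forms -/

/-- Upper triangular matrices in Jordan normal form. -/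
def IsJordanForm {n : ℕ} (J : Mat n) : Prop :=
  ∀ a b : Fin n, a ≠ b → J a b ≠ 0 → (b : ℕ) = a + 1 ∧ J a b = 1 ∧ J a a = J b b

/-- The conditions on the exponents `D = diag(d₁, …, d_n)` and `L` of a Levelt form.  The blocks of
`L` consist of the indices with the same diagonal entry of `L`; these indices are consecutive,
and `L` is block-diagonal and upper triangular, so that each block has one eigenvalue, with real
part in `[0, 1)`, and different blocks have different eigenvalues.  The integers `d` are
non-increasing in each block. -/
structure IsLeveltExponent {n : ℕ} (D : Fin n → ℤ) (L : Mat n) : Prop where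
  triangular : ∀ a b, b < a → L a b = 0
  consecutive : ∀ a b c, a ≤ b → b ≤ c → L a a = L c c → L b b = L a a
  blockDiagonal : ∀ a b, L a a ≠ L b b → L a b = 0
  re_nonneg : ∀ a, 0 ≤ (L a a).re
  re_lt_one : ∀ a, (L a a).re < 1
  antitone : ∀ a b, a ≤ b → L a a = L b b → D b ≤ D a

/-- The matrix `x ^ D` for integers `D = diag(d₁, …, d_n)`. -/
def intPow {n : ℕ} (x : ℂ) (D : Fin n → ℤ) : Mat n := Matrix.diagonal fun a => x ^ D a

/-- The tube of radius `ρ` around the divisor `z = uᵢ`. -/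
def tube {N : ℕ} (u₀ : Par N) (r : Fin N → ℝ) (i : Fin N) (ρ : ℝ) : Set (ℂ × Par N) :=
  {p | ‖p.1 - p.2 i‖ < ρ ∧ p.2 ∈ polydisc u₀ r}

/-- The universal covering of the tube of radius `ρ` without the divisor `z = uᵢ`, in the
coordinates `(x, u)` with `x = log (z - uᵢ)`. -/
def logTube {N : ℕ} (u₀ : Par N) (r : Fin N → ℝ) (ρ : ℝ) : Set (ℂ × Par N) :=
  {h | h.1.re < Real.log ρ ∧ h.2 ∈ polydisc u₀ r}

/-- `Y` has at `z = uᵢ` the Levelt form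
`Y(z, u) = Ŷ(z, u) (z - uᵢ) ^ D (z - uᵢ) ^ L(u) C(u)`.  Here `(z, u)` ranges over (a lift
`ℓ` to the universal covering of the total space of) the universal covering of the tube of some
radius `ρ` without its divisor `z = uᵢ`, which contains no other pole; on it
`z - uᵢ = exp x`. -/
def IsLeveltForm {n N : ℕ} {u₀ : Par N} {r : Fin N → ℝ} {e₀ : totalSpace u₀ r}
    (A : Fin N → Par N → Mat n) (Y : UCover e₀ → Mat n) (i : Fin N)
    (D : Par N → Fin n → ℤ) (L C : Par N → Mat n) : Prop :=
  DifferentiableOn ℂ L (polydisc u₀ r) ∧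
  DifferentiableOn ℂ C (polydisc u₀ r) ∧
  (∀ u ∈ polydisc u₀ r, IsUnit (C u)) ∧
  (∀ u ∈ polydisc u₀ r, IsLeveltExponent (D u) (L u)) ∧
  ∃ (ρ : ℝ) (Yhat : ℂ × Par N → Mat n), 0 < ρ ∧
    DifferentiableOn ℂ Yhat (tube u₀ r i ρ) ∧
    (∀ p ∈ tube u₀ r i ρ, IsUnit (Yhat p)) ∧
    -- the leading coefficient of `Ŷ` puts `Aᵢ` in Jordan form
    (∀ u ∈ polydisc u₀ r, IsJordanForm ((Yhat (u i, u))⁻¹ * A i u * Yhat (u i, u))) ∧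
    (∀ u ∈ polydisc u₀ r,
      Filter.Tendsto
        (fun z : ℂ => Yhat (z, u) *
          (Matrix.diagonal (fun a => (D u a : ℂ)) +
            intPow (z - u i) (D u) * L u * intPow (z - u i) (-D u)) * (Yhat (z, u))⁻¹)
        (𝓝[≠] (u i)) (𝓝 (A i u))) ∧
    ∃ (φ : C(logTube u₀ r ρ, totalSpace u₀ r)) (ℓ : ∀ h, Path.Homotopic.Quotient e₀ (φ h)),
      (∀ h : logTube u₀ r ρ,
        (φ h : OnePoint ℂ × Par N) = affineChart (h.1.2 i + Complex.exp h.1.1, h.1.2)) ∧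
      IsLift φ ℓ ∧
      ∀ h : logTube u₀ r ρ, Y ⟨φ h, ℓ h⟩ =
        Yhat (h.1.2 i + Complex.exp h.1.1, h.1.2) * intPow (Complex.exp h.1.1) (D h.1.2) *
          NormedSpace.exp (h.1.1 • L h.1.2) * C h.1.2

/-- `M` is constant on the polydisc. -/
def IsConstantOn {α : Type*} {N : ℕ} (u₀ : Par N) (r : Fin N → ℝ) (M : Par N → α) : Prop :=
  ∀ u ∈ polydisc u₀ r, ∀ u' ∈ polydisc u₀ r, M u = M u'

/-- At every pole, `Y` has a Levelt form in which `L` and `C` are constant. -/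
def HasConstantExponentsAndConnection {n N : ℕ} {u₀ : Par N} {r : Fin N → ℝ}
    {e₀ : totalSpace u₀ r} (A : Fin N → Par N → Mat n) (Y : UCover e₀ → Mat n) : Prop :=
  ∀ i, ∃ (D : Par N → Fin n → ℤ) (L C : Par N → Mat n), IsLeveltForm A Y i D L C ∧
    IsConstantOn u₀ r L ∧ IsConstantOn u₀ r C

/-- Strongly isomonodromic fundamental matrices of `dY = ω Y`: at every pole there is a Levelt
form in which the essential monodromy data `D`, `L` and `C` are constant. -/
def IsStronglyIsomonodromic {n N : ℕ} {u₀ : Par N} {r : Fin N → ℝ} {e₀ : totalSpace u₀ r}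
    (A : Fin N → Par N → Mat n) (ω : Form n N) (Y : UCover e₀ → Mat n) : Prop :=
  IsIsomonodromicFundamentalMatrix ω Y ∧
  ∀ i, ∃ (D : Par N → Fin n → ℤ) (L C : Par N → Mat n), IsLeveltForm A Y i D L C ∧
    IsConstantOn u₀ r D ∧ IsConstantOn u₀ r L ∧ IsConstantOn u₀ r C

/-- The deformation given by `ω` is strong: `dY = ω Y` has a strongly isomonodromic fundamental
matrix. -/
def IsStrongDeformation {n N : ℕ} {u₀ : Par N} {r : Fin N → ℝ} (e₀ : totalSpace u₀ r)
    (A : Fin N → Par N → Mat n) (ω : Form n N) : Prop :=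
  ∃ Y : UCover e₀ → Mat n, IsStronglyIsomonodromic A ω Y

end Fuchsian

end

/-! Three properties are shown to imply one another in a cycle: Schlesinger, strong, and existence
of an isomonodromic fundamental matrix with constant `L` and `C` at every pole.

Schlesinger implies strong. Integrability gives local holomorphic frames (`IsFlatForm.exists_frame`,
built from a Dyson series along rays). Two frames differ by a locally constant matrix, so frames
form a covering space, and path lifting in it yields a fundamental matrix with constant monodromy
(`LocalBranches.exists_multivalued`). Near the pole `z = uᵢ`, put `x = z - uᵢ`. For a Schlesinger
form, the components of `ω` along directions with `dx = 0` have no pole at `x = 0`; they form a flat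
connection holomorphic across the pole, with transport `P(x, u)` normalized by `P(x, u₀) = 1`. At
the single parameter `u₀` the classical theory of a simple pole (`exists_leveltNormalForm`: Jordan
form, homological equations up to resonance, convergence) gives a solution `S T(x) x^D x^L`. Then `P
S T x^D x^L` solves the equation tangentially for all `u` and transversally at `u₀`, so it differs
from `Y` by a constant factor `C`. Thus `D`, `L` and `C` do not depend on `u`
(`exists_isLeveltForm`).

Strong implies constant `L` and `C` by forgetting `D`.

Constant `L` and `C` imply Schlesinger. The eigenvalues of `Aᵢ(u)` are the numbers `D a + L a a`;
they vary continuously in a countable set, so `D` is constant too. All factors of the Levelt form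
after `Ŷ` then depend on `z - uᵢ` only, so `dY Y⁻¹ = dŶ Ŷ⁻¹` is bounded in the directions tangent to
the pole. Hence the `du_k` component of `ω`, plus `A_k / (z - u_k)`, has only removable
singularities in `z` on the projective line, and by Liouville's theorem it is a function `γ_k(u)`
(`isSchlesinger_of_constant`). -/

/-! ### Holomorphic functions of several variables -/

section SeveralComplexVariables

open Metric Set

variable {E F : Type*} [NormedAddCommGroup E] [NormedSpace ℂ E]
  [NormedAddCommGroup F] [NormedSpace ℂ F]

/-- Cauchy's estimate for the differential of a bounded holomorphic map on a ball. -/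
theorem norm_fderiv_le_of_norm_le_on_ball {f : E → F} {c : E} {R M : ℝ} (hR : 0 < R)
    (hf : DifferentiableOn ℂ f (ball c R)) (hM : ∀ x ∈ ball c R, ‖f x‖ ≤ M) :
    ‖fderiv ℂ f c‖ ≤ 2 * M / R := by
  refine Complex.norm_fderiv_le_div_of_mapsTo_ball hf (fun x hx => ?_) hR
  rw [mem_closedBall, dist_eq_norm]
  have h1 := hM x hx
  have h2 := hM c (mem_ball_self hR)
  linarith [norm_sub_le (f x) (f c)]

/-- In finite dimension a linear map is determined by its values on a basis, which identify `E →L[ℂ]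
F` with a finite power of `F`. -/
theorem DifferentiableOn.of_clm_apply [FiniteDimensional ℂ E] {D : Type*} [NormedAddCommGroup D]
    [NormedSpace ℂ D] {f : D → E →L[ℂ] F} {s : Set D}
    (h : ∀ v, DifferentiableOn ℂ (fun x => f x v) s) : DifferentiableOn ℂ f s := by
  let d := Module.finrank ℂ E
  have hd : d = Module.finrank ℂ (Fin d → ℂ) := (Module.finrank_fin_fun ℂ).symm
  let e₁ := ContinuousLinearEquiv.ofFinrankEq hd
  let e₂ := (e₁.arrowCongr (1 : F ≃L[ℂ] F)).trans (ContinuousLinearEquiv.piRing (Fin d))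
  rw [← Function.id_comp f, ← e₂.symm_comp_self]
  exact e₂.symm.differentiable.comp_differentiableOn (differentiableOn_pi.mpr fun i => h _)

/-- The integral of a holomorphic function over a real parameter is holomorphic. -/
theorem DifferentiableOn.intervalIntegral_param [FiniteDimensional ℂ E] [CompleteSpace F]
    {U : Set E} (hU : IsOpen U) {f : E → ℝ → F} {a b : ℝ} (hab : a ≤ b)
    (hc : ContinuousOn (Function.uncurry f) (U ×ˢ Icc a b))
    (hd : ∀ t ∈ Icc a b, DifferentiableOn ℂ (fun p => f p t) U) :
    DifferentiableOn ℂ (fun p => ∫ t in a..b, f p t) U := by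
  intro p₀ hp₀
  have : ProperSpace E := FiniteDimensional.proper ℂ E
  obtain ⟨δ, hδ, hball⟩ := nhds_basis_closedBall.mem_iff.1 (hU.mem_nhds hp₀)
  have hK : IsCompact (closedBall p₀ δ ×ˢ Icc a b) := (isCompact_closedBall _ _).prod isCompact_Icc
  have hcK : ContinuousOn (Function.uncurry f) (closedBall p₀ δ ×ˢ Icc a b) :=
    hc.mono (prod_mono hball Subset.rfl)
  obtain ⟨M, hM⟩ := hK.exists_bound_of_continuousOn hcK
  have hIoc : Set.uIoc a b ⊆ Icc a b := by rw [uIoc_of_le hab]; exact Ioc_subset_Icc_self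
  have hsec : ∀ p ∈ U, ContinuousOn (f p) (Icc a b) := fun p hp =>
    hc.comp (f := fun t => (p, t)) (by fun_prop) fun t ht => ⟨hp, ht⟩
  have hsub : ∀ x ∈ ball p₀ (δ / 2), ball x (δ / 2) ⊆ closedBall p₀ δ := fun x hx y hy => by
    rw [mem_ball] at hx hy
    rw [mem_closedBall]
    linarith [dist_triangle y x p₀]
  have hdiffball : ∀ t ∈ Icc a b, ∀ x ∈ ball p₀ (δ / 2),
      DifferentiableOn ℂ (fun p => f p t) (ball x (δ / 2)) := fun t ht x hx =>
    (hd t ht).mono ((hsub x hx).trans hball)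
  have hcont : ContinuousOn (fun t => fderiv ℂ (fun p => f p t) p₀) (Icc a b) := by
    have huc := hK.uniformContinuousOn_of_continuous hcK
    rw [Metric.uniformContinuousOn_iff] at huc
    rw [Metric.continuousOn_iff]
    intro t ht ε hε
    -- Cauchy's estimate on a ball of radius `δ / 2` turns a difference `ε * δ / 8` of values into a
    -- difference `ε / 2` of differentials.
    obtain ⟨η, hη, h⟩ := huc (ε * δ / 8) (by positivity)
    refine ⟨η, hη, fun s hs hst => ?_⟩
    have hp0 : p₀ ∈ ball p₀ (δ / 2) := mem_ball_self (by positivity)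
    have hnb : ∀ t ∈ Icc a b, DifferentiableAt ℂ (fun p => f p t) p₀ := fun t ht =>
      (hd t ht).differentiableAt (hU.mem_nhds hp₀)
    rw [dist_eq_norm, ← fderiv_fun_sub (hnb s hs) (hnb t ht)]
    refine (norm_fderiv_le_of_norm_le_on_ball (M := ε * δ / 8) (R := δ / 2) (by positivity)
      ((hdiffball s hs _ hp0).sub (hdiffball t ht _ hp0)) fun x hx => ?_).trans_lt ?_
    · rw [Pi.sub_apply, ← dist_eq_norm]
      refine (h (x, s) ⟨hsub _ hp0 hx, hs⟩ (x, t) ⟨hsub _ hp0 hx, ht⟩ ?_).le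
      rw [Prod.dist_eq]
      simpa using hst
    · rw [div_lt_iff₀ (by positivity)]
      nlinarith
  have key := intervalIntegral.hasFDerivAt_integral_of_dominated_of_fderiv_le
    (μ := MeasureTheory.volume) (F := f) (F' := fun x t => fderiv ℂ (fun p => f p t) x)
    (x₀ := p₀) (a := a) (b := b) (bound := fun _ => 2 * M / (δ / 2))
    (ball_mem_nhds p₀ (half_pos hδ)) ?_ ?_ ?_ ?_ ?_ ?_
  · exact key.differentiableAt.differentiableWithinAt
  · filter_upwards [hU.mem_nhds hp₀] with x hx
    exact ((hsec x hx).mono hIoc).aestronglyMeasurable measurableSet_uIoc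
  · exact (hsec p₀ hp₀).intervalIntegrable_of_Icc hab
  · exact (hcont.mono hIoc).aestronglyMeasurable measurableSet_uIoc
  · refine Filter.Eventually.of_forall fun t ht x hx => ?_
    exact norm_fderiv_le_of_norm_le_on_ball (half_pos hδ) (hdiffball t (hIoc ht) x hx)
      fun y hy => hM (y, t) ⟨hsub x hx hy, hIoc ht⟩
  · exact intervalIntegrable_const
  · refine Filter.Eventually.of_forall fun t ht x hx => ?_
    have hxU : x ∈ U := hball (ball_subset_closedBall (ball_subset_ball (by linarith) hx))
    exact ((hd t (hIoc ht)).differentiableAt (hU.mem_nhds hxU)).hasFDerivAt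

/-- Directional derivatives of holomorphic maps are holomorphic. -/
theorem DifferentiableOn.fderiv_apply_of_isOpen [FiniteDimensional ℂ E] [CompleteSpace F]
    {U : Set E} (hU : IsOpen U) {f : E → F} (hf : DifferentiableOn ℂ f U) (v : E) :
    DifferentiableOn ℂ (fun p => fderiv ℂ f p v) U := by
  intro p₀ hp₀
  obtain ⟨δ, hδ, hball⟩ := nhds_basis_ball.mem_iff.1 (hU.mem_nhds hp₀)
  -- The disc of radius `2 * ε` in the direction `v` around any point of the half ball must stay
  -- inside the ball of radius `δ`.
  obtain ⟨ε, hε, hεv⟩ : ∃ ε : ℝ, 0 < ε ∧ 2 * ε * ‖v‖ < δ / 2 :=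
    ⟨δ / (8 * (‖v‖ + 1)), by positivity, by
      have : 0 < ‖v‖ + 1 := by positivity
      rw [show 2 * (δ / (8 * (‖v‖ + 1))) * ‖v‖ = δ / 4 * (‖v‖ / (‖v‖ + 1)) by field_simp; ring]
      have h1 : ‖v‖ / (‖v‖ + 1) ≤ 1 := by rw [div_le_one this]; linarith
      nlinarith⟩
  have hmem : ∀ p ∈ ball p₀ (δ / 2), ∀ t : ℂ, ‖t‖ < 2 * ε → p + t • v ∈ U := by
    intro p hp t ht
    apply hball
    rw [mem_ball, dist_eq_norm] at hp ⊢
    have h1 : ‖t • v‖ ≤ 2 * ε * ‖v‖ := by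
      rw [norm_smul]; exact mul_le_mul_of_nonneg_right ht.le (norm_nonneg _)
    have h2 : p + t • v - p₀ = (p - p₀) + t • v := by abel
    rw [h2]
    linarith [norm_add_le (p - p₀) (t • v)]
  have hline : ∀ p ∈ ball p₀ (δ / 2), ∀ t : ℂ, ‖t‖ < 2 * ε →
      HasDerivAt (fun t : ℂ => f (p + t • v)) (fderiv ℂ f (p + t • v) v) t := by
    intro p hp t ht
    have h1 : HasDerivAt (fun t : ℂ => p + t • v) v t := by
      simpa using ((hasDerivAt_id t).smul_const v).const_add p
    exact (hf.differentiableAt (hU.mem_nhds (hmem p hp t ht))).hasFDerivAt.comp_hasDerivAt t h1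
  -- Cauchy's formula for the derivative on the complex line through `p` in the direction `v`:
  -- differentiation becomes integration over a parameter, which preserves holomorphy.
  have hformula : ∀ p ∈ ball p₀ (δ / 2), fderiv ℂ f p v = (2 * Real.pi * Complex.I : ℂ)⁻¹ •
      ∫ θ in (0 : ℝ)..2 * Real.pi, _root_.deriv (circleMap 0 ε) θ •
        (((circleMap 0 ε θ - 0) ^ 2)⁻¹ • f (p + circleMap 0 ε θ • v)) := by
    intro p hp
    have h := Complex.two_pi_I_inv_smul_circleIntegral_sub_sq_inv_smul_of_differentiable
      (U := ball (0 : ℂ) (2 * ε)) (c := 0) (w₀ := 0) (R := ε) (f := fun t : ℂ => f (p + t • v))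
      isOpen_ball (closedBall_subset_ball (by linarith))
      (fun t ht => (hline p hp t (by simpa using ht)).differentiableAt.differentiableWithinAt)
      (mem_ball_self hε)
    have h0 := (hline p hp 0 (by simpa using hε)).deriv
    simp only [zero_smul, add_zero] at h0
    rw [← h0, ← h, circleIntegral]
  have hcirc : ∀ θ : ℝ, ‖circleMap 0 ε θ‖ < 2 * ε := fun θ => by
    simp [abs_of_pos hε]; linarith
  have hne : ∀ θ : ℝ, (circleMap 0 ε θ - 0) ^ 2 ≠ 0 := fun θ => by
    simpa using hε.ne'
  have key : DifferentiableOn ℂ (fun p => (2 * Real.pi * Complex.I : ℂ)⁻¹ •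
      ∫ θ in (0 : ℝ)..2 * Real.pi, _root_.deriv (circleMap 0 ε) θ •
        (((circleMap 0 ε θ - 0) ^ 2)⁻¹ • f (p + circleMap 0 ε θ • v))) (ball p₀ (δ / 2)) := by
    refine DifferentiableOn.const_smul (DifferentiableOn.intervalIntegral_param isOpen_ball
      Real.two_pi_pos.le ?_ fun θ _ => ?_) _
    · have h1 : ContinuousOn (fun q : E × ℝ => f (q.1 + circleMap 0 ε q.2 • v))
          (ball p₀ (δ / 2) ×ˢ Icc 0 (2 * Real.pi)) := by
        refine hf.continuousOn.comp (Continuous.continuousOn ?_)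
          fun q hq => hmem q.1 hq.1 _ (hcirc q.2)
        have := continuous_circleMap 0 ε
        fun_prop
      have h2 : Continuous fun q : E × ℝ => _root_.deriv (circleMap 0 ε) q.2 := by
        simp only [deriv_circleMap]
        have := continuous_circleMap 0 ε
        fun_prop
      have h3 : Continuous fun q : E × ℝ => ((circleMap 0 ε q.2 - 0) ^ 2)⁻¹ := by
        have := continuous_circleMap 0 ε
        exact Continuous.inv₀ (by fun_prop) fun q => hne q.2
      exact h2.continuousOn.smul (h3.continuousOn.smul h1)
    · refine ((hf.comp (f := fun p : E => p + circleMap 0 ε θ • v) (by fun_prop)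
        fun p hp => hmem p hp _ (hcirc θ)).const_smul _).const_smul _
  have hnb := ball_mem_nhds p₀ (half_pos hδ)
  refine ((key.differentiableAt hnb).congr_of_eventuallyEq ?_).differentiableWithinAt
  filter_upwards [hnb] with p hp using hformula p hp

/-- The differential of a holomorphic map is holomorphic. -/
theorem DifferentiableOn.fderiv_of_isOpen [FiniteDimensional ℂ E] [CompleteSpace F]
    {U : Set E} (hU : IsOpen U) {f : E → F} (hf : DifferentiableOn ℂ f U) :
    DifferentiableOn ℂ (fderiv ℂ f) U :=
  DifferentiableOn.of_clm_apply fun v => hf.fderiv_apply_of_isOpen hU v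

theorem DifferentiableOn.fderiv_fderiv_comm [FiniteDimensional ℂ E] [CompleteSpace F]
    {U : Set E} (hU : IsOpen U) {f : E → F} (hf : DifferentiableOn ℂ f U) {p : E} (hp : p ∈ U)
    (v w : E) : fderiv ℂ (fderiv ℂ f) p v w = fderiv ℂ (fderiv ℂ f) p w v := by
  refine second_derivative_symmetric_of_eventually (f := f) (f' := fderiv ℂ f) (x := p) ?_ ?_ v w
  · filter_upwards [hU.mem_nhds hp] with y hy
      using (hf.differentiableAt (hU.mem_nhds hy)).hasFDerivAt
  · exact ((hf.fderiv_of_isOpen hU).differentiableAt (hU.mem_nhds hp)).hasFDerivAt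

/-- A locally normally convergent series of holomorphic maps can be differentiated termwise. -/
theorem hasFDerivAt_tsum_of_locally_bounded [CompleteSpace F] {U : Set E} (hU : IsOpen U)
    {f : ℕ → E → F} (hf : ∀ m, DifferentiableOn ℂ (f m) U) {p₀ : E} (hp₀ : p₀ ∈ U)
    (hb : ∃ s ∈ 𝓝 p₀, ∃ b : ℕ → ℝ, Summable b ∧ ∀ m, ∀ q ∈ s, ‖f m q‖ ≤ b m) :
    HasFDerivAt (fun p => ∑' m, f m p) (∑' m, fderiv ℂ (f m) p₀) p₀ ∧
      Summable fun m => fderiv ℂ (f m) p₀ := by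
  obtain ⟨s, hs, b, hbs, hbd⟩ := hb
  obtain ⟨δ, hδ, hball⟩ := nhds_basis_ball.mem_iff.1 (Filter.inter_mem hs (hU.mem_nhds hp₀))
  have hsub : ∀ x ∈ ball p₀ (δ / 2), ball x (δ / 2) ⊆ ball p₀ δ := fun x hx y hy => by
    rw [mem_ball] at hx hy ⊢
    linarith [dist_triangle y x p₀]
  have hmem : p₀ ∈ ball p₀ (δ / 2) := mem_ball_self (half_pos hδ)
  have hbound : ∀ m, ∀ x ∈ ball p₀ (δ / 2), ‖fderiv ℂ (f m) x‖ ≤ 2 * b m / (δ / 2) := by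
    intro m x hx
    exact norm_fderiv_le_of_norm_le_on_ball (half_pos hδ)
      ((hf m).mono fun y hy => (hball (hsub x hx hy)).2)
      fun y hy => hbd m y (hball (hsub x hx hy)).1
  have hsum : Summable fun m => 2 * b m / (δ / 2) := (hbs.mul_left 2).div_const _
  refine ⟨hasFDerivAt_tsum_of_isPreconnected (f' := fun m x => fderiv ℂ (f m) x) hsum isOpen_ball
    (convex_ball p₀ (δ / 2)).isPreconnected ?_ hbound hmem ?_ hmem,
    Summable.of_norm_bounded hsum fun m => hbound m p₀ hmem⟩
  · intro m x hx
    have : x ∈ U := (hball (ball_subset_ball (by linarith) hx)).2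
    exact ((hf m).differentiableAt (hU.mem_nhds this)).hasFDerivAt
  · exact Summable.of_norm_bounded hbs fun m => hbd m p₀ (mem_of_mem_nhds hs)

end SeveralComplexVariables

/-! ### Flat holomorphic connections depending on a parameter -/

section FlatConnections

set_option linter.unusedSectionVars false

open Metric Set

/-- A function on `[0, 1]` which satisfies a linear differential inequality and vanishes at `0`
vanishes. -/
theorem eq_zero_of_norm_deriv_le {F : Type*} [NormedAddCommGroup F] [NormedSpace ℝ F]
    {y y' : ℝ → F} {K : ℝ} (hy : ∀ s ∈ Icc (0 : ℝ) 1, HasDerivAt y (y' s) s) (h0 : y 0 = 0)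
    (hK : ∀ s ∈ Icc (0 : ℝ) 1, ‖y' s‖ ≤ K * ‖y s‖) : y 1 = 0 :=
  eq_zero_of_abs_deriv_le_mul_abs_self_of_eq_zero_right
    (fun s hs => (hy s hs).continuousAt.continuousWithinAt)
    (fun s hs => (hy s (Ico_subset_Icc_self hs)).hasDerivWithinAt) h0
    (fun s hs => hK s (Ico_subset_Icc_self hs)) 1 (right_mem_Icc.2 zero_le_one)

variable {X V 𝔸 : Type*} [NormedAddCommGroup X] [NormedSpace ℂ X] [NormedAddCommGroup V]
  [NormedSpace ℂ V] [NormedRing 𝔸] [NormedAlgebra ℂ 𝔸]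

/-- The contraction of `X × V` by the factor `s` towards `X × {v₀}`. -/
def rayMap (v₀ : V) (s : ℝ) (p : X × V) : X × V := (p.1, v₀ + (s : ℂ) • (p.2 - v₀))

theorem rayMap_one (v₀ : V) (p : X × V) : rayMap v₀ 1 p = p := by simp [rayMap]

theorem rayMap_zero (v₀ : V) (p : X × V) : rayMap v₀ 0 p = (p.1, v₀) := by simp [rayMap]

theorem rayMap_snd_sub (v₀ : V) (s : ℝ) (p : X × V) :
    (rayMap v₀ s p).2 - v₀ = (s : ℂ) • (p.2 - v₀) := by simp [rayMap]

theorem rayMap_rayMap (v₀ : V) (s t : ℝ) (p : X × V) :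
    rayMap v₀ s (rayMap v₀ t p) = rayMap v₀ (s * t) p := by
  simp [rayMap, mul_smul]

theorem continuous_rayMap (v₀ : V) : Continuous fun q : (X × V) × ℝ => rayMap v₀ q.2 q.1 := by
  unfold rayMap
  have : Continuous fun q : (X × V) × ℝ => (q.2 : ℂ) := Complex.continuous_ofReal.comp continuous_snd
  fun_prop

theorem differentiable_rayMap (v₀ : V) (s : ℝ) :
    Differentiable ℂ (rayMap v₀ s : X × V → X × V) := by
  unfold rayMap; fun_prop

theorem hasDerivAt_rayMap (v₀ : V) (s : ℝ) (p : X × V) :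
    HasDerivAt (fun s => rayMap v₀ s p) (0, p.2 - v₀) s := by
  refine (hasDerivAt_const s p.1).prodMk ?_
  have h1 : HasDerivAt (fun s : ℝ => (s : ℂ)) 1 s := Complex.ofRealCLM.hasDerivAt
  simpa using (h1.smul_const (p.2 - v₀)).const_add v₀

/-- The terms of the Dyson series of the radial parallel transport. -/
noncomputable def dyson (Θ : X × V → V →L[ℂ] 𝔸) (v₀ : V) : ℕ → X × V → 𝔸
  | 0, _ => 1
  | m + 1, p => ∫ s in (0 : ℝ)..1, Θ (rayMap v₀ s p) (p.2 - v₀) * dyson Θ v₀ m (rayMap v₀ s p)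

variable {Θ : X × V → V →L[ℂ] 𝔸} {v₀ : V} {U : Set (X × V)}

theorem continuousOn_connection_ray (hΘ : ContinuousOn Θ U)
    (hstar : ∀ p ∈ U, ∀ s ∈ Icc (0 : ℝ) 1, rayMap v₀ s p ∈ U) :
    ContinuousOn (fun q : (X × V) × ℝ => Θ (rayMap v₀ q.2 q.1) (q.1.2 - v₀)) (U ×ˢ Icc 0 1) :=
  (hΘ.comp (continuous_rayMap v₀).continuousOn fun q hq => hstar q.1 hq.1 q.2 hq.2).clm_apply
    (by fun_prop)

theorem differentiableOn_dyson [FiniteDimensional ℂ X] [FiniteDimensional ℂ V] [CompleteSpace 𝔸]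
    (hU : IsOpen U) (hΘ : DifferentiableOn ℂ Θ U)
    (hstar : ∀ p ∈ U, ∀ s ∈ Icc (0 : ℝ) 1, rayMap v₀ s p ∈ U) (m : ℕ) :
    DifferentiableOn ℂ (dyson Θ v₀ m) U := by
  induction m with
  | zero => exact differentiableOn_const _
  | succ m ih =>
    refine DifferentiableOn.intervalIntegral_param hU zero_le_one ?_ fun s hs => ?_
    · exact (continuousOn_connection_ray hΘ.continuousOn hstar).mul
        (ih.continuousOn.comp (continuous_rayMap v₀).continuousOn
          fun q hq => hstar q.1 hq.1 q.2 hq.2)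
    · exact ((hΘ.comp (differentiable_rayMap v₀ s).differentiableOn
        fun p hp => hstar p hp s hs).clm_apply (by fun_prop)).mul
        (ih.comp (differentiable_rayMap v₀ s).differentiableOn fun p hp => hstar p hp s hs)

/-- Contractions compose and `p.2 - v₀` scales by `t`, so the substitution `s ↦ s * t` moves the
upper limit of integration to `t`. Along one ray the terms are therefore iterated integrals. -/
theorem dyson_succ_rayMap [CompleteSpace 𝔸] (m : ℕ) (t : ℝ) (p : X × V) :
    dyson Θ v₀ (m + 1) (rayMap v₀ t p) =
      ∫ s in (0 : ℝ)..t, Θ (rayMap v₀ s p) (p.2 - v₀) * dyson Θ v₀ m (rayMap v₀ s p) := by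
  have h := intervalIntegral.smul_integral_comp_mul_right (a := 0) (b := 1)
    (fun s => Θ (rayMap v₀ s p) (p.2 - v₀) * dyson Θ v₀ m (rayMap v₀ s p)) t
  rw [zero_mul, one_mul] at h
  rw [← h, dyson, ← intervalIntegral.integral_smul]
  refine intervalIntegral.integral_congr fun s _ => ?_
  simp only [rayMap_rayMap, rayMap_snd_sub, map_smul, smul_mul_assoc]
  rw [Complex.coe_smul]

/-- Each integration of `s ^ m` contributes a factor `1 / (m + 1)`; the factorial makes the series
converge without any smallness of the connection. -/
theorem norm_dyson_le [CompleteSpace 𝔸] {M : ℝ} {p : X × V} (hM0 : 0 ≤ M)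
    (hM : ∀ s ∈ Icc (0 : ℝ) 1, ‖Θ (rayMap v₀ s p) (p.2 - v₀)‖ ≤ M) (m : ℕ) :
    ∀ t ∈ Icc (0 : ℝ) 1, ‖dyson Θ v₀ m (rayMap v₀ t p)‖ ≤
      ‖(1 : 𝔸)‖ * M ^ m / m.factorial * t ^ m := by
  induction m with
  | zero => intro t _; simp [dyson]
  | succ m ih =>
    intro t ht
    rw [dyson_succ_rayMap]
    refine (intervalIntegral.norm_integral_le_of_norm_le (g := fun s =>
      M * (‖(1 : 𝔸)‖ * M ^ m / m.factorial * s ^ m)) ht.1 ?_ ?_).trans_eq ?_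
    · refine Filter.Eventually.of_forall fun s hs => ?_
      have hs' : s ∈ Icc (0 : ℝ) 1 := ⟨hs.1.le, hs.2.trans ht.2⟩
      exact (norm_mul_le _ _).trans
        (mul_le_mul (hM s hs') (ih s hs') (norm_nonneg _) hM0)
    · exact (by fun_prop : Continuous fun s : ℝ =>
        M * (‖(1 : 𝔸)‖ * M ^ m / m.factorial * s ^ m)).intervalIntegrable _ _
    · rw [intervalIntegral.integral_const_mul, intervalIntegral.integral_const_mul, integral_pow,
        Nat.factorial_succ]
      push_cast
      have : (m.factorial : ℝ) ≠ 0 := by positivity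
      field_simp
      ring

theorem dyson_locally_bounded [FiniteDimensional ℂ X] [FiniteDimensional ℂ V] [CompleteSpace 𝔸]
    (hU : IsOpen U) (hΘ : ContinuousOn Θ U)
    (hstar : ∀ p ∈ U, ∀ s ∈ Icc (0 : ℝ) 1, rayMap v₀ s p ∈ U) {p₀ : X × V} (hp₀ : p₀ ∈ U) :
    ∃ s ∈ 𝓝 p₀, ∃ b : ℕ → ℝ, Summable b ∧ ∀ m, ∀ q ∈ s, ‖dyson Θ v₀ m q‖ ≤ b m := by
  have : ProperSpace (X × V) := FiniteDimensional.proper ℂ _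
  obtain ⟨δ, hδ, hball⟩ := nhds_basis_closedBall.mem_iff.1 (hU.mem_nhds hp₀)
  obtain ⟨M, hM⟩ := ((isCompact_closedBall p₀ δ).prod
    (isCompact_Icc (a := (0 : ℝ)) (b := 1))).exists_bound_of_continuousOn
    ((continuousOn_connection_ray hΘ hstar).mono (prod_mono hball Subset.rfl))
  have hM0 : 0 ≤ M := (norm_nonneg _).trans
    (hM (p₀, 0) ⟨mem_closedBall_self hδ.le, left_mem_Icc.2 zero_le_one⟩)
  refine ⟨closedBall p₀ δ, closedBall_mem_nhds _ hδ,
    fun m => ‖(1 : 𝔸)‖ * (M ^ m / m.factorial), (Real.summable_pow_div_factorial M).mul_left _,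
    fun m q hq => ?_⟩
  have h := norm_dyson_le hM0 (fun s hs => hM (q, s) ⟨hq, hs⟩) m 1 (right_mem_Icc.2 zero_le_one)
  simpa [rayMap_one, mul_div_assoc] using h

theorem fderiv_dyson_succ_radial [FiniteDimensional ℂ X] [FiniteDimensional ℂ V]
    [CompleteSpace 𝔸] (hU : IsOpen U) (hΘ : DifferentiableOn ℂ Θ U)
    (hstar : ∀ p ∈ U, ∀ s ∈ Icc (0 : ℝ) 1, rayMap v₀ s p ∈ U) (m : ℕ) {p : X × V} (hp : p ∈ U) :
    fderiv ℂ (dyson Θ v₀ (m + 1)) p (0, p.2 - v₀) = Θ p (p.2 - v₀) * dyson Θ v₀ m p := by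
  have hdiff := differentiableOn_dyson hU hΘ hstar
  have hcont : ContinuousOn (fun s : ℝ =>
      Θ (rayMap v₀ s p) (p.2 - v₀) * dyson Θ v₀ m (rayMap v₀ s p)) (Icc 0 1) := by
    have hray : ContinuousOn (fun s : ℝ => rayMap v₀ s p) (Icc 0 1) := fun s _ =>
      (hasDerivAt_rayMap v₀ s p).continuousAt.continuousWithinAt
    exact ((hΘ.continuousOn.comp hray fun s hs => hstar p hp s hs).clm_apply
      continuousOn_const).mul ((hdiff m).continuousOn.comp hray fun s hs => hstar p hp s hs)
  have h1mem : (1 : ℝ) ∈ Icc (0 : ℝ) 1 := right_mem_Icc.2 zero_le_one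
  -- Only the part `s ≤ 1` of the ray is known to lie in `U`, so the fundamental theorem of calculus
  -- gives a one-sided derivative at `1`; this determines the two-sided one.
  have h1 : HasDerivWithinAt (fun t => dyson Θ v₀ (m + 1) (rayMap v₀ t p))
      (Θ p (p.2 - v₀) * dyson Θ v₀ m p) (Icc 0 1) 1 := by
    simp_rw [dyson_succ_rayMap]
    have : Fact ((1 : ℝ) ∈ Icc (0 : ℝ) 1) := ⟨h1mem⟩
    have h := intervalIntegral.integral_hasDerivWithinAt_right
      (hcont.intervalIntegrable_of_Icc zero_le_one) (s := Icc 0 1) (t := Icc 0 1)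
      (hcont.stronglyMeasurableAtFilter_nhdsWithin measurableSet_Icc 1) (hcont 1 h1mem)
    simpa [rayMap_one] using h
  have h2 : HasDerivAt (fun t => dyson Θ v₀ (m + 1) (rayMap v₀ t p))
      (fderiv ℂ (dyson Θ v₀ (m + 1)) p (0, p.2 - v₀)) 1 := by
    have hd : HasFDerivAt (dyson Θ v₀ (m + 1)) (fderiv ℂ (dyson Θ v₀ (m + 1)) p)
        (rayMap v₀ 1 p) := by
      rw [rayMap_one]
      exact ((hdiff (m + 1)).differentiableAt (hU.mem_nhds hp)).hasFDerivAt
    exact (hd.restrictScalars ℝ).comp_hasDerivAt 1 (hasDerivAt_rayMap v₀ 1 p)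
  exact (uniqueDiffOn_Icc zero_lt_one 1 h1mem).eq_deriv _ h2.hasDerivWithinAt h1

/-- The radial parallel transport of a connection along `V`, as a function of the end point. -/
noncomputable def radialTransport (Θ : X × V → V →L[ℂ] 𝔸) (v₀ : V) (p : X × V) : 𝔸 :=
  ∑' m, dyson Θ v₀ m p

theorem differentiableOn_radialTransport [FiniteDimensional ℂ X] [FiniteDimensional ℂ V]
    [CompleteSpace 𝔸] (hU : IsOpen U) (hΘ : DifferentiableOn ℂ Θ U)
    (hstar : ∀ p ∈ U, ∀ s ∈ Icc (0 : ℝ) 1, rayMap v₀ s p ∈ U) :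
    DifferentiableOn ℂ (radialTransport Θ v₀) U := fun _ hp =>
  (hasFDerivAt_tsum_of_locally_bounded hU (differentiableOn_dyson hU hΘ hstar) hp
    (dyson_locally_bounded hU hΘ.continuousOn hstar
      hp)).1.differentiableAt.differentiableWithinAt

theorem radialTransport_base (x : X) : radialTransport Θ v₀ (x, v₀) = 1 := by
  rw [radialTransport, tsum_eq_single 0]
  · rfl
  · intro m hm
    obtain ⟨m, rfl⟩ := Nat.exists_eq_succ_of_ne_zero hm
    simp [dyson]

theorem fderiv_radialTransport_radial [FiniteDimensional ℂ X] [FiniteDimensional ℂ V]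
    [CompleteSpace 𝔸] (hU : IsOpen U) (hΘ : DifferentiableOn ℂ Θ U)
    (hstar : ∀ p ∈ U, ∀ s ∈ Icc (0 : ℝ) 1, rayMap v₀ s p ∈ U) {p : X × V} (hp : p ∈ U) :
    fderiv ℂ (radialTransport Θ v₀) p (0, p.2 - v₀) =
      Θ p (p.2 - v₀) * radialTransport Θ v₀ p := by
  have hb := dyson_locally_bounded hU hΘ.continuousOn hstar hp
  obtain ⟨h1, h2⟩ := hasFDerivAt_tsum_of_locally_bounded hU (differentiableOn_dyson hU hΘ hstar)
    hp hb
  obtain ⟨s, hs, b, hbs, hbd⟩ := hb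
  have hsum : Summable fun m => dyson Θ v₀ m p :=
    Summable.of_norm_bounded hbs fun m => hbd m p (mem_of_mem_nhds hs)
  have h3 : HasSum (fun m => fderiv ℂ (dyson Θ v₀ m) p (0, p.2 - v₀))
      ((∑' m, fderiv ℂ (dyson Θ v₀ m) p) (0, p.2 - v₀)) :=
    (ContinuousLinearMap.apply ℂ 𝔸 ((0, p.2 - v₀) : X × V)).hasSum h2.hasSum
  have h4 : HasFDerivAt (radialTransport Θ v₀) (∑' m, fderiv ℂ (dyson Θ v₀ m) p) p := h1
  rw [h4.fderiv, ← h3.tsum_eq, h3.summable.tsum_eq_zero_add, radialTransport,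
    ← hsum.tsum_mul_left]
  have h0 : fderiv ℂ (dyson Θ v₀ 0) p = 0 := by
    simp only [show dyson Θ v₀ 0 = fun _ => (1 : 𝔸) from rfl, fderiv_fun_const]; rfl
  simp [h0, fderiv_dyson_succ_radial hU hΘ hstar _ hp]

/-- The connection with values in `𝔸` in the directions of `V` is flat on `U`. -/
def IsFlatOn (Θ : X × V → V →L[ℂ] 𝔸) (U : Set (X × V)) : Prop :=
  ∀ p ∈ U, ∀ v w : V, fderiv ℂ Θ p (0, v) w - fderiv ℂ Θ p (0, w) v = Θ p v * Θ p w - Θ p w * Θ p v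

/-- By construction the equation holds in the radial direction. Flatness makes the defect `e` in a
fixed direction `w` satisfy a linear differential equation along rays, and uniqueness forces it to
vanish. -/
theorem fderiv_radialTransport [FiniteDimensional ℂ X] [FiniteDimensional ℂ V]
    [CompleteSpace 𝔸] (hU : IsOpen U) (hΘ : DifferentiableOn ℂ Θ U)
    (hstar : ∀ p ∈ U, ∀ s ∈ Icc (0 : ℝ) 1, rayMap v₀ s p ∈ U) (hflat : IsFlatOn Θ U)
    {p : X × V} (hp : p ∈ U) (w : V) :
    fderiv ℂ (radialTransport Θ v₀) p (0, w) = Θ p w * radialTransport Θ v₀ p := by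
  set G := radialTransport Θ v₀ with hG
  have hGd : DifferentiableOn ℂ G U := differentiableOn_radialTransport hU hΘ hstar
  have hG'd : DifferentiableOn ℂ (fderiv ℂ G) U := hGd.fderiv_of_isOpen hU
  have hrad : ∀ p ∈ U, fderiv ℂ G p (0, p.2 - v₀) = Θ p (p.2 - v₀) * G p := fun p hp =>
    fderiv_radialTransport_radial hU hΘ hstar hp
  let e : X × V → 𝔸 := fun p => fderiv ℂ G p (0, w) - Θ p w * G p
  have hed : ∀ p ∈ U, ∀ q, HasFDerivAt G (fderiv ℂ G p) p ∧ HasFDerivAt e (fderiv ℂ e p) p ∧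
      fderiv ℂ e p q = fderiv ℂ (fderiv ℂ G) p q (0, w) -
        (Θ p w * fderiv ℂ G p q + fderiv ℂ Θ p q w * G p) := by
    intro p hp q
    have h1 := (hGd.differentiableAt (hU.mem_nhds hp)).hasFDerivAt
    have h2 := (hG'd.differentiableAt (hU.mem_nhds hp)).hasFDerivAt
    have h3 := (hΘ.differentiableAt (hU.mem_nhds hp)).hasFDerivAt
    have h4 := (h2.clm_apply (hasFDerivAt_const ((0, w) : X × V) p)).fun_sub
      ((h3.clm_apply (hasFDerivAt_const w p)).mul' h1)
    have h5 : HasFDerivAt e _ p := h4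
    refine ⟨h1, h5.differentiableAt.hasFDerivAt, ?_⟩
    rw [h5.fderiv]
    simp
  -- The radial equation is differentiated in the direction `w`; symmetry of the second derivative
  -- and flatness rearrange the result. The extra `e p` comes from the derivative of the radial
  -- vector `p.2 - v₀`.
  have hE : ∀ p ∈ U, fderiv ℂ e p (0, p.2 - v₀) + e p = Θ p (p.2 - v₀) * e p := by
    intro p hp
    have h1 := (hGd.differentiableAt (hU.mem_nhds hp)).hasFDerivAt
    have h2 := (hG'd.differentiableAt (hU.mem_nhds hp)).hasFDerivAt
    have h3 := (hΘ.differentiableAt (hU.mem_nhds hp)).hasFDerivAt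
    have h4 : HasFDerivAt (fun p : X × V => p.2 - v₀) (ContinuousLinearMap.snd ℂ X V) p :=
      hasFDerivAt_snd.sub_const v₀
    have h5 : HasFDerivAt (fun p : X × V => ((0 : X), p.2 - v₀))
        ((0 : (X × V) →L[ℂ] X).prod (ContinuousLinearMap.snd ℂ X V)) p :=
      (hasFDerivAt_const (0 : X) p).prodMk h4
    have hl := h2.clm_apply h5
    have hr := (h3.clm_apply h4).mul' h1
    have heq : (fun p : X × V => fderiv ℂ G p (0, p.2 - v₀)) =ᶠ[𝓝 p]
        fun p => Θ p (p.2 - v₀) * G p := by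
      filter_upwards [hU.mem_nhds hp] with q hq using hrad q hq
    have key := congrArg (fun L : (X × V) →L[ℂ] 𝔸 => L (0, w))
      ((hl.congr_of_eventuallyEq heq.symm).unique hr)
    simp [-map_sub] at key
    have hsymm := hGd.fderiv_fderiv_comm hU hp (0, p.2 - v₀) (0, w)
    have hfl := hflat p hp (p.2 - v₀) w
    have hr' := hrad p hp
    rw [(hed p hp _).2.2, hsymm, hr']
    simp only [e]
    have hfl' : fderiv ℂ Θ p (0, p.2 - v₀) w = fderiv ℂ Θ p (0, w) (p.2 - v₀) +
        (Θ p (p.2 - v₀) * Θ p w - Θ p w * Θ p (p.2 - v₀)) := by rw [← hfl]; abel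
    have key' : fderiv ℂ (fderiv ℂ G) p (0, w) (0, p.2 - v₀) =
        Θ p (p.2 - v₀) * fderiv ℂ G p (0, w) + (Θ p w + fderiv ℂ Θ p (0, w) (p.2 - v₀)) * G p
          - fderiv ℂ G p (0, w) := by
      rw [eq_sub_iff_add_eq, add_comm, key, add_mul]
    rw [hfl', key']
    noncomm_ring
  -- The factor `s` absorbs the extra term `e` in `hE` and supplies the initial value `y 0 = 0`.
  let y : ℝ → 𝔸 := fun s => (s : ℂ) • e (rayMap v₀ s p)
  have hpU : ∀ s ∈ Icc (0 : ℝ) 1, rayMap v₀ s p ∈ U := fun s hs => hstar p hp s hs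
  have hy : ∀ s ∈ Icc (0 : ℝ) 1, HasDerivAt y (Θ (rayMap v₀ s p) (p.2 - v₀) * y s) s := by
    intro s hs
    have h1 := (hed _ (hpU s hs) 0).2.1
    have h2 := (h1.restrictScalars ℝ).comp_hasDerivAt s (hasDerivAt_rayMap v₀ s p)
    have h3 : HasDerivAt (fun s : ℝ => (s : ℂ)) 1 s := Complex.ofRealCLM.hasDerivAt
    have h4 := h3.smul h2
    have h5 := hE _ (hpU s hs)
    rw [rayMap_snd_sub] at h5
    have h6 : ((0 : X), (s : ℂ) • (p.2 - v₀)) = (s : ℂ) • ((0 : X), p.2 - v₀) := by simp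
    rw [h6, map_smul, map_smul] at h5
    have h7 : Θ (rayMap v₀ s p) (p.2 - v₀) * y s =
        (s : ℂ) • fderiv ℂ e (rayMap v₀ s p) (0, p.2 - v₀) + (1 : ℂ) • e (rayMap v₀ s p) := by
      rw [one_smul, h5, smul_mul_assoc]
      exact mul_smul_comm _ _ _
    rw [h7]
    exact h4
  have hcont : ContinuousOn (fun s : ℝ => Θ (rayMap v₀ s p) (p.2 - v₀)) (Icc 0 1) :=
    (hΘ.continuousOn.comp (fun s _ =>
      (hasDerivAt_rayMap v₀ s p).continuousAt.continuousWithinAt) hpU).clm_apply continuousOn_const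
  obtain ⟨K, hK⟩ := isCompact_Icc.exists_bound_of_continuousOn hcont
  have hy1 := eq_zero_of_norm_deriv_le hy (by simp [y]) (K := K) fun s hs =>
    (norm_mul_le _ _).trans (mul_le_mul_of_nonneg_right (hK s hs) (norm_nonneg _))
  simp only [y, rayMap_one, Complex.ofReal_one, one_smul, e] at hy1
  exact sub_eq_zero.1 hy1

/-- If `G p * c = 0`, uniqueness along the ray run backwards from `p` carries this to the base
point, where `G = 1`, so `c = 0`. Left multiplication by `G p` is injective, hence surjective in
finite dimension. -/
theorem isUnit_radialTransport [FiniteDimensional ℂ X] [FiniteDimensional ℂ V]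
    [FiniteDimensional ℂ 𝔸] (hU : IsOpen U) (hΘ : DifferentiableOn ℂ Θ U)
    (hstar : ∀ p ∈ U, ∀ s ∈ Icc (0 : ℝ) 1, rayMap v₀ s p ∈ U) (hflat : IsFlatOn Θ U)
    {p : X × V} (hp : p ∈ U) :
    IsUnit (radialTransport Θ v₀ p) := by
  have : CompleteSpace 𝔸 := FiniteDimensional.complete ℂ 𝔸
  set G := radialTransport Θ v₀ with hG
  have hpU : ∀ s ∈ Icc (0 : ℝ) 1, rayMap v₀ s p ∈ U := fun s hs => hstar p hp s hs
  have hder : ∀ s ∈ Icc (0 : ℝ) 1, HasDerivAt (fun s => G (rayMap v₀ s p))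
      (Θ (rayMap v₀ s p) (p.2 - v₀) * G (rayMap v₀ s p)) s := by
    intro s hs
    have h1 := ((differentiableOn_radialTransport hU hΘ hstar).differentiableAt
      (hU.mem_nhds (hpU s hs))).hasFDerivAt
    have h2 := (h1.restrictScalars ℝ).comp_hasDerivAt s (hasDerivAt_rayMap v₀ s p)
    rw [← fderiv_radialTransport hU hΘ hstar hflat (hpU s hs)]
    exact h2
  have hinj : ∀ c : 𝔸, G p * c = 0 → c = 0 := by
    intro c hc
    have hcont : ContinuousOn (fun s : ℝ => Θ (rayMap v₀ s p) (p.2 - v₀)) (Icc 0 1) :=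
      (hΘ.continuousOn.comp (fun s _ =>
        (hasDerivAt_rayMap v₀ s p).continuousAt.continuousWithinAt) hpU).clm_apply
        continuousOn_const
    obtain ⟨K, hK⟩ := isCompact_Icc.exists_bound_of_continuousOn hcont
    have hz : ∀ s ∈ Icc (0 : ℝ) 1, HasDerivAt (fun s => G (rayMap v₀ (1 - s) p) * c)
        (-(Θ (rayMap v₀ (1 - s) p) (p.2 - v₀) * (G (rayMap v₀ (1 - s) p) * c))) s := by
      intro s hs
      have h := (HasDerivAt.scomp s (hder (1 - s) ⟨by linarith [hs.2], by linarith [hs.1]⟩)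
        ((hasDerivAt_id s).const_sub 1)).mul_const c
      simpa [mul_assoc] using h
    have := eq_zero_of_norm_deriv_le hz (by simpa [rayMap_one] using hc) (K := K) fun s hs => by
      rw [norm_neg]
      exact (norm_mul_le _ _).trans (mul_le_mul_of_nonneg_right
        (hK (1 - s) ⟨by linarith [hs.2], by linarith [hs.1]⟩) (norm_nonneg _))
    simpa [rayMap_zero, hG, radialTransport_base] using this
  have hsurj : Function.Surjective (LinearMap.mulLeft ℂ (G p)) :=
    LinearMap.injective_iff_surjective.1 ((injective_iff_map_eq_zero _).2 hinj)
  obtain ⟨H, hH⟩ := hsurj 1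
  rw [LinearMap.mulLeft_apply] at hH
  refine ⟨⟨G p, H, hH, sub_eq_zero.1 (hinj _ ?_)⟩, rfl⟩
  rw [mul_sub, ← mul_assoc, hH, one_mul, mul_one, sub_self]

end FlatConnections

/-! ### Flat forms: frames, pull-backs, extension across a hyperplane -/

section FlatForms

open Metric Set

variable {V W 𝔸 : Type*} [NormedAddCommGroup V] [NormedSpace ℂ V] [NormedAddCommGroup W]
  [NormedSpace ℂ W] [NormedRing 𝔸] [NormedAlgebra ℂ 𝔸]

set_option linter.unusedSectionVars false

/-- The form `θ` satisfies `dθ = θ ∧ θ` on `S`. -/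
def IsFlatForm (θ : V → V →L[ℂ] 𝔸) (S : Set V) : Prop :=
  ∀ p ∈ S, ∀ v w : V, fderiv ℂ θ p v w - fderiv ℂ θ p w v = θ p v * θ p w - θ p w * θ p v

/-- A flat holomorphic form on a convex open set has a holomorphic frame. -/
theorem IsFlatForm.exists_frame [FiniteDimensional ℂ V] [FiniteDimensional ℂ 𝔸]
    {θ : V → V →L[ℂ] 𝔸} {S : Set V} (hS : IsOpen S) (hconv : Convex ℝ S)
    (hθ : DifferentiableOn ℂ θ S) (hflat : IsFlatForm θ S) {v₀ : V} (hv₀ : v₀ ∈ S) :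
    ∃ G : V → 𝔸, DifferentiableOn ℂ G S ∧ (∀ p ∈ S, ∀ w, fderiv ℂ G p w = θ p w * G p) ∧
      (∀ p ∈ S, IsUnit (G p)) := by
  have : CompleteSpace 𝔸 := FiniteDimensional.complete ℂ 𝔸
  -- The factor `ℂ` is a dummy parameter space, on which the connection does not depend.
  let Θ : ℂ × V → V →L[ℂ] 𝔸 := fun p => θ p.2
  have hU : IsOpen (univ ×ˢ S : Set (ℂ × V)) := isOpen_univ.prod hS
  have hΘ : DifferentiableOn ℂ Θ (univ ×ˢ S) :=
    hθ.comp differentiable_snd.differentiableOn fun p hp => hp.2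
  have hstar : ∀ p ∈ (univ ×ˢ S : Set (ℂ × V)), ∀ s ∈ Icc (0 : ℝ) 1,
      rayMap v₀ s p ∈ (univ ×ˢ S : Set (ℂ × V)) := fun p hp s hs =>
    ⟨trivial, by
      have := hconv.add_smul_sub_mem hv₀ hp.2 hs
      simpa only [rayMap, Complex.coe_smul] using this⟩
  have hΘ' : ∀ p ∈ (univ ×ˢ S : Set (ℂ × V)), ∀ v, fderiv ℂ Θ p (0, v) = fderiv ℂ θ p.2 v := by
    intro p hp v
    have h := (hθ.differentiableAt (hS.mem_nhds hp.2)).hasFDerivAt.comp p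
      (hasFDerivAt_snd (𝕜 := ℂ) (p := p))
    have h' : HasFDerivAt Θ _ p := h
    rw [h'.fderiv]
    rfl
  have hfl : IsFlatOn Θ (univ ×ˢ S) := fun p hp v w => by
    rw [hΘ' p hp, hΘ' p hp]
    exact hflat p.2 hp.2 v w
  have hG := differentiableOn_radialTransport hU hΘ hstar
  refine ⟨fun v => radialTransport Θ v₀ (0, v), ?_, fun p hp w => ?_, fun p hp => ?_⟩
  · exact hG.comp (by fun_prop) fun v hv => ⟨trivial, hv⟩
  · have hp' : ((0 : ℂ), p) ∈ (univ ×ˢ S : Set (ℂ × V)) := ⟨trivial, hp⟩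
    have h := (hG.differentiableAt (hU.mem_nhds hp')).hasFDerivAt.comp p
      (hasFDerivAt_prodMk_right (𝕜 := ℂ) (0 : ℂ) p)
    have h' : HasFDerivAt (fun v => radialTransport Θ v₀ (0, v)) _ p := h
    rw [h'.fderiv]
    exact fderiv_radialTransport hU hΘ hstar hfl hp' w
  · exact isUnit_radialTransport hU hΘ hstar hfl ⟨trivial, hp⟩

/-- Pull-backs of flat forms are flat. -/
theorem IsFlatForm.pullback [FiniteDimensional ℂ V] [CompleteSpace W]
    {θ : W → W →L[ℂ] 𝔸} {S : Set W} (hS : IsOpen S) (hθ : DifferentiableOn ℂ θ S)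
    (hflat : IsFlatForm θ S) {T : Set V} (hT : IsOpen T) {ψ : V → W}
    (hψ : DifferentiableOn ℂ ψ T) (hmaps : MapsTo ψ T S) {η : V → V →L[ℂ] 𝔸}
    (hη : ∀ p ∈ T, ∀ v, η p v = θ (ψ p) (fderiv ℂ ψ p v)) : IsFlatForm η T := by
  intro p hp v w
  have h1 := (hψ.differentiableAt (hT.mem_nhds hp)).hasFDerivAt
  have h2 := ((hψ.fderiv_of_isOpen hT).differentiableAt (hT.mem_nhds hp)).hasFDerivAt
  have h3 := (hθ.differentiableAt (hS.mem_nhds (hmaps hp))).hasFDerivAt.comp p h1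
  have h4 := h3.clm_comp h2
  have heq : η =ᶠ[𝓝 p] fun p => (θ (ψ p)).comp (fderiv ℂ ψ p) := by
    filter_upwards [hT.mem_nhds hp] with q hq
    ext1 v
    exact hη q hq v
  have h5 : HasFDerivAt η _ p := h4.congr_of_eventuallyEq heq
  -- The terms containing the second differential of `ψ` cancel by its symmetry.
  have hsymm := hψ.fderiv_fderiv_comm hT hp v w
  rw [h5.fderiv, hη p hp, hη p hp, ← hflat (ψ p) (hmaps hp)]
  simp [hsymm]

/-- A continuous function on an open set of `ℂ × W` which vanishes off the hyperplane `{0} × W`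
vanishes. -/
theorem ContinuousOn.eq_zero_of_eq_zero_off_hyperplane {F : Type*} [NormedAddCommGroup F]
    {S : Set (ℂ × W)} (hS : IsOpen S) {Φ : ℂ × W → F} (hΦ : ContinuousOn Φ S)
    (h0 : ∀ p ∈ S, p.1 ≠ 0 → Φ p = 0) {p : ℂ × W} (hp : p ∈ S) : Φ p = 0 := by
  have hc : ContinuousAt (fun t : ℂ => (p.1 + t, p.2)) 0 := by fun_prop
  have ht : Filter.Tendsto (fun t : ℂ => (p.1 + t, p.2)) (𝓝[≠] 0) (𝓝 p) := by
    have := hc.tendsto.mono_left (nhdsWithin_le_nhds (s := {0}ᶜ))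
    simpa using this
  have h1 : Filter.Tendsto (fun t : ℂ => Φ (p.1 + t, p.2)) (𝓝[≠] 0) (𝓝 (Φ p)) :=
    (hΦ.continuousAt (hS.mem_nhds hp)).tendsto.comp ht
  refine tendsto_nhds_unique h1 (tendsto_const_nhds.congr' ?_)
  have h2 : ∀ᶠ t : ℂ in 𝓝[≠] 0, (p.1 + t, p.2) ∈ S := ht (hS.mem_nhds hp)
  have h3 : ∀ᶠ t : ℂ in 𝓝[≠] 0, p.1 + t ≠ 0 := by
    by_cases hp0 : p.1 = 0
    · filter_upwards [self_mem_nhdsWithin] with t ht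
      simpa [hp0] using ht
    · have : ContinuousAt (fun t : ℂ => p.1 + t) 0 := by fun_prop
      exact nhdsWithin_le_nhds (this.eventually_ne (by simpa using hp0))
  filter_upwards [h2, h3] with t ht2 ht3
  exact (h0 _ ht2 ht3).symm

/-- The defect of flatness is continuous, because the differential of a holomorphic form is. This
carries integrability across the points at infinity. -/
theorem IsFlatForm.of_off_hyperplane [FiniteDimensional ℂ W] [CompleteSpace 𝔸]
    {η : ℂ × W → (ℂ × W) →L[ℂ] 𝔸} {S : Set (ℂ × W)} (hS : IsOpen S)
    (hη : DifferentiableOn ℂ η S) (h : IsFlatForm η (S ∩ {p | p.1 ≠ 0})) : IsFlatForm η S := by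
  intro p hp v w
  have hη' := (hη.fderiv_of_isOpen hS).continuousOn
  have hc := hη.continuousOn
  have h1 : ∀ v, ContinuousOn (fun p => η p v) S := fun v => hc.clm_apply continuousOn_const
  have h2 : ∀ v w, ContinuousOn (fun p => fderiv ℂ η p v w) S := fun v w =>
    (hη'.clm_apply continuousOn_const).clm_apply continuousOn_const
  have := ContinuousOn.eq_zero_of_eq_zero_off_hyperplane hS
    (((h2 v w).sub (h2 w v)).sub (((h1 v).mul (h1 w)).sub ((h1 w).mul (h1 v))))
    (fun q hq hq0 => sub_eq_zero.2 (h q ⟨hq, hq0⟩ v w)) hp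
  exact sub_eq_zero.1 this

end FlatForms

namespace Fuchsian

/-! ### The charts of the total space -/

section Charts

open Set Filter

theorem invPoint_zero : invPoint 0 = OnePoint.infty := if_pos rfl

theorem invPoint_of_ne {w : ℂ} (hw : w ≠ 0) : invPoint w = ((w⁻¹ : ℂ) : OnePoint ℂ) := if_neg hw

theorem invPoint_inv {z : ℂ} (hz : z ≠ 0) : invPoint z⁻¹ = (z : OnePoint ℂ) := by
  rw [invPoint_of_ne (inv_ne_zero hz), inv_inv]

theorem invPoint_injective : Function.Injective invPoint := by
  intro w w' h
  by_cases hw : w = 0 <;> by_cases hw' : w' = 0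
  · rw [hw, hw']
  · rw [hw, invPoint_zero, invPoint_of_ne hw'] at h
    exact absurd h (OnePoint.infty_ne_coe _)
  · rw [hw', invPoint_zero, invPoint_of_ne hw] at h
    exact absurd h (OnePoint.coe_ne_infty _)
  · rw [invPoint_of_ne hw, invPoint_of_ne hw'] at h
    exact inv_injective (OnePoint.coe_injective h)

theorem nhds_infty_complex :
    𝓝 (OnePoint.infty : OnePoint ℂ) = map (fun z : ℂ => (z : OnePoint ℂ)) (cocompact ℂ) ⊔
      pure OnePoint.infty := by
  rw [OnePoint.nhds_infty_eq, coclosedCompact_eq_cocompact]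

theorem continuous_invPoint : Continuous invPoint := by
  rw [continuous_iff_continuousAt]
  intro w
  by_cases hw : w = 0
  · rw [ContinuousAt, hw, invPoint_zero, ← nhdsNE_sup_pure]
    refine Tendsto.sup ?_ (by rw [← invPoint_zero]; exact tendsto_pure_nhds _ _)
    rw [nhds_infty_complex]
    refine Tendsto.mono_right ?_ le_sup_left
    have h1 : Tendsto (fun w : ℂ => w⁻¹) (𝓝[≠] 0) (cocompact ℂ) := by
      rw [← Metric.cobounded_eq_cocompact]
      exact tendsto_inv₀_nhdsNE_zero
    refine (tendsto_map.comp h1).congr' ?_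
    filter_upwards [self_mem_nhdsWithin] with w hw
    exact (invPoint_of_ne hw).symm
  · have h1 : ContinuousAt (fun w : ℂ => ((w⁻¹ : ℂ) : OnePoint ℂ)) w :=
      OnePoint.continuous_coe.continuousAt.comp (continuousAt_inv₀ hw)
    refine h1.congr ?_
    filter_upwards [isOpen_ne.mem_nhds hw] with w' hw'
    exact (invPoint_of_ne hw').symm

/-- Openness is checked on neighbourhood filters: inversion sends the cocompact filter to
neighbourhoods of `0`, and it is continuous at the other points. -/
theorem isOpenEmbedding_invPoint : Topology.IsOpenEmbedding invPoint := by
  refine Topology.IsOpenEmbedding.of_continuous_injective_isOpenMap continuous_invPoint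
    invPoint_injective (IsOpenMap.of_nhds_le fun w => ?_)
  by_cases hw : w = 0
  · rw [hw, invPoint_zero, nhds_infty_complex]
    refine sup_le ?_ (by rw [← invPoint_zero, ← map_pure]; exact map_mono (pure_le_nhds _))
    have h1 : Tendsto (fun w : ℂ => w⁻¹) (cocompact ℂ) (𝓝 0) := by
      rw [← Metric.cobounded_eq_cocompact]
      exact tendsto_inv₀_cobounded
    have h2 : map (fun z : ℂ => (z : OnePoint ℂ)) (cocompact ℂ) =
        map (invPoint ∘ fun z => z⁻¹) (cocompact ℂ) := by
      refine Filter.map_congr ?_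
      have : ({0}ᶜ : Set ℂ) ∈ cocompact ℂ := isCompact_singleton.compl_mem_cocompact
      filter_upwards [this] with z hz
      exact (invPoint_inv hz).symm
    rw [h2, ← Filter.map_map (m := fun z : ℂ => z⁻¹) (m' := invPoint)]
    exact map_mono h1
  · rw [invPoint_of_ne hw, ← OnePoint.isOpenEmbedding_coe.map_nhds_eq]
    have h2 : map (fun z : ℂ => (z : OnePoint ℂ)) (𝓝 w⁻¹) =
        map (invPoint ∘ fun z => z⁻¹) (𝓝 w⁻¹) := by
      refine Filter.map_congr ?_
      filter_upwards [isOpen_ne.mem_nhds (inv_ne_zero hw)] with z hz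
      exact (invPoint_inv hz).symm
    rw [h2, ← Filter.map_map (m := fun z : ℂ => z⁻¹) (m' := invPoint)]
    refine map_mono ?_
    have := (continuousAt_inv₀ (inv_ne_zero hw)).tendsto
    rwa [inv_inv] at this

variable {N : ℕ}

theorem isOpenEmbedding_affineChart :
    Topology.IsOpenEmbedding (affineChart : ℂ × Par N → OnePoint ℂ × Par N) :=
  OnePoint.isOpenEmbedding_coe.prodMap .id

theorem isOpenEmbedding_infinityChart :
    Topology.IsOpenEmbedding (infinityChart : ℂ × Par N → OnePoint ℂ × Par N) :=
  isOpenEmbedding_invPoint.prodMap .id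

theorem infinityChart_eq_affineChart {p : ℂ × Par N} (hp : p.1 ≠ 0) :
    infinityChart p = affineChart (p.1⁻¹, p.2) := by
  simp [infinityChart, affineChart, invPoint_of_ne hp]

theorem affineChart_eq_infinityChart {p : ℂ × Par N} (hp : p.1 ≠ 0) :
    affineChart p = infinityChart (p.1⁻¹, p.2) := by
  rw [infinityChart_eq_affineChart (inv_ne_zero hp), inv_inv]

theorem infinityChart_zero_ne_affineChart (u : Par N) (p : ℂ × Par N) :
    infinityChart (0, u) ≠ affineChart p := by
  intro h
  have := congrArg Prod.fst h
  rw [infinityChart, invPoint_zero] at this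
  exact OnePoint.infty_ne_coe _ this

theorem exists_chart (e : OnePoint ℂ × Par N) :
    (∃ p, affineChart p = e) ∨ ∃ u, infinityChart (0, u) = e := by
  obtain ⟨z, u⟩ := e
  induction z using OnePoint.rec with
  | infty => exact Or.inr ⟨u, by simp [infinityChart, invPoint_zero]⟩
  | coe z => exact Or.inl ⟨(z, u), rfl⟩

theorem isOpen_polydisc (u₀ : Par N) (r : Fin N → ℝ) : IsOpen (polydisc u₀ r) := by
  rw [show polydisc u₀ r = Set.pi univ fun i => Metric.ball (u₀ i) (r i) by
    ext u; simp [polydisc]]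
  exact isOpen_set_pi finite_univ fun i _ => Metric.isOpen_ball

theorem convex_polydisc (u₀ : Par N) (r : Fin N → ℝ) : Convex ℝ (polydisc u₀ r) := by
  rw [show polydisc u₀ r = Set.pi univ fun i => Metric.ball (u₀ i) (r i) by
    ext u; simp [polydisc]]
  exact convex_pi fun i _ => convex_ball _ _

theorem mem_affinePart {u₀ : Par N} {r : Fin N → ℝ} {p : ℂ × Par N} :
    p ∈ affinePart u₀ r ↔ p.2 ∈ polydisc u₀ r ∧ ∀ i, p.1 ≠ p.2 i := by
  simp [affinePart, totalSpace, affineChart]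

theorem isOpen_totalSpace (u₀ : Par N) (r : Fin N → ℝ) : IsOpen (totalSpace u₀ r) := by
  have : totalSpace u₀ r = (Prod.snd ⁻¹' polydisc u₀ r) ∩
      ⋂ i, {e : OnePoint ℂ × Par N | e.1 ≠ ((e.2 i : ℂ) : OnePoint ℂ)} := by
    ext e; simp [totalSpace]
  rw [this]
  refine ((isOpen_polydisc u₀ r).preimage continuous_snd).inter (isOpen_iInter_of_finite fun i => ?_)
  refine isOpen_ne_fun continuous_fst (OnePoint.continuous_coe.comp ?_)
  exact (continuous_apply i).comp continuous_snd

theorem isOpen_affinePart (u₀ : Par N) (r : Fin N → ℝ) : IsOpen (affinePart u₀ r) :=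
  (isOpen_totalSpace u₀ r).preimage isOpenEmbedding_affineChart.continuous

theorem isOpen_infinityPart (u₀ : Par N) (r : Fin N → ℝ) : IsOpen (infinityPart u₀ r) :=
  (isOpen_totalSpace u₀ r).preimage isOpenEmbedding_infinityChart.continuous

end Charts

end Fuchsian

/-! ### Multivalued functions from branches with locally constant ratios -/

section LocallyConstantTransitions

open Set

variable {B G : Type*} [TopologicalSpace B] [Group G]

/-- Functions with values in a group, defined near the points of a space, whose ratios are locally
constant: local branches of a multivalued function, determined up to right multiplication by
constants. -/
structure LocalBranches (B G : Type*) [TopologicalSpace B] [Group G] where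
  /-- the domain of the branch at a point -/
  dom : B → Set B
  /-- the branch at a point -/
  val : B → B → G
  isOpen_dom : ∀ b, IsOpen (dom b)
  mem_dom : ∀ b, b ∈ dom b
  locallyConstant : ∀ b b', ∀ x ∈ dom b ∩ dom b', ∀ᶠ y in 𝓝 x,
    (val b' y)⁻¹ * val b y = (val b' x)⁻¹ * val b x

namespace LocalBranches

variable (f : LocalBranches B G) [TopologicalSpace G] [DiscreteTopology G]

/-- The bundle of branches. -/
def core : FiberBundleCore B B G where
  baseSet := f.dom
  isOpen_baseSet := f.isOpen_dom
  indexAt := id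
  mem_baseSet_at := f.mem_dom
  -- The coordinate `m` over the branch `b` stands for the germ of `val b * m`; the change of
  -- coordinates is the one that preserves its value at `x`.
  coordChange b b' x m := (f.val b' x)⁻¹ * f.val b x * m
  coordChange_self b x _ m := by simp
  continuousOn_coordChange b b' := by
    rintro ⟨x, m⟩ hx
    refine ContinuousAt.continuousWithinAt (Filter.Tendsto.congr' ?_ tendsto_const_nhds)
    have h1 : ∀ᶠ p : B × G in 𝓝 (x, m), (f.val b' p.1)⁻¹ * f.val b p.1 =
        (f.val b' x)⁻¹ * f.val b x :=
      (continuous_fst.tendsto (x, m)).eventually (f.locallyConstant b b' x hx.1)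
    have h2 : ∀ᶠ p : B × G in 𝓝 (x, m), p.2 = m :=
      (continuous_snd.tendsto (x, m)).eventually (p := fun g => g = m) (by simp)
    filter_upwards [h1, h2] with p hp1 hp2
    rw [hp1, hp2]
  coordChange_comp b b' b'' x _ m := by simp [mul_assoc]

/-- A bundle with discrete fibre is a covering, and its path lifting is the continuation of branches
along paths. -/
theorem isCoveringMap_proj : IsCoveringMap f.core.proj :=
  FiberBundle.isCoveringMap (F := G) (E := f.core.Fiber)

/-- The coordinate of a point of the bundle of branches with respect to the branch at its base
point. -/
def coord (t : f.core.TotalSpace) : G := t.2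

/-- The value at a point of the bundle of branches. -/
def eval (t : f.core.TotalSpace) : G := f.val t.1 t.1 * f.coord t

/-- Right multiplication in the fibres. -/
def rightMul (M : G) (t : f.core.TotalSpace) : f.core.TotalSpace := ⟨t.1, f.coord t * M⟩

theorem eval_rightMul (M : G) (t : f.core.TotalSpace) :
    f.eval (f.rightMul M t) = f.eval t * M := (mul_assoc _ _ _).symm

theorem continuous_rightMul (M : G) : Continuous (f.rightMul M) := by
  rw [continuous_iff_continuousAt]
  intro t
  rw [FiberBundle.continuousAt_totalSpace]
  refine ⟨(f.core.continuous_proj).continuousAt, ?_⟩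
  have h := ((FiberBundle.continuousAt_totalSpace (F := G) (E := f.core.Fiber) id).1
    (continuousAt_id (x := t))).2
  have h2 : ContinuousAt (fun g : G => g * M) ((f.core.localTrivAt t.1 t).2) :=
    continuous_of_discreteTopology.continuousAt
  refine (ContinuousAt.comp (f := fun s : f.core.TotalSpace => (f.core.localTrivAt t.1 s).2)
    h2 h).congr (Filter.Eventually.of_forall fun s => ?_)
  change (f.val t.1 s.1)⁻¹ * f.val s.1 s.1 * f.coord s * M = (f.val t.1 s.1)⁻¹ * f.val s.1 s.1 * (f.coord s * M)
  rw [mul_assoc]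

theorem monodromy_eq_of_lift {x y : B} (c : Path x y) (Γ : C(unitInterval, f.core.TotalSpace))
    (h : f.core.proj ∘ Γ = c) (h0 : f.core.proj (Γ 0) = x) :
    (f.isCoveringMap_proj.monodromy (Path.Homotopic.Quotient.mk c) ⟨Γ 0, h0⟩).1 = Γ 1 :=
  congrArg (fun Δ : C(unitInterval, f.core.TotalSpace) => Δ 1)
    ((f.isCoveringMap_proj.eq_liftPath_iff' (c.source.trans h0.symm)).2 ⟨h, rfl⟩).symm

/-- Right multiplication maps lifts of a path to lifts of the same path, so by uniqueness of lifts
it commutes with continuation. This is the source of monodromy matrices. -/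
theorem monodromy_rightMul {x y : B} (q : Path.Homotopic.Quotient x y) (M : G)
    (t : f.core.TotalSpace) (ht : f.core.proj t = x) :
    (f.isCoveringMap_proj.monodromy q ⟨f.rightMul M t, ht⟩).1 =
      f.rightMul M (f.isCoveringMap_proj.monodromy q ⟨t, ht⟩).1 := by
  obtain ⟨c⟩ := q
  have hΓ := f.isCoveringMap_proj.liftPath_lifts c t (c.source.trans ht.symm)
  have h0 := f.isCoveringMap_proj.liftPath_zero c t (c.source.trans ht.symm)
  set Γ := f.isCoveringMap_proj.liftPath c t (c.source.trans ht.symm)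
  have h := f.monodromy_eq_of_lift c ((⟨_, f.continuous_rightMul M⟩ : C(_, _)).comp Γ)
    (by funext s; exact congrFun hΓ s) (by simpa [h0, rightMul] using ht)
  have h' := f.monodromy_eq_of_lift c Γ hΓ (by rw [h0]; exact ht)
  simp only [ContinuousMap.comp_apply, ContinuousMap.coe_mk, h0] at h h'
  erw [h, h']

/-- While the path stays in the domain of the branch `b`, the lift has constant coordinate `m` in
the trivialization belonging to `b`. -/
theorem monodromy_of_mem_dom {b b' : B} (c : Path b b') (hc : ∀ t, c t ∈ f.dom b) (m : G) :
    f.eval (f.isCoveringMap_proj.monodromy (Path.Homotopic.Quotient.mk c)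
      ⟨⟨b, m⟩, rfl⟩).1 = f.val b b' * m := by
  have : ∀ x, Nonempty (f.core.Fiber x) := fun _ => ⟨(1 : G)⟩
  have hcont : Continuous fun t : unitInterval =>
      (f.core.localTriv b).toOpenPartialHomeomorph.symm (c t, m) := by
    refine (f.core.localTriv b).toOpenPartialHomeomorph.continuousOn_symm.comp_continuous
      (c.continuous.prodMk continuous_const) fun t => ?_
    exact ⟨hc t, trivial⟩
  have key := f.monodromy_eq_of_lift c ⟨_, hcont⟩ rfl (by simp)
  have h0 : (f.core.localTriv b).toOpenPartialHomeomorph.symm (c 0, m) = ⟨b, m⟩ := by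
    rw [c.source]
    change (⟨b, (f.val b b)⁻¹ * f.val b b * m⟩ : f.core.TotalSpace) = ⟨b, m⟩
    simp
  have h1 : (f.core.localTriv b).toOpenPartialHomeomorph.symm (c 1, m) =
      ⟨b', (f.val b' b')⁻¹ * f.val b b' * m⟩ := by
    rw [c.target]
    rfl
  simp only [ContinuousMap.coe_mk, h0] at key
  rw [key, h1]
  change f.val b' b' * ((f.val b' b')⁻¹ * f.val b b' * m) = f.val b b' * m
  simp [mul_assoc]

end LocalBranches

/-- A multivalued function on a space with prescribed local branches. -/
theorem LocalBranches.exists_multivalued (f : LocalBranches B G) (e₀ : B) :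
    ∃ Y : Fuchsian.UCover e₀ → G,
      (∀ (e : B) (q : Path.Homotopic.Quotient e₀ e), ∃ m : G, ∀ (e' : B) (c : Path e e'),
        (∀ t, c t ∈ f.dom e) → Y ⟨e', q.trans (Path.Homotopic.Quotient.mk c)⟩ = f.val e e' * m) ∧
      ∀ g : Path.Homotopic.Quotient e₀ e₀, ∃ M : G, ∀ (e : B) (q : Path.Homotopic.Quotient e₀ e),
        Y ⟨e, g.trans q⟩ = Y ⟨e, q⟩ * M := by
  -- Only the discrete topology on the fibre is relevant: coordinates of continued branches must be
  -- locally constant.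
  let _ : TopologicalSpace G := ⊥
  have _ : DiscreteTopology G := ⟨rfl⟩
  let t₀ : f.core.proj ⁻¹' {e₀} := ⟨⟨e₀, (1 : G)⟩, rfl⟩
  refine ⟨fun q => f.eval (f.isCoveringMap_proj.monodromy q.2 t₀).1, fun e q => ?_, fun g => ?_⟩
  · rcases hm : f.isCoveringMap_proj.monodromy q t₀ with ⟨⟨b, m⟩, hb⟩
    obtain rfl : b = e := hb
    refine ⟨m, fun e' c hc => ?_⟩
    dsimp only
    rw [IsCoveringMap.monodromy_trans_apply, hm]
    exact f.monodromy_of_mem_dom c hc m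
  -- The loop `g` moves the unit branch at `e₀` to its right multiple by some `m`, and this factor
  -- persists under further continuation.
  · rcases hm : f.isCoveringMap_proj.monodromy g t₀ with ⟨⟨b, m⟩, hb⟩
    obtain rfl : b = e₀ := hb
    refine ⟨m, fun e q => ?_⟩
    dsimp only
    rw [IsCoveringMap.monodromy_trans_apply, hm]
    have h := f.monodromy_rightMul q m t₀.1 rfl
    have h' : f.rightMul m t₀.1 = ⟨b, m⟩ :=
      congrArg (fun k : G => (⟨b, k⟩ : f.core.TotalSpace)) (one_mul (show G from m))
    simp only [h'] at h
    rw [h]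
    exact f.eval_rightMul m _

end LocallyConstantTransitions

namespace Fuchsian

/-! ### Local solutions of `dY = ω Y` -/

section LocalSolutions

open Set Filter
open scoped Matrix.Norms.L2Operator

variable {n N : ℕ} {u₀ : Par N} {r : Fin N → ℝ} {ω η : Form n N}

theorem IsHolomorphicForm.differentiableOn (hω : IsHolomorphicForm u₀ r ω) :
    DifferentiableOn ℂ ω (affinePart u₀ r) :=
  DifferentiableOn.of_clm_apply hω.1

theorem extDer_eq {S : Set (ℂ × Par N)} (hS : IsOpen S) (hω : DifferentiableOn ℂ ω S)
    {p : ℂ × Par N} (hp : p ∈ S) (v w : ℂ × Par N) :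
    extDer ω p v w = fderiv ℂ ω p v w - fderiv ℂ ω p w v := by
  have h : ∀ v w, fderiv ℂ (fun q => ω q w) p v = fderiv ℂ ω p v w := fun v w => by
    rw [((hω.differentiableAt (hS.mem_nhds hp)).hasFDerivAt.clm_apply
      (hasFDerivAt_const w p)).fderiv]
    simp
  rw [extDer, h, h]

theorem isFlatForm_of_integrable (hω : IsHolomorphicForm u₀ r ω)
    (hint : ∀ p ∈ affinePart u₀ r, ∀ v w, extDer ω p v w = wedgeSelf ω p v w) :
    IsFlatForm ω (affinePart u₀ r) := fun p hp v w => by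
  rw [← extDer_eq (isOpen_affinePart u₀ r) hω.differentiableOn hp, hint p hp]
  rfl

/-- The change of charts `(w, u) ↦ (1 / w, u)`. -/
noncomputable def invChart (p : ℂ × Par N) : ℂ × Par N := (p.1⁻¹, p.2)

theorem invChart_invChart (p : ℂ × Par N) : invChart (invChart p) = p := by simp [invChart]

theorem infinityChart_eq {p : ℂ × Par N} (hp : p.1 ≠ 0) :
    infinityChart p = affineChart (invChart p) := infinityChart_eq_affineChart hp

theorem affineChart_eq {p : ℂ × Par N} (hp : p.1 ≠ 0) :
    affineChart p = infinityChart (invChart p) := affineChart_eq_infinityChart hp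

theorem hasFDerivAt_invChart {p : ℂ × Par N} (hp : p.1 ≠ 0) :
    HasFDerivAt invChart (((-(p.1 ^ 2)⁻¹) • ContinuousLinearMap.fst ℂ ℂ (Par N)).prod
      (ContinuousLinearMap.snd ℂ ℂ (Par N))) p :=
  ((hasDerivAt_inv hp).comp_hasFDerivAt p hasFDerivAt_fst).prodMk hasFDerivAt_snd

theorem isOpen_fst_ne_zero : IsOpen {p : ℂ × Par N | p.1 ≠ 0} :=
  isOpen_ne_fun continuous_fst continuous_const

/-- A branch of a fundamental matrix of `dY = ω Y` on an open set. -/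
structure IsLocalSolution (ω : Form n N) (U : Set (OnePoint ℂ × Par N))
    (F : OnePoint ℂ × Par N → Mat n) : Prop where
  holomorphic : HolomorphicOn F U
  equation : ∀ p, affineChart p ∈ U → ∀ v,
    fderiv ℂ (F ∘ affineChart) p v = ω p v * F (affineChart p)
  invertible : ∀ e ∈ U, IsUnit (F e)

theorem exists_localSolution_affine (hω : IsHolomorphicForm u₀ r ω)
    (hflat : IsFlatForm ω (affinePart u₀ r)) {p₀ : ℂ × Par N} (hp₀ : p₀ ∈ affinePart u₀ r) :
    ∃ U, IsOpen U ∧ U ⊆ totalSpace u₀ r ∧ affineChart p₀ ∈ U ∧ ∃ F, IsLocalSolution ω U F := by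
  obtain ⟨δ, hδ, hball⟩ := Metric.nhds_basis_ball.mem_iff.1
    ((isOpen_affinePart u₀ r).mem_nhds hp₀)
  obtain ⟨G, hG, hG', hGu⟩ := IsFlatForm.exists_frame Metric.isOpen_ball (convex_ball p₀ δ)
    (hω.differentiableOn.mono hball) (fun p hp => hflat p (hball hp)) (Metric.mem_ball_self hδ)
  have hinj := (isOpenEmbedding_affineChart (N := N)).injective
  -- The frame is transported to the projective line by the chart; the value `0` off the image of
  -- the chart is never used.
  have hF : ∀ p, Function.extend affineChart G (fun _ => 0) (affineChart p) = G p :=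
    fun p => hinj.extend_apply _ _ _
  have hF' : Function.extend affineChart G (fun _ => 0) ∘ affineChart = G := funext hF
  have hpre : affineChart ⁻¹' (affineChart '' Metric.ball p₀ δ) = Metric.ball p₀ δ :=
    preimage_image_eq _ hinj
  refine ⟨affineChart '' Metric.ball p₀ δ,
    isOpenEmbedding_affineChart.isOpenMap _ Metric.isOpen_ball, ?_,
    mem_image_of_mem _ (Metric.mem_ball_self hδ), Function.extend affineChart G fun _ => 0,
    ⟨?_, ?_⟩, ?_, ?_⟩
  · rintro _ ⟨p, hp, rfl⟩
    exact hball hp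
  · rw [hF', hpre]
    exact hG
  · rintro p ⟨q, hq, hqp⟩
    have hp0 : p.1 ≠ 0 := fun h => infinityChart_zero_ne_affineChart p.2 q (by
      rw [hqp, ← h])
    have hq' : q = invChart p := hinj (by rw [hqp, infinityChart_eq hp0])
    have h1 : DifferentiableAt ℂ (fun p => G (invChart p)) p :=
      (hG.differentiableAt (Metric.isOpen_ball.mem_nhds (hq' ▸ hq))).comp p
        (hasFDerivAt_invChart hp0).differentiableAt
    refine (h1.congr_of_eventuallyEq ?_).differentiableWithinAt
    filter_upwards [isOpen_fst_ne_zero.mem_nhds hp0] with p' hp'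
    rw [Function.comp_apply, infinityChart_eq hp', hF]
  · rintro p hp v
    rw [hF', hF]
    exact hG' p (by rw [← hpre]; exact hp) v
  · rintro _ ⟨p, hp, rfl⟩
    rw [hF]
    exact hGu p hp

/-- For `w ≠ 0` the form `η` is the pull-back of `ω` by inversion, hence flat; continuity covers `w
= 0`. -/
theorem isFlatForm_infinity (hω : IsHolomorphicForm u₀ r ω)
    (hflat : IsFlatForm ω (affinePart u₀ r))
    (hη : ∀ v, DifferentiableOn ℂ (fun p => η p v) (infinityPart u₀ r))
    (hηω : ∀ p ∈ infinityPart u₀ r, p.1 ≠ 0 →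
      ∀ v : ℂ × Par N, η p v = ω (p.1⁻¹, p.2) (-(p.1 ^ 2)⁻¹ * v.1, v.2)) :
    IsFlatForm η (infinityPart u₀ r) := by
  refine IsFlatForm.of_off_hyperplane (isOpen_infinityPart u₀ r)
    (DifferentiableOn.of_clm_apply hη) ?_
  refine IsFlatForm.pullback (ψ := invChart) (isOpen_affinePart u₀ r) hω.differentiableOn hflat
    ((isOpen_infinityPart u₀ r).inter isOpen_fst_ne_zero) (fun p hp =>
      (hasFDerivAt_invChart hp.2).differentiableAt.differentiableWithinAt) (fun p hp => ?_)
    fun p hp v => ?_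
  · have := hp.1
    rwa [infinityPart, mem_preimage, infinityChart_eq hp.2] at this
  · rw [hηω p hp.1 hp.2 v, (hasFDerivAt_invChart hp.2).fderiv]
    rfl

/-- A frame of the extended form `η` exists near `w = 0`; off the divisor at infinity the chain rule
translates its equation into the one for `ω`. -/
theorem exists_localSolution_infinity (hω : IsHolomorphicForm u₀ r ω)
    (hflat : IsFlatForm ω (affinePart u₀ r)) {u : Par N}
    (hu : ((0 : ℂ), u) ∈ infinityPart u₀ r) :
    ∃ U, IsOpen U ∧ U ⊆ totalSpace u₀ r ∧ infinityChart (0, u) ∈ U ∧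
      ∃ F, IsLocalSolution ω U F := by
  obtain ⟨η, hη, hηω⟩ := hω.2
  obtain ⟨δ, hδ, hball⟩ := Metric.nhds_basis_ball.mem_iff.1
    ((isOpen_infinityPart u₀ r).mem_nhds hu)
  have hflat' := isFlatForm_infinity hω hflat hη hηω
  obtain ⟨G, hG, hG', hGu⟩ := IsFlatForm.exists_frame Metric.isOpen_ball (convex_ball _ δ)
    ((DifferentiableOn.of_clm_apply hη).mono hball) (fun p hp => hflat' p (hball hp))
    (Metric.mem_ball_self hδ)
  have hinj := (isOpenEmbedding_infinityChart (N := N)).injective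
  have hF : ∀ p, Function.extend infinityChart G (fun _ => 0) (infinityChart p) = G p :=
    fun p => hinj.extend_apply _ _ _
  have hF' : Function.extend infinityChart G (fun _ => 0) ∘ infinityChart = G := funext hF
  have hpre : infinityChart ⁻¹' (infinityChart '' Metric.ball (0, u) δ) = Metric.ball (0, u) δ :=
    preimage_image_eq _ hinj
  have hmem : ∀ p, affineChart p ∈ infinityChart '' Metric.ball (0, u) δ →
      p.1 ≠ 0 ∧ invChart p ∈ Metric.ball (0, u) δ := by
    rintro p ⟨q, hq, hqp⟩
    have hq0 : q.1 ≠ 0 := fun h => infinityChart_zero_ne_affineChart q.2 p (by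
      rw [← hqp, ← h])
    have hp : p = invChart q := isOpenEmbedding_affineChart.injective (by
      rw [← hqp, infinityChart_eq hq0])
    refine ⟨by rw [hp]; exact inv_ne_zero hq0, ?_⟩
    rwa [hp, invChart_invChart]
  have heq : ∀ p : ℂ × Par N, p.1 ≠ 0 →
      Function.extend infinityChart G (fun _ => 0) ∘ affineChart =ᶠ[𝓝 p]
        fun p => G (invChart p) := fun p hp => by
    filter_upwards [isOpen_fst_ne_zero.mem_nhds hp] with p' hp'
    rw [Function.comp_apply, affineChart_eq hp', hF]
  have hder : ∀ p, affineChart p ∈ infinityChart '' Metric.ball (0, u) δ →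
      HasFDerivAt (fun p => G (invChart p)) ((fderiv ℂ G (invChart p)).comp
        (((-(p.1 ^ 2)⁻¹) • ContinuousLinearMap.fst ℂ ℂ (Par N)).prod
          (ContinuousLinearMap.snd ℂ ℂ (Par N)))) p := fun p hp =>
    (hG.differentiableAt (Metric.isOpen_ball.mem_nhds (hmem p hp).2)).hasFDerivAt.comp p
      (hasFDerivAt_invChart (hmem p hp).1)
  refine ⟨infinityChart '' Metric.ball (0, u) δ,
    isOpenEmbedding_infinityChart.isOpenMap _ Metric.isOpen_ball, ?_,
    mem_image_of_mem _ (Metric.mem_ball_self hδ), Function.extend infinityChart G fun _ => 0,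
    ⟨?_, ?_⟩, ?_, ?_⟩
  · rintro _ ⟨p, hp, rfl⟩
    exact hball hp
  · intro p hp
    exact ((hder p hp).differentiableAt.congr_of_eventuallyEq
      (heq p (hmem p hp).1)).differentiableWithinAt
  · rw [hF', hpre]
    exact hG
  · intro p hp v
    obtain ⟨hp0, hpb⟩ := hmem p hp
    rw [((hder p hp).congr_of_eventuallyEq (heq p hp0)).fderiv, affineChart_eq hp0, hF]
    rw [ContinuousLinearMap.comp_apply, hG' _ hpb,
      hηω _ (hball hpb) (inv_ne_zero hp0)]
    -- The factors `-(w ^ 2)⁻¹` taken at two mutually inverse points cancel.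
    congr 2
    · simp [invChart]
    · ext1
      · simp only [invChart, ContinuousLinearMap.prod_apply, smul_apply,
          ContinuousLinearMap.coe_fst', smul_eq_mul]
        field_simp
      · rfl
  · rintro _ ⟨p, hp, rfl⟩
    rw [hF]
    exact hGu p hp

theorem exists_localSolution (hω : IsHolomorphicForm u₀ r ω)
    (hflat : IsFlatForm ω (affinePart u₀ r)) {e : OnePoint ℂ × Par N} (he : e ∈ totalSpace u₀ r) :
    ∃ U, IsOpen U ∧ U ⊆ totalSpace u₀ r ∧ e ∈ U ∧ ∃ F, IsLocalSolution ω U F := by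
  rcases exists_chart e with ⟨p, rfl⟩ | ⟨u, rfl⟩
  · exact exists_localSolution_affine hω hflat he
  · exact exists_localSolution_infinity hω hflat he

/-- The ratio of two solutions of a linear equation is constant. -/
theorem fderiv_inverse_mul_eq_zero {E 𝔸 : Type*} [NormedAddCommGroup E] [NormedSpace ℂ E]
    [NormedRing 𝔸] [NormedAlgebra ℂ 𝔸] [CompleteSpace 𝔸] {F F' : E → 𝔸} {p v : E} {a : 𝔸}
    (hF : DifferentiableAt ℂ F p) (hF' : DifferentiableAt ℂ F' p) (hu : IsUnit (F' p))
    (h : fderiv ℂ F p v = a * F p) (h' : fderiv ℂ F' p v = a * F' p) :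
    fderiv ℂ (fun q => Ring.inverse (F' q) * F q) p v = 0 := by
  obtain ⟨x, hx⟩ := hu
  have hx' := hasFDerivAt_ringInverse (𝕜 := ℂ) x
  rw [hx] at hx'
  have h1 : HasFDerivAt (fun q => Ring.inverse (F' q)) _ p := hx'.comp p hF'.hasFDerivAt
  have h2 : HasFDerivAt (fun q => Ring.inverse (F' q) * F q) _ p := h1.mul' hF.hasFDerivAt
  rw [h2.fderiv]
  simp [h, h', ← hx, mul_assoc]

theorem differentiableAt_inverse_mul {E 𝔸 : Type*} [NormedAddCommGroup E] [NormedSpace ℂ E]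
    [NormedRing 𝔸] [NormedAlgebra ℂ 𝔸] [CompleteSpace 𝔸] {F F' : E → 𝔸} {p : E}
    (hF : DifferentiableAt ℂ F p) (hF' : DifferentiableAt ℂ F' p) (hu : IsUnit (F' p)) :
    DifferentiableAt ℂ (fun q => Ring.inverse (F' q) * F q) p := by
  obtain ⟨x, hx⟩ := hu
  exact (DifferentiableAt.comp p (hx ▸ differentiableAt_inverse (𝕜 := ℂ) x.isUnit) hF').mul hF

theorem eventually_const_of_fderiv_eq_zero {E F : Type*} [NormedAddCommGroup E] [NormedSpace ℂ E]
    [NormedAddCommGroup F] [NormedSpace ℂ F] {S : Set E} (hS : IsOpen S) {K : E → F}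
    (hK : DifferentiableOn ℂ K S) (h0 : ∀ p ∈ S, fderiv ℂ K p = 0) {p : E} (hp : p ∈ S) :
    ∀ᶠ q in 𝓝 p, K q = K p := by
  obtain ⟨δ, hδ, hball⟩ := Metric.nhds_basis_ball.mem_iff.1 (hS.mem_nhds hp)
  filter_upwards [Metric.ball_mem_nhds p hδ] with q hq
  exact Metric.isOpen_ball.is_const_of_fderiv_eq_zero (convex_ball p δ).isPreconnected
    (hK.mono hball) (fun x hx => h0 x (hball hx)) hq (Metric.mem_ball_self hδ)

/-- The differential of the ratio vanishes in the affine chart. In the chart at infinity this gives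
vanishing for `w ≠ 0`, and by continuity at `w = 0`, so no equation at infinity is needed. -/
theorem IsLocalSolution.eventually_ratio_eq {U U' : Set (OnePoint ℂ × Par N)} (hU : IsOpen U)
    (hU' : IsOpen U') {F F' : OnePoint ℂ × Par N → Mat n} (hF : IsLocalSolution ω U F)
    (hF' : IsLocalSolution ω U' F') {e : OnePoint ℂ × Par N} (he : e ∈ U ∩ U') :
    ∀ᶠ e' in 𝓝 e, Ring.inverse (F' e') * F e' = Ring.inverse (F' e) * F e := by
  have hUU := hU.inter hU'
  have haff : ∀ p, affineChart p ∈ U ∩ U' →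
      fderiv ℂ (fun q => Ring.inverse (F' (affineChart q)) * F (affineChart q)) p = 0 := by
    intro p hp
    have hS := hUU.preimage (isOpenEmbedding_affineChart (N := N)).continuous
    refine ContinuousLinearMap.ext fun v => ?_
    exact fderiv_inverse_mul_eq_zero
      (hF.holomorphic.1.differentiableAt ((hU.preimage
        isOpenEmbedding_affineChart.continuous).mem_nhds hp.1))
      (hF'.holomorphic.1.differentiableAt ((hU'.preimage
        isOpenEmbedding_affineChart.continuous).mem_nhds hp.2))
      (hF'.invertible _ hp.2) (hF.equation p hp.1 v) (hF'.equation p hp.2 v)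
  rcases exists_chart e with ⟨p, rfl⟩ | ⟨u, rfl⟩
  · rw [← isOpenEmbedding_affineChart.map_nhds_eq, eventually_map]
    refine eventually_const_of_fderiv_eq_zero
      (hUU.preimage isOpenEmbedding_affineChart.continuous) (fun q hq => ?_) haff he
    exact (differentiableAt_inverse_mul
      (hF.holomorphic.1.differentiableAt ((hU.preimage
        isOpenEmbedding_affineChart.continuous).mem_nhds hq.1))
      (hF'.holomorphic.1.differentiableAt ((hU'.preimage
        isOpenEmbedding_affineChart.continuous).mem_nhds hq.2))
      (hF'.invertible _ hq.2)).differentiableWithinAt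
  · rw [← isOpenEmbedding_infinityChart.map_nhds_eq, eventually_map]
    have hS : IsOpen (infinityChart ⁻¹' (U ∩ U') : Set (ℂ × Par N)) :=
      hUU.preimage isOpenEmbedding_infinityChart.continuous
    have hK : DifferentiableOn ℂ (fun q : ℂ × Par N =>
        Ring.inverse (F' (infinityChart q)) * F (infinityChart q))
        (infinityChart ⁻¹' (U ∩ U')) := fun q hq =>
      (differentiableAt_inverse_mul
        (hF.holomorphic.2.differentiableAt ((hU.preimage
          isOpenEmbedding_infinityChart.continuous).mem_nhds hq.1))
        (hF'.holomorphic.2.differentiableAt ((hU'.preimage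
          isOpenEmbedding_infinityChart.continuous).mem_nhds hq.2))
        (hF'.invertible _ hq.2)).differentiableWithinAt
    refine eventually_const_of_fderiv_eq_zero hS hK (fun q hq => ?_) he
    refine ContinuousOn.eq_zero_of_eq_zero_off_hyperplane hS (hK.fderiv_of_isOpen hS).continuousOn
      (fun q hq hq0 => ?_) hq
    have hq' : affineChart (invChart q) ∈ U ∩ U' := by
      rw [← infinityChart_eq hq0]; exact hq
    have hd : DifferentiableAt ℂ
        (fun q => Ring.inverse (F' (affineChart q)) * F (affineChart q)) (invChart q) :=
      differentiableAt_inverse_mul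
        (hF.holomorphic.1.differentiableAt ((hU.preimage
          isOpenEmbedding_affineChart.continuous).mem_nhds hq'.1))
        (hF'.holomorphic.1.differentiableAt ((hU'.preimage
          isOpenEmbedding_affineChart.continuous).mem_nhds hq'.2))
        (hF'.invertible _ hq'.2)
    have h1 := hd.hasFDerivAt.comp q (hasFDerivAt_invChart hq0)
    rw [haff _ hq', ContinuousLinearMap.zero_comp] at h1
    refine (h1.congr_of_eventuallyEq ?_).fderiv
    filter_upwards [isOpen_fst_ne_zero.mem_nhds hq0] with q' hq'
    rw [infinityChart_eq hq']
    rfl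

theorem IsLocalSolution.mul_const {U : Set (OnePoint ℂ × Par N)} (hU : IsOpen U)
    {F : OnePoint ℂ × Par N → Mat n} (hF : IsLocalSolution ω U F) {m : Mat n} (hm : IsUnit m) :
    IsLocalSolution ω U fun e => F e * m where
  holomorphic := ⟨hF.holomorphic.1.mul_const m, hF.holomorphic.2.mul_const m⟩
  equation p hp v := by
    have h := (hF.holomorphic.1.differentiableAt ((hU.preimage
      isOpenEmbedding_affineChart.continuous).mem_nhds hp)).hasFDerivAt.mul_const' m
    have h' : HasFDerivAt ((fun e => F e * m) ∘ affineChart) _ p := h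
    rw [h'.fderiv]
    simp [hF.equation p hp v, mul_assoc]
  invertible e he := (hF.invertible e he).mul hm

/-- An integrable form has an isomonodromic fundamental matrix. -/
theorem exists_isIsomonodromicFundamentalMatrix (hω : IsHolomorphicForm u₀ r ω)
    (hflat : IsFlatForm ω (affinePart u₀ r)) (e₀ : totalSpace u₀ r) :
    ∃ Y : UCover e₀ → Mat n, IsIsomonodromicFundamentalMatrix ω Y := by
  choose U hU hUE heU F hF using fun e : totalSpace u₀ r => exists_localSolution hω hflat e.2
  classical
  let f : LocalBranches (totalSpace u₀ r) (Mat n)ˣ :=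
    { dom := fun e => Subtype.val ⁻¹' U e
      val := fun e e' => if h : (e' : OnePoint ℂ × Par N) ∈ U e then
        ((hF e).invertible e' h).unit else 1
      isOpen_dom := fun e => (hU e).preimage continuous_subtype_val
      mem_dom := heU
      locallyConstant := by
        rintro e e' x ⟨hx, hx'⟩
        have h1 := (continuous_subtype_val.tendsto x).eventually
          ((hF e).eventually_ratio_eq (hU e) (hU e') (hF e') ⟨hx, hx'⟩)
        have h2 := (continuous_subtype_val.tendsto x).eventually
          (((hU e).inter (hU e')).mem_nhds ⟨hx, hx'⟩)
        have key : ∀ y : totalSpace u₀ r, ∀ (h : (y : OnePoint ℂ × Par N) ∈ U e)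
            (h' : (y : OnePoint ℂ × Par N) ∈ U e'),
            (((((hF e').invertible y h').unit⁻¹ * ((hF e).invertible y h).unit : (Mat n)ˣ)) :
              Mat n) = Ring.inverse (F e' y) * F e y := fun y h h' => by
          rw [Units.val_mul, IsUnit.unit_spec, ← Ring.inverse_unit, IsUnit.unit_spec]
        filter_upwards [h1, h2] with y hy1 hy2
        have hyU : (y : OnePoint ℂ × Par N) ∈ U e := hy2.1
        have hyU' : (y : OnePoint ℂ × Par N) ∈ U e' := hy2.2
        have hx : (x : OnePoint ℂ × Par N) ∈ U e := hx
        have hx' : (x : OnePoint ℂ × Par N) ∈ U e' := hx'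
        ext1
        rw [dif_pos hyU, dif_pos hyU', dif_pos hx, dif_pos hx']
        exact (key y hyU hyU').trans (hy1.trans (key x hx hx').symm) }
  have hval : ∀ e e' : totalSpace u₀ r, (e' : OnePoint ℂ × Par N) ∈ U e →
      (f.val e e' : Mat n) = F e e' := fun e e' h => by
    have h' : f.val e e' = ((hF e).invertible e' h).unit := dif_pos h
    rw [h', IsUnit.unit_spec]
  obtain ⟨Y, hY1, hY2⟩ := f.exists_multivalued e₀
  refine ⟨fun q => Y q, ⟨fun q => (Y q).isUnit, fun e q => ?_⟩, fun g => ?_⟩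
  · obtain ⟨m, hm⟩ := hY1 e q
    have hFm := (hF e).mul_const (hU e) m.isUnit
    refine ⟨U e, hU e, hUE e, heU e, fun e' => F e e' * m, hFm.holomorphic, hFm.equation,
      fun e' c hc => ?_⟩
    rw [hm e' c hc, Units.val_mul, hval e e' (by simpa using hc 1)]
  · obtain ⟨M, hM⟩ := hY2 g
    exact ⟨M, fun e q => by rw [hM e q, Units.val_mul]⟩

end LocalSolutions

end Fuchsian

namespace Fuchsian

/-! ### Fundamental matrices near a pole -/

section NearPole

open Set Filter
open scoped Matrix.Norms.L2Operator

variable {n N : ℕ} {u₀ : Par N} {r : Fin N → ℝ} {ω : Form n N}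

theorem exists_path_subtype {X : Type*} [TopologicalSpace X] {S T : Set X} (hT : T ⊆ S) {x y : X}
    (h : JoinedIn T x y) (hx : x ∈ S) (hy : y ∈ S) :
    ∃ c : Path (⟨x, hx⟩ : S) ⟨y, hy⟩, ∀ t, (c t : X) ∈ T := by
  obtain ⟨γ, hγ⟩ := h
  exact ⟨⟨⟨fun t => ⟨γ t, hT (hγ t)⟩, by fun_prop⟩, by simp, by simp⟩, hγ⟩

/-- The point of the tube with coordinates `(x, u)`, `x = log (z - uᵢ)`. -/
noncomputable def tubeMap (i : Fin N) (h : ℂ × Par N) : ℂ × Par N := (h.2 i + Complex.exp h.1, h.2)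

theorem hasFDerivAt_tubeMap (i : Fin N) (h : ℂ × Par N) :
    HasFDerivAt (tubeMap i) ((du i + Complex.exp h.1 • dz N).prod
      (ContinuousLinearMap.snd ℂ ℂ (Par N))) h := by
  refine HasFDerivAt.prodMk ?_ hasFDerivAt_snd
  refine (du i).hasFDerivAt.fun_add ?_
  exact (Complex.hasDerivAt_exp h.1).comp_hasFDerivAt h hasFDerivAt_fst

theorem differentiable_tubeMap (i : Fin N) : Differentiable ℂ (tubeMap i) := fun h =>
  (hasFDerivAt_tubeMap i h).differentiableAt

theorem isOpen_logTube (u₀ : Par N) (r : Fin N → ℝ) (ρ : ℝ) : IsOpen (logTube u₀ r ρ) :=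
  (isOpen_lt (Complex.continuous_re.comp continuous_fst) continuous_const).inter
    ((isOpen_polydisc u₀ r).preimage continuous_snd)

theorem convex_logTube (u₀ : Par N) (r : Fin N → ℝ) (ρ : ℝ) : Convex ℝ (logTube u₀ r ρ) := by
  have : logTube u₀ r ρ = {z : ℂ | z.re < Real.log ρ} ×ˢ polydisc u₀ r := rfl
  rw [this]
  exact (convex_halfSpace_re_lt _).prod (convex_polydisc u₀ r)

theorem norm_exp_lt {ρ : ℝ} (hρ : 0 < ρ) {x : ℂ} (hx : x.re < Real.log ρ) :
    ‖Complex.exp x‖ < ρ := by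
  rw [Complex.norm_exp]
  exact (Real.lt_log_iff_exp_lt hρ).1 hx

/-- In logarithmic coordinates near a pole, a fundamental matrix of `dY = ω Y` is a solution of
the pulled back equation. -/
theorem IsFundamentalMatrix.hasFDerivAt_lift {e₀ : totalSpace u₀ r} {Y : UCover e₀ → Mat n}
    (hY : IsFundamentalMatrix ω Y) {i : Fin N} {ρ : ℝ} {φ : C(logTube u₀ r ρ, totalSpace u₀ r)}
    {ℓ : ∀ h, Path.Homotopic.Quotient e₀ (φ h)}
    (hφ : ∀ h : logTube u₀ r ρ, (φ h : OnePoint ℂ × Par N) = affineChart (tubeMap i h))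
    (hℓ : IsLift φ ℓ) {Ψ : ℂ × Par N → Mat n} (hΨ : ∀ h : logTube u₀ r ρ, Ψ h = Y ⟨φ h, ℓ h⟩)
    {h : ℂ × Par N} (hh : h ∈ logTube u₀ r ρ) :
    DifferentiableAt ℂ Ψ h ∧ ∀ v : ℂ × Par N, fderiv ℂ Ψ h v =
      ω (tubeMap i h) (v.2 i + Complex.exp h.1 * v.1, v.2) * Ψ h := by
  obtain ⟨U, hU, hUE, heU, F, hF, hF', hYF⟩ := hY.solution (φ ⟨h, hh⟩) (ℓ ⟨h, hh⟩)
  rw [hφ] at heU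
  have hcont : Continuous fun h : ℂ × Par N => affineChart (tubeMap i h) :=
    isOpenEmbedding_affineChart.continuous.comp (differentiable_tubeMap i).continuous
  obtain ⟨δ, hδ, hball⟩ := Metric.nhds_basis_ball.mem_iff.1
    (((isOpen_logTube u₀ r ρ).inter (hU.preimage hcont)).mem_nhds ⟨hh, heU⟩)
  have hmem := Metric.mem_ball_self (x := h) hδ
  -- A path inside the ball has its image inside `U`, so the lift property continues `Y` by the
  -- single-valued branch `F`.
  have heq : ∀ h' ∈ Metric.ball h δ, Ψ h' = F (affineChart (tubeMap i h')) := by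
    intro h' hh'
    have hj : JoinedIn (Metric.ball h δ) h h' :=
      ((convex_ball h δ).isPathConnected ⟨h, hmem⟩).joinedIn _ hmem _ hh'
    obtain ⟨c, hc⟩ := exists_path_subtype (fun x hx => (hball hx).1) hj hh (hball hh').1
    rw [hΨ ⟨h', (hball hh').1⟩, hℓ _ _ c, hYF _ (c.map φ.continuous), hφ]
    intro t
    rw [Path.map_coe, Function.comp_apply, hφ]
    exact (hball (hc t)).2
  have hFd : HasFDerivAt (F ∘ affineChart) (fderiv ℂ (F ∘ affineChart) (tubeMap i h))
      (tubeMap i h) :=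
    (hF.1.differentiableAt ((hU.preimage isOpenEmbedding_affineChart.continuous).mem_nhds
      heU)).hasFDerivAt
  have h1 := (hFd.comp h (hasFDerivAt_tubeMap i h)).congr_of_eventuallyEq
    (f₁ := Ψ) (by filter_upwards [Metric.ball_mem_nhds h hδ] with h' hh' using heq h' hh')
  refine ⟨h1.differentiableAt, fun v => ?_⟩
  rw [h1.fderiv, heq h hmem, ContinuousLinearMap.comp_apply, hF' _ heU]
  rfl

/-- The source is convex, hence simply connected: the class of the image of a path from `h₀` depends
only on its end point, so arbitrary choices of paths are compatible. -/
theorem exists_isLift {e₀ : totalSpace u₀ r} {ρ : ℝ} (φ : C(logTube u₀ r ρ, totalSpace u₀ r))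
    {h₀ : logTube u₀ r ρ} (h : Joined e₀ (φ h₀)) :
    ∃ ℓ : ∀ h, Path.Homotopic.Quotient e₀ (φ h), IsLift φ ℓ := by
  have : ContractibleSpace (logTube u₀ r ρ) :=
    (convex_logTube u₀ r ρ).contractibleSpace ⟨h₀, h₀.2⟩
  have hc : ∀ x : logTube u₀ r ρ, Nonempty (Path h₀ x) := fun x => PathConnectedSpace.joined h₀ x
  obtain ⟨γ⟩ := h
  refine ⟨fun x => (Path.Homotopic.Quotient.mk γ).trans
    (Path.Homotopic.Quotient.mk ((hc x).some.map φ.continuous)), fun x x' c => ?_⟩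
  have h1 : Path.Homotopic.Quotient.mk (hc x').some =
      Path.Homotopic.Quotient.mk ((hc x).some.trans c) :=
    Path.Homotopic.Quotient.eq.2 (SimplyConnectedSpace.paths_homotopic _ _)
  have h2 := congrArg (fun q => Path.Homotopic.Quotient.map q φ) h1
  simp only [← Path.Homotopic.Quotient.mk_map, Path.map_trans] at h2
  dsimp only
  rw [h2, ← Path.Homotopic.Quotient.mk_trans, ← Path.Homotopic.Quotient.mk_trans,
    ← Path.Homotopic.Quotient.mk_trans, Path.Homotopic.Quotient.eq]
  exact (Path.Homotopic.trans_assoc _ _ _).symm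

/-- A radius for which the tubes around the pole `z = uᵢ` contain no other pole. -/
theorem exists_tube_radius (hr : ∀ i, 0 < r i)
    (hdisj : ∀ i j, i ≠ j →
      Disjoint (Metric.closedBall (u₀ i) (r i)) (Metric.closedBall (u₀ j) (r j))) (i : Fin N) :
    ∃ ρ : ℝ, 0 < ρ ∧ ∀ u ∈ polydisc u₀ r, ∀ x : ℂ, ‖x‖ < ρ → ∀ j ≠ i, x + u i - u j ≠ 0 := by
  have h1 : ∀ᶠ ρ : ℝ in 𝓝[>] 0, ∀ j, j ≠ i → ρ + (r i + r j) < dist (u₀ i) (u₀ j) := by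
    rw [eventually_all]
    intro j
    by_cases hj : j = i
    · simp [hj]
    · have h2 := (disjoint_closedBall_closedBall_iff (hr i).le (hr j).le).1
        (hdisj i j (Ne.symm hj))
      have h3 : ContinuousAt (fun ρ : ℝ => ρ + (r i + r j)) 0 := by fun_prop
      filter_upwards [nhdsWithin_le_nhds (h3.eventually_lt_const (by simpa using h2))]
        with ρ hρ _ using hρ
  obtain ⟨ρ, h1, h0⟩ := (h1.and self_mem_nhdsWithin).exists
  refine ⟨ρ, h0, fun u hu x hx j hj h => ?_⟩
  have h2 := h1 j hj
  have h3 : u₀ i - u₀ j = -(u i - u₀ i) + (u j - u₀ j) - x := by linear_combination h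
  have h4 := Metric.mem_ball.1 (hu i)
  have h5 := Metric.mem_ball.1 (hu j)
  rw [dist_eq_norm] at h2 h4 h5
  rw [h3] at h2
  have h6 := norm_sub_le (-(u i - u₀ i) + (u j - u₀ j)) x
  have h7 := norm_add_le (-(u i - u₀ i)) (u j - u₀ j)
  rw [norm_neg] at h7
  linarith

/-- The parametrization of a tube without its pole, as a map to the total space. -/
theorem exists_tube_parametrization {i : Fin N} {ρ : ℝ} (hρ : 0 < ρ)
    (hsep : ∀ u ∈ polydisc u₀ r, ∀ x : ℂ, ‖x‖ < ρ → ∀ j ≠ i, x + u i - u j ≠ 0) :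
    ∃ φ : C(logTube u₀ r ρ, totalSpace u₀ r),
      ∀ h : logTube u₀ r ρ, (φ h : OnePoint ℂ × Par N) = affineChart (tubeMap i h) := by
  have hcont : Continuous fun h : ℂ × Par N => affineChart (tubeMap i h) :=
    isOpenEmbedding_affineChart.continuous.comp (differentiable_tubeMap i).continuous
  suffices hmem : ∀ h : logTube u₀ r ρ, affineChart (tubeMap i h) ∈ totalSpace u₀ r from
    ⟨⟨fun h => ⟨affineChart (tubeMap i h), hmem h⟩,
      Continuous.subtype_mk (hcont.comp continuous_subtype_val) _⟩, fun h => rfl⟩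
  intro h
  change tubeMap i h ∈ affinePart u₀ r
  refine mem_affinePart.2 ⟨h.2.2, fun j => ?_⟩
  by_cases hj : j = i
  · simp [tubeMap, hj, Complex.exp_ne_zero]
  · have := hsep h.1.2 h.2.2 (Complex.exp h.1.1) (norm_exp_lt hρ h.2.1) j hj
    intro h'
    apply this
    simp only [tubeMap] at h'
    rw [← h']
    ring

/-- For fixed `u`, a finite set of points does not disconnect the plane. -/
theorem joinedIn_affinePart {p q : ℂ × Par N} (hp : p ∈ affinePart u₀ r)
    (hq : q ∈ affinePart u₀ r) (h : p.2 = q.2) : JoinedIn (affinePart u₀ r) p q := by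
  obtain ⟨z, u⟩ := p
  obtain ⟨z', u'⟩ := q
  obtain rfl : u = u' := h
  have hmem : ∀ z, (z, u) ∈ affinePart u₀ r ↔ z ∈ (range u)ᶜ := fun z => by
    rw [mem_affinePart, mem_compl_iff, mem_range, not_exists]
    exact ⟨fun h i => (h.2 i).symm, fun h => ⟨(mem_affinePart.1 hp).1, fun i hi => h i hi.symm⟩⟩
  have hconn : IsPathConnected ((range u)ᶜ : Set ℂ) :=
    (finite_range u).countable.isPathConnected_compl_of_one_lt_rank (by
      rw [Complex.rank_real_complex]; norm_num)
  obtain ⟨γ, hγ⟩ := hconn.joinedIn z ((hmem z).1 hp) z' ((hmem z').1 hq)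
  refine ⟨γ.map (f := fun z => (z, u)) (by fun_prop), fun t => ?_⟩
  exact (hmem _).2 (hγ t)

theorem joined_affineChart (e : totalSpace u₀ r) :
    ∀ q ∈ affinePart u₀ r, q.2 = e.1.2 → JoinedIn (totalSpace u₀ r) e (affineChart q) := by
  have himg : ∀ p ∈ affinePart u₀ r, ∀ q ∈ affinePart u₀ r, p.2 = q.2 →
      JoinedIn (totalSpace u₀ r) (affineChart p) (affineChart q) := fun p hp q hq h => by
    obtain ⟨γ, hγ⟩ := joinedIn_affinePart hp hq h
    exact ⟨γ.map isOpenEmbedding_affineChart.continuous, fun t => hγ t⟩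
  obtain ⟨e, he⟩ := e
  rcases exists_chart e with ⟨p, rfl⟩ | ⟨u, rfl⟩
  · exact fun q hq h => himg p he q hq h.symm
  · intro q hq h
    obtain ⟨δ, hδ, hball⟩ := Metric.nhds_basis_ball.mem_iff.1
      ((isOpen_infinityPart u₀ r).mem_nhds (x := (0, u)) he)
    -- From the point at infinity a short path in the coordinate `w` leads to the finite point with
    -- `w = δ / 2`.
    have hδ2 : ((δ / 2 : ℝ) : ℂ) ≠ 0 := by
      exact_mod_cast (half_pos hδ).ne'
    have hs : (((δ / 2 : ℝ) : ℂ), u) ∈ Metric.ball ((0 : ℂ), u) δ := by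
      rw [Metric.mem_ball, Prod.dist_eq]
      simp only [dist_self, dist_zero_right, Complex.norm_real, Real.norm_eq_abs]
      rw [abs_of_pos (half_pos hδ)]
      simpa using hδ
    obtain ⟨γ, hγ⟩ := ((convex_ball ((0 : ℂ), u) δ).isPathConnected
      ⟨_, Metric.mem_ball_self hδ⟩).joinedIn _ (Metric.mem_ball_self hδ) _ hs
    have h1 : JoinedIn (totalSpace u₀ r) (infinityChart (0, u))
        (infinityChart (((δ / 2 : ℝ) : ℂ), u)) :=
      ⟨γ.map isOpenEmbedding_infinityChart.continuous, fun t => hball (hγ t)⟩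
    rw [infinityChart_eq (p := (((δ / 2 : ℝ) : ℂ), u)) hδ2] at h1
    exact h1.trans (himg _ h1.target_mem q hq h.symm)

/-- The universal covering of a tube without its pole can be lifted to the universal covering of
the total space. -/
theorem exists_tube_lift (e₀ : totalSpace u₀ r) {i : Fin N} {ρ : ℝ} (hρ : 0 < ρ)
    (hsep : ∀ u ∈ polydisc u₀ r, ∀ x : ℂ, ‖x‖ < ρ → ∀ j ≠ i, x + u i - u j ≠ 0) :
    ∃ (φ : C(logTube u₀ r ρ, totalSpace u₀ r)) (ℓ : ∀ h, Path.Homotopic.Quotient e₀ (φ h)),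
      (∀ h : logTube u₀ r ρ, (φ h : OnePoint ℂ × Par N) = affineChart (tubeMap i h)) ∧
      IsLift φ ℓ := by
  obtain ⟨φ, hφ⟩ := exists_tube_parametrization hρ hsep
  -- A point of the tube over the same parameter as `e₀`, so that only `z` has to move.
  have hmem : (((Real.log ρ - 1 : ℝ) : ℂ), e₀.1.2) ∈ logTube u₀ r ρ :=
    ⟨by simp, e₀.2.1⟩
  have hj : JoinedIn (totalSpace u₀ r) e₀ (φ ⟨_, hmem⟩ : OnePoint ℂ × Par N) := by
    rw [hφ]
    refine joined_affineChart e₀ _ ?_ rfl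
    have := (φ ⟨_, hmem⟩).2
    rwa [hφ] at this
  obtain ⟨ℓ, hℓ⟩ := exists_isLift (e₀ := e₀) φ (h₀ := ⟨_, hmem⟩) hj.joined_subtype
  exact ⟨φ, ℓ, hφ, hℓ⟩

end NearPole

end Fuchsian

namespace Fuchsian

/-! ### Levelt exponents -/

section Exponents

open Set Filter

variable {n : ℕ}

theorem intPow_mul_mul_apply (x : ℂ) (D D' : Fin n → ℤ) (M : Mat n) (a b : Fin n) :
    (intPow x D * M * intPow x D') a b = x ^ D a * M a b * x ^ D' b := by
  simp [intPow, Matrix.mul_diagonal, Matrix.diagonal_mul]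

theorem intPow_mul_intPow_neg {x : ℂ} (hx : x ≠ 0) (D : Fin n → ℤ) :
    intPow x D * intPow x (-D) = 1 := by
  rw [intPow, intPow, Matrix.diagonal_mul_diagonal, ← Matrix.diagonal_one]
  congr 1
  funext a
  rw [Pi.neg_apply, zpow_neg]
  exact mul_inv_cancel₀ (zpow_ne_zero _ hx)

theorem isUnit_intPow {x : ℂ} (hx : x ≠ 0) (D : Fin n → ℤ) : IsUnit (intPow x D) :=
  IsUnit.of_mul_eq_one _ (intPow_mul_intPow_neg hx D)

/-- The characteristic polynomial of the residue is determined by the exponents. -/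
theorem charpoly_of_tendsto {D : Fin n → ℤ} {L B : Mat n} (hL : ∀ a b, b < a → L a b = 0)
    {G : ℂ → Mat n} {c : ℂ} (hG : ∀ᶠ z in 𝓝[≠] c, IsUnit (G z))
    (h : Tendsto (fun z : ℂ => G z * (Matrix.diagonal (fun a => (D a : ℂ)) +
      intPow (z - c) D * L * intPow (z - c) (-D)) * (G z)⁻¹) (𝓝[≠] c) (𝓝 B)) :
    B.charpoly = ∏ a, (Polynomial.X - Polynomial.C ((D a : ℂ) + L a a)) := by
  refine Polynomial.funext fun t => ?_
  rw [Matrix.eval_charpoly]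
  have hcont : Continuous fun M : Mat n => (Matrix.scalar (Fin n) t - M).det := by fun_prop
  refine tendsto_nhds_unique ((hcont.tendsto B).comp h) (tendsto_const_nhds.congr' ?_)
  filter_upwards [hG, self_mem_nhdsWithin] with z hz hzc
  have hzc : z - c ≠ 0 := sub_ne_zero.2 hzc
  have h1 : ∀ M : Mat n, (Matrix.scalar (Fin n) t - M).det = M.charpoly.eval t := fun M => by
    rw [Matrix.eval_charpoly]
  set R := Matrix.diagonal (fun a => (D a : ℂ)) + intPow (z - c) D * L * intPow (z - c) (-D)
    with hR
  have h2 : (Matrix.scalar (Fin n) t - G z * R * (G z)⁻¹).det =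
      (Matrix.scalar (Fin n) t - R).det := by
    rw [← Matrix.det_conj hz (Matrix.scalar (Fin n) t - R), mul_sub, sub_mul]
    congr 2
    rw [← (Matrix.scalar_commute t (fun _ => Commute.all _ _) (G z)).eq, mul_assoc,
      Matrix.mul_nonsing_inv _ ((Matrix.isUnit_iff_isUnit_det _).1 hz), mul_one]
  change _ = (Matrix.scalar (Fin n) t - G z * R * (G z)⁻¹).det
  -- Conjugation by a diagonal matrix preserves triangularity and the diagonal of `L`.
  have h3' : ∀ a b : Fin n, b < a → R a b = 0 := fun a b hab => by
    rw [hR, Matrix.add_apply, intPow_mul_mul_apply, hL a b hab,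
      Matrix.diagonal_apply_ne _ (ne_of_gt hab)]
    simp
  have h3 : R.IsUpperTriangular := fun a b hab => h3' a b hab
  rw [h2, h1, Matrix.charpoly_of_isUpperTriangular R h3]
  congr 1
  refine Finset.prod_congr rfl fun a _ => ?_
  rw [hR, Matrix.add_apply, intPow_mul_mul_apply]
  have h4 : (z - c) ^ D a * L a a * (z - c) ^ (-D) a = L a a := by
    rw [Pi.neg_apply, zpow_neg]
    field_simp
  rw [h4, Matrix.diagonal_apply_eq]

/-- Real parts in `[0, 1)` allow each eigenvalue to be split uniquely into integer and block
eigenvalue. If `D' a < D a`, count in the block of `a` the integers at least `D' a + 1`: by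
monotonicity every index counted for `D'` precedes `a` and is counted for `D`, and `a` itself is
counted for `D` only. -/
theorem IsLeveltExponent.le_of_multiset_eq {D D' : Fin n → ℤ} {L : Mat n}
    (hD : IsLeveltExponent D L) (hD' : IsLeveltExponent D' L)
    (h : Multiset.map (fun a => (D a : ℂ) + L a a) Finset.univ.val =
      Multiset.map (fun a => (D' a : ℂ) + L a a) Finset.univ.val) (a : Fin n) : D a ≤ D' a := by
  classical
  by_contra! hlt
  have hcard : ∀ D : Fin n → ℤ, Multiset.countP (fun μ : ℂ => ∃ k : ℤ, D' a + 1 ≤ k ∧ μ = k + L a a)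
      (Multiset.map (fun a => (D a : ℂ) + L a a) Finset.univ.val) =
      (Finset.univ.filter fun b => L b b = L a a ∧ D' a + 1 ≤ D b).card := by
    intro D
    rw [Multiset.countP_map, Finset.card_def, Finset.filter_val]
    congr 1
    refine Multiset.filter_congr fun b _ => ⟨?_, fun ⟨h1, h2⟩ => ⟨D b, h2, by rw [h1]⟩⟩
    rintro ⟨k, hk, hk'⟩
    have h1 := congrArg Complex.re hk'
    simp only [Complex.add_re, Complex.intCast_re] at h1
    have h2 := hD.re_nonneg a
    have h3 := hD.re_lt_one a
    have h4 := hD.re_nonneg b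
    have h5 := hD.re_lt_one b
    have h6 : (D b : ℝ) < k + 1 := by linarith
    have h7 : (k : ℝ) < D b + 1 := by linarith
    have h8 : D b = k := by
      have : D b < k + 1 := by exact_mod_cast h6
      have : k < D b + 1 := by exact_mod_cast h7
      omega
    rw [h8] at hk'
    exact ⟨add_left_cancel hk', h8 ▸ hk⟩
  have h1 := hcard D
  rw [h, hcard D'] at h1
  refine absurd h1 (ne_of_lt (Finset.card_lt_card ?_))
  rw [Finset.ssubset_iff_of_subset]
  · exact ⟨a, by simp; omega, by simp⟩
  · intro b hb
    simp only [Finset.mem_filter, Finset.mem_univ, true_and] at hb ⊢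
    refine ⟨hb.1, ?_⟩
    have hba : b ≤ a := by
      by_contra! hab
      have := hD'.antitone a b hab.le hb.1.symm
      omega
    have := hD.antitone b a hba hb.1
    omega

/-- A continuous family of matrices with the exponents `D u`, `L` has constant `D u`. -/
theorem isConstantOn_of_charpoly {N : ℕ} {u₀ : Par N} {r : Fin N → ℝ} {D : Par N → Fin n → ℤ}
    {L : Mat n} {B : Par N → Mat n} (hB : ContinuousOn B (polydisc u₀ r))
    (hD : ∀ u ∈ polydisc u₀ r, IsLeveltExponent (D u) L)
    (h : ∀ u ∈ polydisc u₀ r, (B u).charpoly =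
      ∏ a, (Polynomial.X - Polynomial.C ((D u a : ℂ) + L a a))) :
    IsConstantOn u₀ r D := by
  intro u hu u' hu'
  suffices hpoly : (B u).charpoly = (B u').charpoly by
    have hroots : ∀ u, (∏ a, (Polynomial.X - Polynomial.C ((D u a : ℂ) + L a a))).roots =
        Multiset.map (fun a => (D u a : ℂ) + L a a) Finset.univ.val := fun u => by
      rw [← Polynomial.roots_multiset_prod_X_sub_C
        (Multiset.map (fun a => (D u a : ℂ) + L a a) Finset.univ.val), Multiset.map_map]
      rfl
    rw [h u hu, h u' hu'] at hpoly
    have hm := congrArg Polynomial.roots hpoly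
    rw [hroots, hroots] at hm
    exact funext fun a => le_antisymm ((hD u hu).le_of_multiset_eq (hD u' hu') hm a)
      ((hD u' hu').le_of_multiset_eq (hD u hu) hm.symm a)
  refine Polynomial.funext fun t => ?_
  have hcont : ContinuousOn (fun u => (B u).charpoly.eval t) (polydisc u₀ r) := by
    simp only [Matrix.eval_charpoly]
    have h1 : Continuous fun M : Mat n => (Matrix.scalar (Fin n) t - M).det := by fun_prop
    exact h1.comp_continuousOn hB
  -- At a fixed `t` the characteristic polynomial takes values in a countable set, and a connected
  -- subset of a countable set is a point.
  have hcount : (range fun d : Fin n → ℤ => ∏ a, (t - ((d a : ℂ) + L a a))).Countable :=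
    countable_range _
  have himg := ((convex_polydisc u₀ r).isPreconnected.image _ hcont)
  refine hcount.isTotallyDisconnected _ ?_ himg (mem_image_of_mem _ hu) (mem_image_of_mem _ hu')
  rintro _ ⟨w, hw, rfl⟩
  refine ⟨D w, ?_⟩
  simp [h w hw, Polynomial.eval_prod]

end Exponents

/-! ### Constant exponents and connection matrices imply the Schlesinger property -/

section Converse

open Set Filter
open scoped Matrix.Norms.L2Operator

variable {n N : ℕ} {u₀ : Par N} {r : Fin N → ℝ} {A : Fin N → Par N → Mat n} {ω : Form n N}

/-- The limit condition makes the numbers `D u a + L a a` the eigenvalues of the continuous family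
`A i`. This is why constancy of `D` need not be assumed in addition to that of `L`. -/
theorem IsLeveltForm.isConstantOn_exponents {e₀ : totalSpace u₀ r} {Y : UCover e₀ → Mat n}
    {i : Fin N} {D : Par N → Fin n → ℤ} {L C : Par N → Mat n} (h : IsLeveltForm A Y i D L C)
    (hA : DifferentiableOn ℂ (A i) (polydisc u₀ r)) (hL : IsConstantOn u₀ r L) :
    IsConstantOn u₀ r D := by
  obtain ⟨-, -, -, hexp, ρ, Yhat, hρ, hYd, hYu, -, hlim, -⟩ := h
  intro u hu
  have hexp' : ∀ u' ∈ polydisc u₀ r, IsLeveltExponent (D u') (L u) := fun u' hu' => by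
    rw [hL u hu u' hu']
    exact hexp u' hu'
  refine isConstantOn_of_charpoly hA.continuousOn hexp' (fun u' hu' => ?_) u hu
  rw [hL u hu u' hu']
  refine charpoly_of_tendsto (hexp u' hu').triangular ?_ (hlim u' hu')
  have hball : Metric.ball (u' i) ρ ∈ 𝓝[≠] (u' i) :=
    nhdsWithin_le_nhds (Metric.ball_mem_nhds _ hρ)
  filter_upwards [hball] with z hz
  exact hYu _ ⟨by rwa [← dist_eq_norm], hu'⟩

/-- If `D`, `L` and `C` are constant, the form `ω` is bounded near the pole in the directions
tangent to the pole. -/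
theorem IsLeveltForm.apply_tangent {e₀ : totalSpace u₀ r} {Y : UCover e₀ → Mat n}
    (hY : IsFundamentalMatrix ω Y)
    {i : Fin N} {D : Par N → Fin n → ℤ} {L C : Par N → Mat n} (h : IsLeveltForm A Y i D L C)
    (hD : IsConstantOn u₀ r D) (hL : IsConstantOn u₀ r L) (hC : IsConstantOn u₀ r C) :
    ∃ (ρ : ℝ) (g : Par N → ℂ × Par N → Mat n), 0 < ρ ∧
      (∀ v, ContinuousOn (g v) (tube u₀ r i ρ)) ∧
      ∀ p ∈ tube u₀ r i ρ, p.1 ≠ p.2 i → ∀ v : Par N, ω p (v i, v) = g v p := by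
  obtain ⟨-, -, -, -, ρ, Yhat, hρ, hYd, hYu, -, -, φ, ℓ, hφ, hℓ, hform⟩ := h
  have htube : IsOpen (tube u₀ r i ρ) := by
    have h1 : Continuous fun p : ℂ × Par N => ‖p.1 - p.2 i‖ := by fun_prop
    exact (isOpen_lt h1 continuous_const).inter
      ((isOpen_polydisc u₀ r).preimage continuous_snd)
  refine ⟨ρ, fun v p => fderiv ℂ Yhat p (v i, v) * Ring.inverse (Yhat p), hρ, fun v p hp => ?_, ?_⟩
  · have h1 := (hYd.fderiv_apply_of_isOpen htube (v i, v) p hp).continuousWithinAt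
    have h2 : DifferentiableAt ℂ (fun p => Ring.inverse (Yhat p)) p :=
      DifferentiableAt.comp p (differentiableAt_inverse (hYu p hp))
        (hYd.differentiableAt (htube.mem_nhds hp))
    exact h1.mul h2.continuousAt.continuousWithinAt
  · intro p hp hpi v
    have hne : p.1 - p.2 i ≠ 0 := sub_ne_zero.2 hpi
    set h : ℂ × Par N := (Complex.log (p.1 - p.2 i), p.2) with hh
    have htm : tubeMap i h = p := by
      refine Prod.ext ?_ rfl
      simp [tubeMap, hh, Complex.exp_log hne]
    have hmem : h ∈ logTube u₀ r ρ := by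
      refine ⟨?_, hp.2⟩
      rw [hh, Complex.log_re]
      exact Real.log_lt_log (norm_pos_iff.2 hne) hp.1
    -- Tangent vectors keep `z - uᵢ` fixed, so this factor is constant along them and cancels from
    -- `dY * Y⁻¹`, leaving `dŶ * Ŷ⁻¹`.
    set M : ℂ → Mat n := fun x => intPow (Complex.exp x) (D p.2) * NormedSpace.exp (x • L p.2) *
      C p.2 with hM
    set Ψ : ℂ × Par N → Mat n := fun q => Yhat (tubeMap i q) * M q.1 with hΨ
    have hΨY : ∀ q : logTube u₀ r ρ, Ψ q = Y ⟨φ q, ℓ q⟩ := fun q => by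
      rw [hform, hD _ q.2.2 _ hp.2, hL _ q.2.2 _ hp.2, hC _ q.2.2 _ hp.2, hΨ, hM]
      simp only [tubeMap, mul_assoc]
    obtain ⟨hd, hder⟩ := hY.hasFDerivAt_lift hφ hℓ hΨY hmem
    have hunit : IsUnit (Ψ h) := by
      rw [hΨY ⟨h, hmem⟩]
      exact hY.invertible _
    have hline : HasDerivAt (fun t : ℂ => h + t • ((0 : ℂ), v)) (0, v) 0 := by
      simpa using ((hasDerivAt_id (0 : ℂ)).smul_const ((0 : ℂ), v)).const_add h
    have h1 : HasDerivAt (fun t : ℂ => Ψ (h + t • ((0 : ℂ), v))) (fderiv ℂ Ψ h (0, v)) 0 := by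
      exact HasFDerivAt.comp_hasDerivAt_of_eq (0 : ℂ) hd.hasFDerivAt hline (by simp)
    have hYp := (hYd.differentiableAt (htube.mem_nhds hp)).hasFDerivAt
    have h2 : HasDerivAt (fun t : ℂ => Yhat (tubeMap i (h + t • ((0 : ℂ), v))))
        (fderiv ℂ Yhat p (v i, v)) 0 := by
      have h3 : HasFDerivAt (fun q => Yhat (tubeMap i q)) _ h :=
        HasFDerivAt.comp h (by rw [htm]; exact hYp) (hasFDerivAt_tubeMap i h)
      have h4 : HasDerivAt (fun t : ℂ => Yhat (tubeMap i (h + t • ((0 : ℂ), v)))) _ 0 :=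
        h3.comp_hasDerivAt_of_eq (l := fun q => Yhat (tubeMap i q)) (0 : ℂ) hline (by simp)
      convert h4 using 1
      simp [dz, du]
    have h5 : HasDerivAt (fun t : ℂ => Ψ (h + t • ((0 : ℂ), v)))
        (fderiv ℂ Yhat p (v i, v) * M h.1) 0 := by
      have := h2.mul_const (M h.1)
      simpa [hΨ] using this
    have h6 := h1.unique h5
    rw [hder, htm] at h6
    simp only [mul_zero, add_zero] at h6
    have hΨh : Ψ h = Yhat p * M h.1 := by rw [hΨ]; simp only [htm]
    rw [hΨh] at h6 hunit
    have hMu : IsUnit (M h.1) := by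
      obtain ⟨y, hy⟩ := hYu p hp
      rw [← hy] at hunit
      exact (Units.isUnit_units_mul y _).1 hunit
    rw [← mul_assoc] at h6
    have h7 := hMu.mul_right_cancel h6
    change _ = fderiv ℂ Yhat p (v i, v) * _
    rw [← h7, mul_assoc, Ring.mul_inverse_cancel _ (hYu p hp), mul_one]

/-- Liouville's theorem for functions with finitely many removable singularities. -/
theorem eq_const_of_removable {F : Type*} [NormedAddCommGroup F] [NormedSpace ℂ F]
    [CompleteSpace F] {f : ℂ → F} {S : Set ℂ} (hS : S.Finite)
    (hf : ∀ z ∉ S, DifferentiableAt ℂ f z)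
    (hrem : ∀ c ∈ S, ∃ y, Tendsto f (𝓝[≠] c) (𝓝 y)) {c : F}
    (hlim : Tendsto f (cocompact ℂ) (𝓝 c)) {z : ℂ} (hz : z ∉ S) : f z = c := by
  classical
  choose! g hg using hrem
  set G : ℂ → F := fun z => if z ∈ S then g z else f z with hG
  have hGf : ∀ z ∉ S, G z = f z := fun z hz => if_neg hz
  have hev : ∀ z, ∀ᶠ w in 𝓝[≠] z, w ∉ S := fun z => by
    have := (hS.subset (sdiff_subset (t := {z}))).isClosed.isOpen_compl.mem_nhds
      (x := z) (by simp)
    filter_upwards [nhdsWithin_le_nhds this, self_mem_nhdsWithin] with w hw hw' hwS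
    exact hw ⟨hwS, hw'⟩
  have hdiffS : ∀ z ∉ S, DifferentiableAt ℂ G z := fun z hz => by
    refine (hf z hz).congr_of_eventuallyEq ?_
    filter_upwards [hS.isClosed.isOpen_compl.mem_nhds hz] with w hw using hGf w hw
  have hdiff : Differentiable ℂ G := fun z => by
    by_cases hz : z ∈ S
    · refine (Complex.analyticAt_of_differentiable_on_punctured_nhds_of_continuousAt ?_ ?_).differentiableAt
      · filter_upwards [hev z] with w hw using hdiffS w hw
      · rw [continuousAt_iff_punctured_nhds]
        refine Tendsto.congr' ?_ (by simpa [hG, hz] using hg z hz)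
        filter_upwards [hev z] with w hw using (hGf w hw).symm
    · exact hdiffS z hz
  rw [← hGf z hz]
  refine hdiff.apply_eq_of_tendsto_cocompact z (hlim.congr' ?_)
  filter_upwards [hS.isCompact.compl_mem_cocompact] with w hw using (hGf w hw).symm

/-- For fixed `u`, the `du_k` component of `ω` corrected by `A_k / (z - u_k)` is a bounded
holomorphic function of `z` off finitely many points, with a limit at infinity. Liouville's theorem
makes it constant, and `γ_k` is its value at infinity. -/
theorem isSchlesinger_of_constant (hdisj : ∀ i j, i ≠ j →
      Disjoint (Metric.closedBall (u₀ i) (r i)) (Metric.closedBall (u₀ j) (r j)))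
    (hA : ∀ i, DifferentiableOn ℂ (A i) (polydisc u₀ r))
    (hω : IsDeformationForm u₀ r A ω) {e₀ : totalSpace u₀ r} {Y : UCover e₀ → Mat n}
    (hY : IsFundamentalMatrix ω Y) (h : HasConstantExponentsAndConnection A Y) :
    IsSchlesinger u₀ r A ω := by
  obtain ⟨⟨hhol, η, hη, hηω⟩, hres, -⟩ := hω
  have hinf : ∀ u ∈ polydisc u₀ r, ((0 : ℂ), u) ∈ infinityPart u₀ r := fun u hu =>
    ⟨hu, fun i => by simp [infinityChart, invPoint_zero]⟩
  have hmain : ∀ p ∈ affinePart u₀ r, ∀ k : Fin N,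
      ω p (0, Pi.single k 1) + (p.1 - p.2 k)⁻¹ • A k p.2 = η (0, p.2) (0, Pi.single k 1) := by
    rintro ⟨z, u⟩ hp k
    have hu : u ∈ polydisc u₀ r := (mem_affinePart.1 hp).1
    have hmem : ∀ z, (z, u) ∈ affinePart u₀ r ↔ z ∉ range u := fun z => by
      rw [mem_affinePart, mem_range, not_exists]
      exact ⟨fun h i hi => h.2 i hi.symm, fun h => ⟨hu, fun i hi => h i hi.symm⟩⟩
    have hinj : Function.Injective u := fun i j hij => by
      by_contra hne
      refine Set.disjoint_left.1 (hdisj i j hne) (Metric.ball_subset_closedBall (hu i)) ?_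
      rw [hij]
      exact Metric.ball_subset_closedBall (hu j)
    refine eq_const_of_removable (f := fun z => ω (z, u) (0, Pi.single k 1) + (z - u k)⁻¹ • A k u)
      (finite_range u) (fun z hz => ?_) ?_ ?_ ((hmem z).1 hp)
    · have h1 := (hhol (0, Pi.single k 1)).differentiableAt
        ((isOpen_affinePart u₀ r).mem_nhds ((hmem z).2 hz))
      have h2 : DifferentiableAt ℂ (fun z => ω (z, u) (0, Pi.single k 1)) z :=
        DifferentiableAt.comp (𝕜 := ℂ) z h1 (f := fun z => (z, u)) (by fun_prop)
      have h3 : z - u k ≠ 0 := fun h0 => hz ⟨k, (sub_eq_zero.1 h0).symm⟩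
      have h4 : DifferentiableAt ℂ (fun z => z - u k) z := by fun_prop
      exact h2.add ((h4.inv h3).smul_const _)
    · rintro _ ⟨i, rfl⟩
      obtain ⟨D, L, C, hLev, hL, hC⟩ := h i
      obtain ⟨ρ, g, hρ, hg, hgω⟩ :=
        hLev.apply_tangent hY (hLev.isConstantOn_exponents (hA i) hL) hL hC
      set s : ℂ := (Pi.single k 1 : Par N) i with hs
      have htube : (u i, u) ∈ tube u₀ r i ρ := ⟨by simpa using hρ, hu⟩
      have hgc : Tendsto (fun z => g (Pi.single k 1) (z, u)) (𝓝[≠] (u i))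
          (𝓝 (g (Pi.single k 1) (u i, u))) := by
        refine ((hg _ _ htube).tendsto).comp (tendsto_nhdsWithin_iff.2 ⟨?_, ?_⟩)
        · exact ((show Continuous fun z : ℂ => (z, u) by fun_prop).tendsto (u i)).mono_left
            nhdsWithin_le_nhds
        · filter_upwards [nhdsWithin_le_nhds (Metric.ball_mem_nhds (u i) hρ)] with w hw
          exact ⟨by rwa [← dist_eq_norm], hu⟩
      have hother : ∀ j, j ≠ i → ContinuousAt (fun z : ℂ => (z - u j)⁻¹ • A j u) (u i) := by
        intro j hj
        have h1 : ContinuousAt (fun z : ℂ => z - u j) (u i) := by fun_prop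
        exact (h1.inv₀ (sub_ne_zero.2 fun h0 => hj (hinj h0.symm))).smul continuousAt_const
      have hev : ∀ᶠ w in 𝓝[≠] (u i), (w, u) ∈ affinePart u₀ r ∧ (w, u) ∈ tube u₀ r i ρ ∧
          w ≠ u i := by
        have h1 : (range u \ {u i})ᶜ ∈ 𝓝 (u i) :=
          ((finite_range u).subset sdiff_subset).isClosed.isOpen_compl.mem_nhds (by simp)
        filter_upwards [nhdsWithin_le_nhds (Metric.ball_mem_nhds (u i) hρ),
          nhdsWithin_le_nhds h1, self_mem_nhdsWithin] with w hw hw1 hw2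
        exact ⟨(hmem w).2 fun hw3 => hw1 ⟨hw3, hw2⟩, ⟨by rwa [← dist_eq_norm], hu⟩, hw2⟩
      by_cases hki : k = i
      -- At its own pole the tangent vector is `(1, e_k)`, so the component along `(0, e_k)` is a
      -- bounded term minus `ω (1, 0)`, whose polar part is exactly compensated by the correction.
      · subst hki
        have hsum : ContinuousAt (fun z : ℂ => ∑ j ∈ Finset.univ.erase k, (z - u j)⁻¹ • A j u)
            (u k) := tendsto_finsetSum _ fun j hj => hother j (Finset.ne_of_mem_erase hj)
        refine ⟨_, (hgc.sub (hsum.tendsto.mono_left nhdsWithin_le_nhds)).congr' ?_⟩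
        filter_upwards [hev] with w ⟨hw1, hw2, hw3⟩
        rw [← hgω _ hw2 hw3]
        have h1 := hres _ hw1
        rw [← Finset.add_sum_erase _ _ (Finset.mem_univ k)] at h1
        have h2 : (((Pi.single k 1 : Par N) k, (Pi.single k 1 : Par N)) : ℂ × Par N) =
            (1, 0) + (0, Pi.single k 1) := by simp
        rw [h2, map_add, h1]
        dsimp only
        abel
      -- At any other pole `(0, e_k)` is itself tangent, and the correction is regular there.
      · refine ⟨_, (hgc.add ((hother k hki).tendsto.mono_left nhdsWithin_le_nhds)).congr' ?_⟩
        filter_upwards [hev] with w ⟨hw1, hw2, hw3⟩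
        rw [← hgω _ hw2 hw3]
        have h2 : (Pi.single k 1 : Par N) i = 0 := Pi.single_eq_of_ne (Ne.symm hki) _
        rw [h2]
    · have h1 : Tendsto (fun z : ℂ => (z - u k)⁻¹ • A k u) (cocompact ℂ) (𝓝 0) := by
        have : Tendsto (fun z : ℂ => (z - u k)⁻¹) (cocompact ℂ) (𝓝 0) := by
          refine (tendsto_inv₀_cobounded.comp (tendsto_sub_const_cobounded (u k))).mono_left ?_
          rw [Metric.cobounded_eq_cocompact]
        simpa using this.smul_const (A k u)
      -- On vectors without `z`-component `ω` and `η` agree, so holomorphy at infinity gives the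
      -- limit.
      have h2 : Tendsto (fun z : ℂ => η (z⁻¹, u) (0, Pi.single k 1)) (cocompact ℂ)
          (𝓝 (η (0, u) (0, Pi.single k 1))) := by
        have hc := ((hη (0, Pi.single k 1)).differentiableAt
          ((isOpen_infinityPart u₀ r).mem_nhds (hinf u hu))).continuousAt
        refine Tendsto.comp hc.tendsto ?_
        refine Tendsto.prodMk_nhds ?_ tendsto_const_nhds
        rw [← Metric.cobounded_eq_cocompact]
        exact tendsto_inv₀_cobounded
      have h3 := h2.add h1
      rw [add_zero] at h3
      refine h3.congr' ?_
      have hfin : (insert 0 (range u)).Finite := (finite_range u).insert 0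
      filter_upwards [hfin.isCompact.compl_mem_cocompact] with w hw
      have hw0 : w ≠ 0 := fun h0 => hw (Or.inl h0)
      have hwA : (w, u) ∈ affinePart u₀ r := (hmem w).2 fun h0 => hw (Or.inr h0)
      have hwI : (w⁻¹, u) ∈ infinityPart u₀ r := by
        have h4 : infinityChart (w⁻¹, u) = affineChart (w, u) := by
          rw [affineChart_eq (p := (w, u)) hw0, invChart]
        rw [infinityPart, mem_preimage, h4]
        exact hwA
      have h5 := hηω _ hwI (inv_ne_zero hw0) (0, Pi.single k 1)
      simp only [inv_inv, mul_zero] at h5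
      rw [h5]
  refine ⟨fun k u => η (0, u) (0, Pi.single k 1), fun k u hu => ?_, fun p hp => ?_⟩
  · have h1 := (hη (0, Pi.single k 1)).differentiableAt
      ((isOpen_infinityPart u₀ r).mem_nhds (hinf u hu))
    have h2 : DifferentiableAt ℂ (fun u => η (0, u) (0, Pi.single k 1)) u :=
      DifferentiableAt.comp (𝕜 := ℂ) u h1 (f := fun u => ((0 : ℂ), u)) (by fun_prop)
    exact h2.differentiableWithinAt
  · refine ContinuousLinearMap.ext fun v => ?_
    have hv : v = v.1 • ((1 : ℂ), (0 : Par N)) + ∑ k, v.2 k • ((0 : ℂ), Pi.single k 1) := by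
      refine Prod.ext ?_ (funext fun j => ?_)
      · simp [Prod.fst_sum]
      · simp [Prod.snd_sum, Finset.sum_apply, Pi.single_apply]
    conv_lhs => rw [hv]
    simp only [map_add, map_sum, map_smul, hres p hp, schlesingerForm, normalizationForm,
      _root_.add_apply, _root_.sum_apply,
      ContinuousLinearMap.smulRight_apply, _root_.sub_apply]
    simp only [← hmain p hp, Finset.smul_sum, ← Finset.sum_add_distrib]
    refine Finset.sum_congr rfl fun k _ => ?_
    simp only [dz, du, ContinuousLinearMap.coe_fst', ContinuousLinearMap.comp_apply,
      ContinuousLinearMap.coe_snd', ContinuousLinearMap.proj_apply]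
    module

end Converse

end Fuchsian

/-! ### Jordan normal form -/

section JordanForm

open Polynomial Module

/-- Substituting `X + l` for `X` turns a linear relation into divisibility by `X ^ e` of a
polynomial of degree below `e`. -/
theorem Polynomial.linearIndependent_mk_X_sub_C_pow {K : Type*} [Field K] (l : K) (e : ℕ) :
    LinearIndependent K fun j : Fin e =>
      (Ideal.Quotient.mk (Ideal.span {(X - C l) ^ e}) ((X - C l) ^ (j : ℕ)) :
        K[X] ⧸ Ideal.span {(X - C l) ^ e}) := by
  rw [Fintype.linearIndependent_iff]
  intro c hc j
  have h1 : (∑ j : Fin e, c j • (Ideal.Quotient.mk (Ideal.span {(X - C l) ^ e})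
      ((X - C l) ^ (j : ℕ)))) = Ideal.Quotient.mk (Ideal.span {(X - C l) ^ e})
      ((∑ j : Fin e, C (c j) * X ^ (j : ℕ)).comp (X - C l)) := by
    simp only [Polynomial.comp, eval₂_finsetSum, eval₂_mul, eval₂_C, eval₂_X_pow, map_sum]
    refine Finset.sum_congr rfl fun j _ => ?_
    rw [← smul_eq_C_mul]
    rfl
  rw [h1, Ideal.Quotient.eq_zero_iff_mem, Ideal.mem_span_singleton] at hc
  obtain ⟨q, hq⟩ := hc
  have h2 : (X : K[X]) ^ e ∣ ∑ j : Fin e, C (c j) * X ^ (j : ℕ) := by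
    refine ⟨q.comp (X + C l), ?_⟩
    have := congrArg (fun p => p.comp (X + C l)) hq
    simp only [comp_assoc, sub_comp, X_comp, C_comp, mul_comp, pow_comp, add_sub_cancel_right,
      comp_X] at this
    exact this
  have h3 := X_pow_dvd_iff.1 h2 j j.2
  simp only [finsetSum_coeff, coeff_C_mul, coeff_X_pow] at h3
  rw [Finset.sum_eq_single j] at h3
  · simpa using h3
  · intro b _ hb
    rw [if_neg, mul_zero]
    exact fun h => hb (Fin.ext h.symm)
  · simp

/-- Multiplication by `X` on a primary cyclic module over `K[X]` is a Jordan block. -/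
theorem Polynomial.exists_jordanChain {K : Type*} [Field K] [IsAlgClosed K] {p : K[X]}
    (hp : Irreducible p) (e : ℕ) :
    ∃ (l : K) (b : Basis (Fin e) K (K[X] ⧸ Submodule.span K[X] {p ^ e})), ∀ j : Fin e,
      (X : K[X]) • b j = l • b j + if h : 0 < (j : ℕ) then b ⟨j - 1, by omega⟩ else 0 := by
  obtain ⟨l, hl⟩ := IsAlgClosed.exists_root p (by rw [IsAlgClosed.degree_eq_one_of_irreducible K hp]; simp)
  have hass : Associated (X - C l) p :=
    (irreducible_X_sub_C l).associated_of_dvd hp (dvd_iff_isRoot.2 hl)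
  have hspan : Submodule.span K[X] {p ^ e} = Ideal.span {(X - C l) ^ e} :=
    (Ideal.span_singleton_eq_span_singleton.2 (hass.pow_pow)).symm
  rw [hspan]
  have hli := linearIndependent_mk_X_sub_C_pow l e
  have hmonic : ((X - C l) ^ e).Monic := (monic_X_sub_C l).pow e
  have hfr : finrank K (K[X] ⧸ Ideal.span {(X - C l) ^ e}) = e := by
    rw [finrank_quotient_span_eq_natDegree]
    simp
  have hfin : Module.Finite K (K[X] ⧸ Ideal.span {(X - C l) ^ e}) :=
    hmonic.finite_quotient
  have hsp := hli.span_eq_top_of_card_eq_finrank' (by rw [hfr, Fintype.card_fin])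
  have hX : ∀ k : ℕ, (X : K[X]) • Ideal.Quotient.mk (Ideal.span {(X - C l) ^ e}) ((X - C l) ^ k) =
      l • Ideal.Quotient.mk (Ideal.span {(X - C l) ^ e}) ((X - C l) ^ k) +
      Ideal.Quotient.mk (Ideal.span {(X - C l) ^ e}) ((X - C l) ^ (k + 1)) := by
    intro k
    have : (X : K[X]) * (X - C l) ^ k = l • (X - C l) ^ k + (X - C l) ^ (k + 1) := by
      rw [smul_eq_C_mul, pow_succ]
      ring
    change Ideal.Quotient.mk _ (X * _) = Ideal.Quotient.mk _ (l • _) + _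
    rw [this, map_add]
  -- Multiplication by `X - l` raises the exponent; reversing the order makes it lower the index, so
  -- the ones stand above the diagonal. The chain ends at index `0` because `(X - l) ^ e = 0`.
  refine ⟨l, (Basis.mk hli hsp.ge).reindex Fin.revPerm, fun j => ?_⟩
  simp only [Basis.reindex_apply, Basis.mk_apply, Fin.revPerm_symm, Fin.revPerm_apply, Fin.val_rev]
  rw [hX]
  congr 1
  split_ifs with h
  · congr 3
    omega
  · rw [Ideal.Quotient.eq_zero_iff_mem, Ideal.mem_span_singleton]
    exact pow_dvd_pow _ (by omega)

/-- Every endomorphism has a basis of Jordan chains. -/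
theorem Module.End.exists_jordanBasis {K V : Type} [Field K] [IsAlgClosed K] [AddCommGroup V]
    [Module K V] [FiniteDimensional K V] (f : Module.End K V) :
    ∃ (ι : Type) (_ : Fintype ι) (l : ι → K) (e : ι → ℕ) (b : Basis (Σ i, Fin (e i)) K V),
      ∀ i (j : Fin (e i)), f (b ⟨i, j⟩) =
        l i • b ⟨i, j⟩ + if h : 0 < (j : ℕ) then b ⟨i, ⟨j - 1, by omega⟩⟩ else 0 := by
  classical
  -- The space is a torsion module over `K[X]` with `X` acting by `f`, hence a sum of primary cyclic
  -- modules.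
  obtain ⟨ι, hι, p, hp, e, ⟨φ⟩⟩ := Module.equiv_directSum_of_isTorsion
    (R := K[X]) (M := AEval' f) (AEval.isTorsion_of_finiteDimensional K V f)
  choose l b hb using fun i => Polynomial.exists_jordanChain (hp i) (e i)
  let ψ : V ≃ₗ[K] DirectSum ι fun i => K[X] ⧸ Submodule.span K[X] {p i ^ e i} :=
    (AEval'.of f).trans (φ.restrictScalars K)
  have hψ : ∀ v, ψ (f v) = (X : K[X]) • ψ v := fun v => by
    change φ (AEval'.of f (f v)) = (X : K[X]) • φ (AEval'.of f v)
    rw [← map_smul, AEval'.X_smul_of]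
  refine ⟨ι, hι, l, e, (DFinsupp.basis b).map ψ.symm, fun i j => ψ.injective ?_⟩
  have hval : ∀ i (j : Fin (e i)), ψ ((DFinsupp.basis b).map ψ.symm ⟨i, j⟩) =
      DirectSum.lof K[X] ι (fun i => K[X] ⧸ Submodule.span K[X] {p i ^ e i}) i (b i j) := by
    intro i j
    rw [Basis.map_apply, LinearEquiv.apply_symm_apply]
    refine (DFinsupp.basis b).repr.injective ?_
    rw [Basis.repr_self]
    change _ = (sigmaFinsuppLequivDFinsupp K).symm
      (DFinsupp.mapRange.linearEquiv (fun i => (b i).repr) (DFinsupp.single i (b i j)))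
    rw [DFinsupp.mapRange.linearEquiv_apply, DFinsupp.mapRange_single, Basis.repr_self]
    exact (LinearEquiv.eq_symm_apply _).2 (sigmaFinsuppEquivDFinsupp_single _ _)
  rw [hψ, map_add, map_smul, hval, ← map_smul, hb, map_add]
  congr 1
  · exact (DirectSum.lof K[X] ι (fun i => K[X] ⧸ Submodule.span K[X] {p i ^ e i}) i).map_smul_of_tower
      _ _
  split_ifs with h
  · rw [hval]
  · simp

namespace Fuchsian

/-- Jordan blocks may be permuted freely. Sorting first by the eigenvalue modulo integers and then
by decreasing integer part puts resonant eigenvalues next to one another in the order that Levelt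
exponents require. -/
theorem exists_sorted_jordanForm {n : ℕ} (A : Mat n) :
    ∃ P J : Mat n, IsUnit P ∧ A * P = P * J ∧ IsJordanForm J ∧
      (∀ a b c, a ≤ b → b ≤ c → J a a - ⌊(J a a).re⌋ = J c c - ⌊(J c c).re⌋ →
        J b b - ⌊(J b b).re⌋ = J a a - ⌊(J a a).re⌋) ∧
      ∀ a b, a ≤ b → J a a - ⌊(J a a).re⌋ = J b b - ⌊(J b b).re⌋ →
        ⌊(J b b).re⌋ ≤ ⌊(J a a).re⌋ := by
  classical
  obtain ⟨ι, hι, l, e, b, hb⟩ := Module.End.exists_jordanBasis (Matrix.toLin' A)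
  let part : ℂ → ℂ := fun z => z - ⌊z.re⌋
  let fkey : ℂ → ℝ ×ₗ ℝ := fun z => toLex ((part z).re, (part z).im)
  have hfkey : ∀ z w, fkey z = fkey w → part z = part w := fun z w h => by
    have := (Prod.ext_iff.1 (toLex.injective h))
    exact Complex.ext this.1 this.2
  let key : ι → (ℝ ×ₗ ℝ) ×ₗ ℤᵒᵈ := fun i => toLex (fkey (l i), OrderDual.toDual ⌊(l i).re⌋)
  -- An arbitrary numbering of the blocks breaks ties and makes the order linear.
  let order : ι → ((ℝ ×ₗ ℝ) ×ₗ ℤᵒᵈ) ×ₗ Fin (Fintype.card ι) :=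
    fun i => toLex (key i, Fintype.equivFin ι i)
  let _ : LinearOrder ι := LinearOrder.lift' order fun i j h =>
    (Fintype.equivFin ι).injective (Prod.ext_iff.1 (toLex.injective h)).2
  have hkey : Monotone key := fun i j h => Prod.Lex.monotone_fst _ _ (show order i ≤ order j from h)
  have hcard : Fintype.card (Σₗ i, Fin (e i)) = n := by
    have h1 := Module.finrank_eq_card_basis b
    rw [Module.finrank_fin_fun] at h1
    exact h1.symm
  -- The lexicographic order keeps each Jordan chain consecutive, so that chain predecessors are
  -- index predecessors.
  let σ : Fin n ≃o Σₗ i, Fin (e i) := monoEquivOfFin _ hcard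
  let b' : Basis (Fin n) ℂ (Fin n → ℂ) := b.reindex σ.symm.toEquiv
  have hb'σ : ∀ x : Σ i, Fin (e i), b x = b' (σ.symm x) := fun x => by
    exact (congrArg b (σ.apply_symm_apply x).symm).trans (b.reindex_apply σ.symm.toEquiv _).symm
  let blk : Fin n → ι := fun a => (σ a).1
  have hblk : Monotone blk := fun a c h => by
    have h1 : σ a ≤ σ c := σ.monotone h
    rcases Sigma.Lex.le_def.1 h1 with h2 | ⟨h2, -⟩
    · exact h2.le
    · exact h2.le
  let J : Mat n := LinearMap.toMatrix b' b' (Matrix.toLin' A)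
  have hf : ∀ a : Fin n, Matrix.toLin' A (b' a) = l (blk a) • b' a +
      if h : 0 < ((σ a).2 : ℕ) then b' (σ.symm ⟨(σ a).1, ⟨(σ a).2 - 1, by omega⟩⟩) else 0 := by
    intro a
    have h1 := hb (σ a).1 (σ a).2
    have h2 : b ⟨(σ a).1, (σ a).2⟩ = b' a := by
      rw [hb'σ]
      congr 1
      exact σ.symm_apply_apply a
    rw [h2] at h1
    rw [h1]
    congr 1
    split_ifs with h
    · rw [hb'σ]
    · rfl
  have hpred : ∀ a : Fin n, ∀ h : 0 < ((σ a).2 : ℕ), ∀ c,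
      σ.symm ⟨(σ a).1, ⟨(σ a).2 - 1, by omega⟩⟩ = c → (a : ℕ) = c + 1 ∧ blk c = blk a := by
    rintro a h c rfl
    have hcov : @CovBy (Σₗ i, Fin (e i)) _ ⟨(σ a).1, ⟨(σ a).2 - 1, by omega⟩⟩ (σ a) := by
      refine ⟨(Sigma.Lex.lt_def (α := fun i => Fin (e i))).2 (Or.inr ⟨rfl, ?_⟩), fun x h1 h2 => ?_⟩
      · rw [Fin.lt_def]
        dsimp only
        omega
      · obtain ⟨i, j⟩ := x
        rcases Sigma.Lex.lt_def.1 h1 with h3 | ⟨h3, h4⟩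
        · rcases Sigma.Lex.lt_def.1 h2 with h5 | ⟨h5, -⟩
          · exact lt_asymm h3 h5
          · exact h3.ne' h5
        · dsimp only at h3
          subst h3
          rcases Sigma.Lex.lt_def.1 h2 with h5 | ⟨h5, h6⟩
          · exact lt_irrefl _ h5
          · dsimp only at h4 h6
            rw [Fin.lt_def] at h4 h6
            dsimp only at h4
            omega
    have h1 := (apply_covBy_apply_iff σ.symm).2 hcov
    rw [σ.symm_apply_apply] at h1
    refine ⟨?_, ?_⟩
    · have := Nat.covBy_iff_add_one_eq.1 (Fin.covBy_iff.1 h1)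
      omega
    · have h2 := congrArg (fun x : Σₗ i, Fin (e i) => x.1)
        (σ.apply_symm_apply ⟨(σ a).1, ⟨(σ a).2 - 1, by omega⟩⟩)
      exact h2
  have hJ : ∀ c a, J c a = (if a = c then l (blk a) else 0) +
      if h : 0 < ((σ a).2 : ℕ) then
        (if σ.symm ⟨(σ a).1, ⟨(σ a).2 - 1, by omega⟩⟩ = c then 1 else 0) else 0 := by
    intro c a
    simp only [J, LinearMap.toMatrix_apply]
    rw [hf, map_add, map_smul, Finsupp.add_apply, Finsupp.smul_apply, Basis.repr_self_apply]
    congr 1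
    · simp
    · split_ifs with h h'
      · rw [Basis.repr_self_apply, if_pos h']
      · rw [Basis.repr_self_apply, if_neg h']
      · simp
  have hJd : ∀ a, J a a = l (blk a) := fun a => by
    rw [hJ, if_pos rfl]
    split_ifs with h h₁
    · exact absurd (hpred a h a h₁).1 (by omega)
    · simp
    · simp
  refine ⟨(Pi.basisFun ℂ (Fin n)).toMatrix b', J, ?_, ?_, ?_, ?_, ?_⟩
  · exact IsUnit.of_mul_eq_one _ (Basis.toMatrix_mul_toMatrix_flip (Pi.basisFun ℂ (Fin n)) b')
  · have h1 : A = LinearMap.toMatrix (Pi.basisFun ℂ (Fin n)) (Pi.basisFun ℂ (Fin n))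
        (Matrix.toLin' A) := by
      rw [LinearMap.toMatrix_eq_toMatrix', LinearMap.toMatrix'_toLin']
    conv_lhs => rw [h1]
    rw [linearMap_toMatrix_mul_basis_toMatrix, basis_toMatrix_mul_linearMap_toMatrix]
  · intro a c hac hne
    rw [hJ, if_neg (Ne.symm hac), zero_add] at hne
    split_ifs at hne with h h'
    · obtain ⟨h1, h2⟩ := hpred c h a h'
      refine ⟨h1, ?_, by rw [hJd, hJd, h2]⟩
      rw [hJ, if_neg (Ne.symm hac), dif_pos h, if_pos h', zero_add]
    · exact absurd rfl hne
    · exact absurd rfl hne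
  · intro a c d hac hcd h
    simp only [hJd] at h ⊢
    refine hfkey _ _ (le_antisymm ?_ ?_)
    · have h1 : fkey (l (blk a)) = fkey (l (blk d)) := by
        simp only [fkey, part, h]
      rw [h1]
      exact Prod.Lex.monotone_fst _ _ (hkey (hblk hcd))
    · exact Prod.Lex.monotone_fst _ _ (hkey (hblk hac))
  · intro a c hac h
    simp only [hJd] at h ⊢
    have h1 : fkey (l (blk a)) = fkey (l (blk c)) := by
      simp only [fkey, part, h]
    rcases Prod.Lex.le_iff.1 (hkey (hblk hac)) with h2 | ⟨-, h2⟩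
    · exact absurd h1 h2.ne
    · exact h2

end Fuchsian

end JordanForm

namespace Fuchsian

/-! ### The normal form of a system at a simple pole -/

section NormalForm

open Set Filter Metric
open scoped Matrix.Norms.L2Operator

variable {n : ℕ}

/-- For triangular `J`, the entry `(a, b)` of the commutator involves, besides `T a b`, only entries
lower in its column or further left in its row. Induction from the lower left corner leaves `(k - (J
a a - J b b)) * T a b = 0`. -/
theorem eq_zero_of_homological {J T : Mat n} (hJ : ∀ a b, b < a → J a b = 0) (k : ℂ)
    (h : ∀ a b, J a a - J b b = k → T a b = 0)
    (h' : ∀ a b, J a a - J b b ≠ k → (k • T - (J * T - T * J)) a b = 0) : T = 0 := by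
  suffices H : ∀ m : ℕ, ∀ a b : Fin n, n - a + b = m → T a b = 0 from
    Matrix.ext fun a b => H _ a b rfl
  intro m
  induction m using Nat.strong_induction_on with
  | _ m ih =>
    intro a b hm
    by_cases hab : J a a - J b b = k
    · exact h a b hab
    · have h1 := h' a b hab
      have h2 : (J * T) a b = J a a * T a b := by
        rw [Matrix.mul_apply, Finset.sum_eq_single a]
        · intro c _ hca
          rcases lt_or_gt_of_ne hca with hlt | hlt
          · rw [hJ a c hlt, zero_mul]
          · rw [ih (n - c + b) (by omega) c b rfl, mul_zero]
        · simp
      have h3 : (T * J) a b = T a b * J b b := by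
        rw [Matrix.mul_apply, Finset.sum_eq_single b]
        · intro c _ hcb
          rcases lt_or_gt_of_ne hcb with hlt | hlt
          · rw [ih (n - a + c) (by omega) a c rfl, zero_mul]
          · rw [hJ c b hlt, mul_zero]
        · simp
      simp only [Matrix.sub_apply, Matrix.smul_apply, smul_eq_mul, h2, h3] at h1
      have h4 : (k - (J a a - J b b)) * T a b = 0 := by linear_combination h1
      exact (mul_eq_zero.1 h4).resolve_left (sub_ne_zero.2 (Ne.symm hab))

/-- Solvability of the homological equation up to resonant terms. -/
theorem exists_homological {J : Mat n} (hJ : ∀ a b, b < a → J a b = 0) (k : ℂ) (Q : Mat n) :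
    ∃ T R : Mat n, k • T = J * T - T * J + Q - R ∧ ∀ a b, R a b ≠ 0 → J a a - J b b = k := by
  classical
  -- At resonant positions the equation is replaced by a condition on `T a b` itself, which makes
  -- the system uniquely solvable; the unsolved resonant part becomes `R`.
  let Φ : Mat n →ₗ[ℂ] Mat n :=
    { toFun := fun T => Matrix.of fun a b =>
        if J a a - J b b = k then T a b else (k • T - (J * T - T * J)) a b
      map_add' := fun T T' => by
        ext a b
        simp only [Matrix.of_apply, Matrix.add_apply]
        split_ifs
        · rfl
        · simp only [mul_add, add_mul, smul_add, Matrix.sub_apply, Matrix.add_apply]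
          ring
      map_smul' := fun c T => by
        ext a b
        simp only [Matrix.of_apply, Matrix.smul_apply, RingHom.id_apply]
        split_ifs
        · rfl
        · simp only [Matrix.mul_smul, Matrix.smul_mul, Matrix.sub_apply, Matrix.smul_apply,
            smul_eq_mul]
          ring }
  have hΦ : ∀ T a b, Φ T a b =
      if J a a - J b b = k then T a b else (k • T - (J * T - T * J)) a b := fun _ _ _ => rfl
  have hinj : Function.Injective Φ := by
    rw [← LinearMap.ker_eq_bot, LinearMap.ker_eq_bot']
    intro T hT
    have hT' : ∀ a b, Φ T a b = 0 := fun a b => by rw [hT]; rfl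
    refine eq_zero_of_homological hJ k (fun a b hab => ?_) fun a b hab => ?_
    · have := hT' a b
      rwa [hΦ, if_pos hab] at this
    · have := hT' a b
      rwa [hΦ, if_neg hab] at this
  obtain ⟨T, hT⟩ := (LinearMap.injective_iff_surjective.1 hinj)
    (Matrix.of fun a b => if J a a - J b b = k then 0 else Q a b)
  refine ⟨T, Q - (k • T - (J * T - T * J)), by abel, fun a b hR => ?_⟩
  by_contra hab
  refine hR ?_
  have h1 := congrFun (congrFun hT a) b
  rw [hΦ, if_neg hab, Matrix.of_apply, if_neg hab] at h1
  rw [Matrix.sub_apply, h1, sub_self]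

/-- The coefficients of the normalizing transformation and of the normal form. -/
noncomputable def normalFormCoeff {J : Mat n} (hJ : ∀ a b, b < a → J a b = 0) (B : ℕ → Mat n) :
    ℕ → Mat n × Mat n
  | 0 => (1, J)
  | k + 1 =>
    -- The part of the coefficient of `x ^ (k + 1)` in `B T - T R` that is known from lower orders.
    let Q := (∑ j : Fin (k + 1), B (j + 1) * (normalFormCoeff hJ B (k - j)).1) -
      ∑ j : Fin k, (normalFormCoeff hJ B (j + 1)).1 * (normalFormCoeff hJ B (k - j)).2
    ((exists_homological hJ (k + 1 : ℕ) Q).choose,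
      (exists_homological hJ (k + 1 : ℕ) Q).choose_spec.choose)

theorem normalFormCoeff_succ {J : Mat n} (hJ : ∀ a b, b < a → J a b = 0) (B : ℕ → Mat n) (k : ℕ) :
    ((k + 1 : ℕ) : ℂ) • (normalFormCoeff hJ B (k + 1)).1 =
      J * (normalFormCoeff hJ B (k + 1)).1 - (normalFormCoeff hJ B (k + 1)).1 * J +
      ((∑ j ∈ Finset.range (k + 1), B (j + 1) * (normalFormCoeff hJ B (k - j)).1) -
        ∑ j ∈ Finset.range k, (normalFormCoeff hJ B (j + 1)).1 *
          (normalFormCoeff hJ B (k - j)).2) - (normalFormCoeff hJ B (k + 1)).2 ∧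
    ∀ a b, (normalFormCoeff hJ B (k + 1)).2 a b ≠ 0 → J a a - J b b = (k + 1 : ℕ) := by
  rw [Finset.sum_range, Finset.sum_range]
  rw [normalFormCoeff]
  exact (exists_homological hJ (k + 1 : ℕ) _).choose_spec.choose_spec

/-- Formal solution of `x T' = B T - T R` with `R` resonant. -/
theorem exists_formal_normalForm {B : ℕ → Mat n} (hJ : ∀ a b, b < a → B 0 a b = 0)
    (hJ' : ∀ a b, B 0 a b ≠ 0 → B 0 a a = B 0 b b) :
    ∃ T R : ℕ → Mat n, T 0 = 1 ∧ R 0 = B 0 ∧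
      (∀ k a b, R k a b ≠ 0 → B 0 a a - B 0 b b = k) ∧
      (∀ k : ℕ, (k : ℂ) • T k = (∑ j ∈ Finset.range (k + 1), B j * T (k - j)) -
        ∑ j ∈ Finset.range (k + 1), T j * R (k - j)) ∧
      ∀ k, ((k + 1 : ℕ) : ℂ) • T (k + 1) = B 0 * T (k + 1) - T (k + 1) * B 0 +
        ((∑ j ∈ Finset.range (k + 1), B (j + 1) * T (k - j)) -
          ∑ j ∈ Finset.range k, T (j + 1) * R (k - j)) - R (k + 1) := by
  have h0 : normalFormCoeff hJ B 0 = (1, B 0) := by rw [normalFormCoeff]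
  refine ⟨fun k => (normalFormCoeff hJ B k).1, fun k => (normalFormCoeff hJ B k).2, by simp [h0],
    by simp [h0], ?_, ?_, fun k => (normalFormCoeff_succ hJ B k).1⟩
  · rintro (_ | k) a b h
    · replace h : (normalFormCoeff hJ B 0).2 a b ≠ 0 := h
      rw [h0] at h
      simp [hJ' a b h]
    · exact (normalFormCoeff_succ hJ B k).2 a b h
  · rintro (_ | k)
    · simp [h0]
    · rw [(normalFormCoeff_succ hJ B k).1, Finset.sum_range_succ' _ (k + 1),
        Finset.sum_range_succ _ (k + 1),
        Finset.sum_range_succ' (fun j => (normalFormCoeff hJ B j).1 * _) k]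
      simp only [h0, Nat.add_sub_add_right, Nat.sub_zero, one_mul, Nat.sub_self]
      abel

/-- A sequence which is eventually dominated by its convolution with a geometric sequence grows
at most geometrically. -/
theorem exists_geometric_bound {t : ℕ → ℝ} (ht : ∀ k, 0 ≤ t k) {M β : ℝ} (hM : 0 ≤ M) (hβ : 0 < β)
    {K : ℕ} (h : ∀ k ≥ K, t k ≤ ∑ j ∈ Finset.range k, M * β ^ (k - j) * t j) :
    ∃ C γ : ℝ, 0 ≤ C ∧ 0 < γ ∧ ∀ k, t k ≤ C * γ ^ k := by
  -- The ratio `β * (1 + M)` makes the sum of `M * (1 + M) ^ j` over `j < k` telescope to `(1 + M) ^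
  -- k - 1`.
  have hγ : 0 < β * (1 + M) := by positivity
  set C := ∑ j ∈ Finset.range K, t j / (β * (1 + M)) ^ j with hC
  have hC0 : 0 ≤ C := Finset.sum_nonneg fun j _ => div_nonneg (ht j) (by positivity)
  refine ⟨C, β * (1 + M), hC0, hγ, fun k => ?_⟩
  induction k using Nat.strong_induction_on with
  | _ k ih =>
    rcases lt_or_ge k K with hk | hk
    · rw [← div_le_iff₀ (by positivity)]
      exact Finset.single_le_sum (f := fun j => t j / (β * (1 + M)) ^ j)
        (fun j _ => div_nonneg (ht j) (by positivity)) (Finset.mem_range.2 hk)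
    · calc t k ≤ ∑ j ∈ Finset.range k, M * β ^ (k - j) * t j := h k hk
        _ ≤ ∑ j ∈ Finset.range k, C * β ^ k * (M * (1 + M) ^ j) := by
          refine Finset.sum_le_sum fun j hj => ?_
          have hjk := Finset.mem_range.1 hj
          calc M * β ^ (k - j) * t j ≤ M * β ^ (k - j) * (C * (β * (1 + M)) ^ j) := by
                gcongr
                exact ih j hjk
            _ = C * (β ^ (k - j) * β ^ j) * (M * (1 + M) ^ j) := by
                rw [mul_pow]
                ring
            _ = C * β ^ k * (M * (1 + M) ^ j) := by
                rw [← pow_add, Nat.sub_add_cancel hjk.le]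
        _ = C * β ^ k * ((1 + M) ^ k - 1) := by
          rw [← Finset.mul_sum, ← Finset.mul_sum]
          have := geom_sum_mul (1 + M) k
          rw [← this]
          ring
        _ ≤ C * (β * (1 + M)) ^ k := by
          rw [mul_pow, ← mul_assoc]
          gcongr
          linarith

/-- Convergence of the formal normalizing transformation. -/
theorem formal_normalForm_bound {B T R : ℕ → Mat n} {M β : ℝ} (hβ : 0 < β)
    (hB : ∀ k, ‖B k‖ ≤ M * β ^ k)
    (hR : ∀ k a b, R k a b ≠ 0 → B 0 a a - B 0 b b = k)
    (hT : ∀ k, ((k + 1 : ℕ) : ℂ) • T (k + 1) = B 0 * T (k + 1) - T (k + 1) * B 0 +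
        ((∑ j ∈ Finset.range (k + 1), B (j + 1) * T (k - j)) -
          ∑ j ∈ Finset.range k, T (j + 1) * R (k - j)) - R (k + 1)) :
    ∃ C γ : ℝ, 0 ≤ C ∧ 0 < γ ∧ ∀ k, ‖T k‖ ≤ C * γ ^ k := by
  -- Beyond `K` there is no resonance, so `R` vanishes, and `k + 1` exceeds `2 * ‖B 0‖ + 1`, so `‖T
  -- (k + 1)‖` can be isolated on the left.
  obtain ⟨K, hK⟩ := exists_nat_gt (2 * ‖B 0‖ + 1 + ∑ a, ∑ b, ‖B 0 a a - B 0 b b‖)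
  have hsum : ∀ a b, ‖B 0 a a - B 0 b b‖ ≤ ∑ a, ∑ b, ‖B 0 a a - B 0 b b‖ := fun a b =>
    (Finset.single_le_sum (f := fun b => ‖B 0 a a - B 0 b b‖) (fun _ _ => norm_nonneg _)
      (Finset.mem_univ b)).trans
    (Finset.single_le_sum (f := fun a => ∑ b, ‖B 0 a a - B 0 b b‖)
      (fun _ _ => Finset.sum_nonneg fun _ _ => norm_nonneg _) (Finset.mem_univ a))
  have hsum0 : 0 ≤ ∑ a, ∑ b, ‖B 0 a a - B 0 b b‖ :=
    Finset.sum_nonneg fun _ _ => Finset.sum_nonneg fun _ _ => norm_nonneg _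
  have hR0 : ∀ k ≥ K, R k = 0 := fun k hk => by
    ext a b
    by_contra hne
    have h1 := congrArg norm (hR k a b hne)
    rw [Complex.norm_natCast] at h1
    have h2 := hsum a b
    have h3 := norm_nonneg (B 0)
    have h5 : (K : ℝ) ≤ k := by exact_mod_cast hk
    linarith
  have hM : 0 ≤ M := by simpa using (norm_nonneg _).trans (hB 0)
  obtain ⟨M', hM'0, hM'⟩ : ∃ M' : ℝ, 0 ≤ M' ∧ ∀ k, ‖R k‖ ≤ M' * β ^ k := by
    refine ⟨∑ j ∈ Finset.range K, ‖R j‖ / β ^ j,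
      Finset.sum_nonneg fun j _ => by positivity, fun k => ?_⟩
    rcases lt_or_ge k K with hk | hk
    · rw [← div_le_iff₀ (by positivity)]
      exact Finset.single_le_sum (f := fun j => ‖R j‖ / β ^ j)
        (fun j _ => by positivity) (Finset.mem_range.2 hk)
    · rw [hR0 k hk, norm_zero]
      exact mul_nonneg (Finset.sum_nonneg fun j _ => by positivity) (by positivity)
  refine exists_geometric_bound (fun k => norm_nonneg (T k)) (M := M + M') (by positivity) hβ
    (K := K + 1) ?_
  rintro (_ | k) hk
  · omega
  · have hkK : (K : ℝ) ≤ k := by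
      have : K ≤ k := by omega
      exact_mod_cast this
    have h1 := hT k
    rw [hR0 (k + 1) (by omega), sub_zero] at h1
    have h2 : ‖(∑ j ∈ Finset.range (k + 1), B (j + 1) * T (k - j)) -
        ∑ j ∈ Finset.range k, T (j + 1) * R (k - j)‖ ≤
        ∑ j ∈ Finset.range (k + 1), (M + M') * β ^ (k + 1 - j) * ‖T j‖ := by
      simp only [add_mul, Finset.sum_add_distrib]
      refine (norm_sub_le _ _).trans (add_le_add ?_ ?_)
      · rw [← Finset.sum_range_reflect]
        refine (norm_sum_le _ _).trans (Finset.sum_le_sum fun j hj => ?_)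
        have hjk := Finset.mem_range.1 hj
        have e1 : k + 1 - 1 - j + 1 = k + 1 - j := by omega
        have e2 : k - (k + 1 - 1 - j) = j := by omega
        rw [e1, e2]
        exact (norm_mul_le _ _).trans (mul_le_mul_of_nonneg_right (hB _) (norm_nonneg _))
      · rw [Finset.sum_range_succ' _ k]
        refine le_add_of_le_of_nonneg ?_ (by positivity)
        refine (norm_sum_le _ _).trans (Finset.sum_le_sum fun j hj => ?_)
        rw [Nat.add_sub_add_right, mul_comm (M' * _)]
        exact (norm_mul_le _ _).trans (mul_le_mul_of_nonneg_left (hM' _) (norm_nonneg _))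
    have h3 : ((k + 1 : ℕ) : ℝ) * ‖T (k + 1)‖ ≤ ‖B 0‖ * ‖T (k + 1)‖ + ‖T (k + 1)‖ * ‖B 0‖ +
        ∑ j ∈ Finset.range (k + 1), (M + M') * β ^ (k + 1 - j) * ‖T j‖ := by
      have h4 := congrArg norm h1
      rw [norm_smul, Complex.norm_natCast] at h4
      rw [h4]
      refine (norm_add_le _ _).trans (add_le_add ((norm_sub_le _ _).trans
        (add_le_add (norm_mul_le _ _) (norm_mul_le _ _))) h2)
    push_cast at h3
    nlinarith [norm_nonneg (T (k + 1)), norm_nonneg (B 0)]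

theorem summable_norm_pow_smul {a : ℕ → Mat n} {C γ : ℝ} (hγ : 0 < γ)
    (ha : ∀ k, ‖a k‖ ≤ C * γ ^ k) {x : ℂ} (hx : ‖x‖ < γ⁻¹) :
    Summable fun k => ‖x ^ k • a k‖ := by
  have h1 : γ * ‖x‖ < 1 := by
    rwa [← one_div, lt_div_iff₀ hγ, mul_comm] at hx
  refine Summable.of_nonneg_of_le (fun _ => norm_nonneg _) (fun k => ?_)
    ((summable_geometric_of_lt_one (by positivity) h1).mul_left C)
  rw [norm_smul, norm_pow, mul_pow, ← mul_assoc, mul_comm]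
  exact mul_le_mul_of_nonneg_right (ha k) (by positivity)

/-- The Euler operator `x d/dx` multiplies the coefficients by `k`, which matches the left side of
the recursion. -/
theorem hasDerivAt_tsum_pow_smul {a : ℕ → Mat n} {C γ : ℝ} (hγ : 0 < γ)
    (ha : ∀ k, ‖a k‖ ≤ C * γ ^ k) {x : ℂ} (hx : ‖x‖ < γ⁻¹) :
    DifferentiableAt ℂ (fun x : ℂ => ∑' k, x ^ k • a k) x ∧
      HasSum (fun k : ℕ => x ^ k • ((k : ℂ) • a k)) (x • deriv (fun x : ℂ => ∑' k, x ^ k • a k) x) := by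
  obtain ⟨δ, hδ, hδγ⟩ := exists_between hx
  have hδ0 : 0 < δ := (norm_nonneg x).trans_lt hδ
  have hs := summable_norm_pow_smul hγ ha (x := (δ : ℂ))
    (by rwa [Complex.norm_real, Real.norm_of_nonneg hδ0.le])
  have hder : ∀ (k : ℕ) (y : ℂ), HasDerivAt (fun x : ℂ => x ^ k • a k) (((k : ℂ) * y ^ (k - 1)) • a k) y :=
    fun k y => (hasDerivAt_pow k y).smul_const (a k)
  obtain ⟨h1, h2⟩ := hasFDerivAt_tsum_of_locally_bounded (F := Mat n) (isOpen_univ (X := ℂ))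
    (f := fun k x => x ^ k • a k) (fun k y _ => (hder k y).differentiableAt.differentiableWithinAt)
    (mem_univ x) ⟨ball 0 δ, isOpen_ball.mem_nhds (by simpa using hδ), _, hs, fun k q hq => by
      rw [norm_smul, norm_smul, norm_pow, norm_pow, Complex.norm_real,
        Real.norm_of_nonneg hδ0.le]
      have : ‖q‖ ≤ δ := by simpa using (mem_ball.1 hq).le
      gcongr⟩
  refine ⟨h1.differentiableAt, ?_⟩
  have h3 : deriv (fun x : ℂ => ∑' k, x ^ k • a k) x =
      (∑' k, fderiv ℂ (fun x : ℂ => x ^ k • a k) x) 1 := by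
    rw [← h1.fderiv]
    rfl
  have h4 := (ContinuousLinearMap.apply ℂ (Mat n) (1 : ℂ)).hasSum h2.hasSum
  rw [h3]
  have h5 := h4.const_smul x
  have h6 : (fun k : ℕ => x ^ k • ((k : ℂ) • a k)) = fun k =>
      x • ContinuousLinearMap.apply ℂ (Mat n) (1 : ℂ) (fderiv ℂ (fun x : ℂ => x ^ k • a k) x) := by
    funext k
    rw [ContinuousLinearMap.apply_apply, (hder k x).hasFDerivAt.fderiv]
    rcases k with _ | k
    · simp
    · simp [smul_smul, pow_succ]
      congr 1
      ring
  rw [h6]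
  exact h5

/-- The matrix `x ^ D` conjugates the exponent `L` to a polynomial in `x`. -/
theorem exists_leveltExponent {J : Mat n} (hJ : IsJordanForm J)
    (hcons : ∀ a b c, a ≤ b → b ≤ c → J a a - ⌊(J a a).re⌋ = J c c - ⌊(J c c).re⌋ →
        J b b - ⌊(J b b).re⌋ = J a a - ⌊(J a a).re⌋)
    (hanti : ∀ a b, a ≤ b → J a a - ⌊(J a a).re⌋ = J b b - ⌊(J b b).re⌋ →
        ⌊(J b b).re⌋ ≤ ⌊(J a a).re⌋)
    {R : ℕ → Mat n} (hR0 : R 0 = J) (hR : ∀ k a b, R k a b ≠ 0 → J a a - J b b = k) :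
    ∃ (D : Fin n → ℤ) (L : Mat n), IsLeveltExponent D L ∧
      (∀ x : ℂ, x ≠ 0 → HasSum (fun k => x ^ k • R k)
        (Matrix.diagonal (fun a => (D a : ℂ)) + intPow x D * L * intPow x (-D))) ∧
      Tendsto (fun x : ℂ => Matrix.diagonal (fun a => (D a : ℂ)) +
        intPow x D * L * intPow x (-D)) (𝓝[≠] 0) (𝓝 J) := by
  classical
  set d : Fin n → ℤ := fun a => ⌊(J a a).re⌋ with hd
  set ρ : Fin n → ℂ := fun a => J a a - d a with hρ
  -- At the entry `(a, b)` only the coefficient `R k` with `k = d a - d b` can be nonzero.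
  -- Conjugation by `x ^ D` restores its power of `x`, and the integers `d` are removed from the
  -- diagonal.
  set L : Mat n := Matrix.of fun a b => (if ρ a = ρ b ∧ d b ≤ d a then
    R (d a - d b).toNat a b else 0) - if a = b then (d a : ℂ) else 0 with hL
  have hres : ∀ a b (k : ℕ), J a a - J b b = k ↔ ρ a = ρ b ∧ d a - d b = k := by
    intro a b k
    constructor
    · intro h
      have h1 : (J a a).re = (J b b).re + k := by
        have := congrArg Complex.re h
        simp only [Complex.sub_re, Complex.natCast_re] at this
        linarith
      have h2 : d a = d b + k := by
        simp only [hd, h1]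
        exact_mod_cast Int.floor_add_natCast _ _
      refine ⟨?_, by omega⟩
      simp only [hρ, h2]
      push_cast
      linear_combination h
    · rintro ⟨h1, h2⟩
      have h3 : (d a : ℂ) - d b = k := by exact_mod_cast h2
      simp only [hρ] at h1
      linear_combination h1 + h3
  have hLd : ∀ a, L a a = ρ a := fun a => by
    simp [hL, hR0, hρ]
  have hLo : ∀ a b, a ≠ b → L a b = if ρ a = ρ b ∧ d b ≤ d a then
    R (d a - d b).toNat a b else 0 := fun a b hab => by simp [hL, hab]
  have hexp : IsLeveltExponent d L := by
    refine ⟨fun a b hba => ?_, ?_, fun a b h => ?_, fun a => ?_, fun a => ?_, ?_⟩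
    · rw [hLo a b hba.ne']
      split_ifs with h
      -- Below the diagonal the sorting leaves only `d a = d b`, where the entry comes from the
      -- triangular `R 0`.
      · have h1 : d a = d b := le_antisymm (hanti b a hba.le h.1.symm) h.2
        rw [h1, sub_self, Int.toNat_zero, hR0]
        by_contra hne
        have := (hJ a b hba.ne' hne).1
        omega
      · rfl
    · intro a b c hab hbc h
      simp only [hLd] at h ⊢
      exact hcons a b c hab hbc h
    · simp only [hLd] at h
      rw [hLo a b fun hab => h (by rw [hab]), if_neg fun h' => h h'.1]
    · rw [hLd]
      simp [hρ, hd]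
    · rw [hLd]
      simp only [hρ, hd, Complex.sub_re, Complex.intCast_re]
      linarith [Int.lt_floor_add_one (J a a).re]
    · intro a b hab h
      simp only [hLd] at h
      exact hanti a b hab h
  have hent : ∀ x : ℂ, x ≠ 0 → ∀ a b, (Matrix.diagonal (fun a => (d a : ℂ)) +
      intPow x d * L * intPow x (-d)) a b = if ρ a = ρ b ∧ d b ≤ d a then
        x ^ (d a - d b).toNat * R (d a - d b).toNat a b else 0 := by
    intro x hx a b
    rw [Matrix.add_apply, intPow_mul_mul_apply, Pi.neg_apply]
    by_cases hab : a = b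
    · subst hab
      rw [hLd, mul_right_comm, ← zpow_add₀ hx]
      simp [hR0, hρ]
    · rw [Matrix.diagonal_apply_ne _ hab, hLo a b hab, zero_add]
      split_ifs with h
      · rw [mul_right_comm, ← zpow_add₀ hx, ← sub_eq_add_neg]
        congr 1
        rw [← zpow_natCast, Int.toNat_of_nonneg (by omega)]
      · simp
  have hzero : ∀ a b (k : ℕ), ¬ (ρ a = ρ b ∧ d a - d b = k) → R k a b = 0 := fun a b k h => by
    by_contra hne
    exact h ((hres a b k).1 (hR k a b hne))
  have hsum : ∀ x : ℂ, ∀ a b, HasSum (fun k => x ^ k * R k a b) (if ρ a = ρ b ∧ d b ≤ d a then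
        x ^ (d a - d b).toNat * R (d a - d b).toNat a b else 0) := by
    intro x a b
    split_ifs with h
    · refine hasSum_single _ fun k hk => ?_
      rw [hzero a b k fun h' => hk (by omega), mul_zero]
    · have : (fun k => x ^ k * R k a b) = fun _ => 0 := funext fun k => by
        rw [hzero a b k fun h' => h ⟨h'.1, by omega⟩, mul_zero]
      rw [this]
      exact hasSum_zero
  refine ⟨d, L, hexp, fun x hx => ?_, ?_⟩
  · refine Pi.hasSum.2 fun a => Pi.hasSum.2 fun b => ?_
    rw [hent x hx a b]
    exact hsum x a b
  · have hpoly : ∀ a b, Tendsto (fun x : ℂ => if ρ a = ρ b ∧ d b ≤ d a then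
        x ^ (d a - d b).toNat * R (d a - d b).toNat a b else 0) (𝓝[≠] 0) (𝓝 (J a b)) := by
      intro a b
      have h1 : (if ρ a = ρ b ∧ d b ≤ d a then
        (0 : ℂ) ^ (d a - d b).toNat * R (d a - d b).toNat a b else 0) = J a b := by
        rw [← (hsum 0 a b).tsum_eq, tsum_eq_single 0 fun k hk => by simp [hk]]
        simp [hR0]
      have h2 : Continuous fun x : ℂ => if ρ a = ρ b ∧ d b ≤ d a then
        x ^ (d a - d b).toNat * R (d a - d b).toNat a b else 0 := by
        split_ifs
        · fun_prop
        · exact continuous_const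
      have h3 := (h2.tendsto 0).mono_left (nhdsWithin_le_nhds (s := {0}ᶜ))
      rwa [h1] at h3
    refine tendsto_pi_nhds.2 fun a => tendsto_pi_nhds.2 fun b => ?_
    refine (hpoly a b).congr' ?_
    filter_upwards [self_mem_nhdsWithin] with x hx using (hent x hx a b).symm

/-- The normal form of a system `x Y' = B(x) Y` at its simple pole `x = 0`. -/
theorem exists_leveltNormalForm {B : ℂ → Mat n} {ρ : ℝ} (hρ : 0 < ρ)
    (hB : DifferentiableOn ℂ B (ball 0 ρ)) (hJ : IsJordanForm (B 0))
    (hcons : ∀ a b c, a ≤ b → b ≤ c → B 0 a a - ⌊(B 0 a a).re⌋ = B 0 c c - ⌊(B 0 c c).re⌋ →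
        B 0 b b - ⌊(B 0 b b).re⌋ = B 0 a a - ⌊(B 0 a a).re⌋)
    (hanti : ∀ a b, a ≤ b → B 0 a a - ⌊(B 0 a a).re⌋ = B 0 b b - ⌊(B 0 b b).re⌋ →
        ⌊(B 0 b b).re⌋ ≤ ⌊(B 0 a a).re⌋) :
    ∃ (D : Fin n → ℤ) (L : Mat n) (δ : ℝ) (T : ℂ → Mat n), IsLeveltExponent D L ∧
      0 < δ ∧ δ ≤ ρ ∧ DifferentiableOn ℂ T (ball 0 δ) ∧ T 0 = 1 ∧
      (∀ x ∈ ball 0 δ, IsUnit (T x)) ∧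
      (∀ x ∈ ball 0 δ, x ≠ 0 → x • deriv T x = B x * T x - T x *
        (Matrix.diagonal (fun a => (D a : ℂ)) + intPow x D * L * intPow x (-D))) ∧
      Tendsto (fun x : ℂ => Matrix.diagonal (fun a => (D a : ℂ)) +
        intPow x D * L * intPow x (-D)) (𝓝[≠] 0) (𝓝 (B 0)) := by
  set b : ℕ → Mat n := fun k => (k.factorial : ℂ)⁻¹ • iteratedDeriv k B 0 with hb
  have hbB : ∀ x ∈ ball 0 ρ, HasSum (fun k => x ^ k • b k) (B x) := fun x hx => by
    have := Complex.hasSum_taylorSeries_on_ball hB hx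
    simpa [hb, smul_smul, mul_comm] using this
  have hb0 : b 0 = B 0 := by simp [hb]
  obtain ⟨M, hbM⟩ : ∃ M : ℝ, ∀ k, ‖b k‖ ≤ M * ((ρ / 2)⁻¹) ^ k := by
    have hmem : ((ρ / 2 : ℝ) : ℂ) ∈ ball (0 : ℂ) ρ := by
      rw [mem_ball_zero_iff, Complex.norm_real, Real.norm_of_nonneg (by positivity)]
      linarith
    obtain ⟨M, hM⟩ := (hbB _ hmem).summable.tendsto_atTop_zero.norm.bddAbove_range
    refine ⟨M, fun k => ?_⟩
    have := hM ⟨k, rfl⟩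
    dsimp only at this
    rw [norm_smul, norm_pow, Complex.norm_real, Real.norm_of_nonneg (by positivity)] at this
    rw [inv_pow, ← div_eq_mul_inv, le_div_iff₀ (by positivity), mul_comm]
    exact this
  have htri : ∀ a c, c < a → b 0 a c = 0 := fun a c hca => by
    by_contra hne
    rw [hb0] at hne
    have := (hJ a c hca.ne' hne).1
    omega
  have hdiag : ∀ a c, b 0 a c ≠ 0 → b 0 a a = b 0 c c := fun a c hne => by
    by_cases hac : a = c
    · rw [hac]
    · rw [hb0] at hne ⊢
      exact (hJ a c hac hne).2.2
  obtain ⟨t, R, ht0, hR0, hR, hrec, hrec'⟩ := exists_formal_normalForm htri hdiag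
  obtain ⟨C, γ, hC, hγ, ht⟩ := formal_normalForm_bound (by positivity) hbM hR hrec'
  rw [hb0] at hR0 hR
  obtain ⟨D, L, hexp, hsum, hlim⟩ := exists_leveltExponent hJ hcons hanti hR0 hR
  set T : ℂ → Mat n := fun x => ∑' k, x ^ k • t k with hT
  have hTd : ∀ x : ℂ, ‖x‖ < γ⁻¹ → DifferentiableAt ℂ T x := fun x hx =>
    (hasDerivAt_tsum_pow_smul hγ ht hx).1
  have hT0 : T 0 = 1 := by
    rw [hT]
    dsimp only
    rw [tsum_eq_single 0 fun k hk => by simp [hk]]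
    simp [ht0]
  have hunit : ∀ᶠ x in 𝓝 (0 : ℂ), IsUnit (T x) := by
    refine (hTd 0 (by simpa using hγ)).continuousAt.eventually (Units.isOpen.mem_nhds ?_)
    rw [hT0]
    exact isUnit_one
  obtain ⟨ε, hε, hεT⟩ := Metric.eventually_nhds_iff_ball.1 hunit
  -- The three radii ensure invertibility of `T` and absolute convergence of the series of `B` and
  -- of `T`.
  refine ⟨D, L, min ε (min (ρ / 2) γ⁻¹), T, hexp, by positivity,
    (min_le_right _ _).trans ((min_le_left _ _).trans (by linarith)), ?_, hT0, ?_, ?_, hlim⟩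
  · intro x hx
    exact (hTd x (by simpa using (lt_min_iff.1 (lt_min_iff.1 (mem_ball_zero_iff.1 hx)).2).2)).differentiableWithinAt
  · exact fun x hx => hεT x (ball_subset_ball (min_le_left _ _) hx)
  · intro x hx hx0
    have hx1 := lt_min_iff.1 (mem_ball_zero_iff.1 hx)
    have hx2 := lt_min_iff.1 hx1.2
    have hxρ : x ∈ ball 0 ρ := by
      rw [mem_ball_zero_iff]
      linarith
    have hst := summable_norm_pow_smul hγ ht hx2.2
    have hsb := summable_norm_pow_smul (by positivity) hbM (x := x) (by simpa using hx2.1)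
    have hsR : Summable fun k => ‖x ^ k • R k‖ := (hsum x hx0).summable.norm
    have h1 := hasSum_sum_range_mul_of_summable_norm hsb hst
    have h2 := hasSum_sum_range_mul_of_summable_norm hst hsR
    rw [(hbB x hxρ).tsum_eq] at h1
    rw [(hsum x hx0).tsum_eq] at h2
    have h3 := (hasDerivAt_tsum_pow_smul hγ ht hx2.2).2
    -- The formal recursion is the equality of coefficients in the Cauchy products of the convergent
    -- series.
    have h4 : (fun k : ℕ => x ^ k • ((k : ℂ) • t k)) = fun k =>
        (∑ j ∈ Finset.range (k + 1), x ^ j • b j * x ^ (k - j) • t (k - j)) -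
        ∑ j ∈ Finset.range (k + 1), x ^ j • t j * x ^ (k - j) • R (k - j) := by
      have hmul : ∀ (f g : ℕ → Mat n) (k : ℕ),
          ∑ j ∈ Finset.range (k + 1), x ^ j • f j * x ^ (k - j) • g (k - j) =
          x ^ k • ∑ j ∈ Finset.range (k + 1), f j * g (k - j) := fun f g k => by
        rw [Finset.smul_sum]
        refine Finset.sum_congr rfl fun j hj => ?_
        rw [smul_mul_smul_comm, ← pow_add, Nat.add_sub_cancel' (by
          have := Finset.mem_range.1 hj
          omega)]
      funext k
      rw [hmul, hmul, ← smul_sub, hrec]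
    rw [h4] at h3
    exact h3.unique (h1.sub h2)

end NormalForm

end Fuchsian

namespace Fuchsian

/-! ### Schlesinger deformations near a pole -/

section SchlesingerNearPole

open Set Filter Metric
open scoped Matrix.Norms.L2Operator

variable {n N : ℕ} {u₀ : Par N} {r : Fin N → ℝ} {A γ : Fin N → Par N → Mat n} {ω : Form n N}

/-- The connection of a Schlesinger deformation in the directions tangent to the pole `z = uᵢ`, in
the coordinates `x = z - uᵢ`, `u`. -/
noncomputable def tangentConnection (A γ : Fin N → Par N → Mat n) (i : Fin N) (p : ℂ × Par N) :
    Par N →L[ℂ] Mat n :=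
  (∑ j ∈ Finset.univ.erase i,
    (ContinuousLinearMap.proj (R := ℂ) (φ := fun _ : Fin N => ℂ) i -
      ContinuousLinearMap.proj (R := ℂ) (φ := fun _ : Fin N => ℂ) j).smulRight
      ((p.1 + p.2 i - p.2 j)⁻¹ • A j p.2)) +
  ∑ k, (ContinuousLinearMap.proj (R := ℂ) (φ := fun _ : Fin N => ℂ) k).smulRight (γ k p.2)

/-- The coefficient of the system in the variable `x = z - uᵢ`, multiplied by `x`. -/
noncomputable def residualCoeff (A : Fin N → Par N → Mat n) (i : Fin N) (p : ℂ × Par N) : Mat n :=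
  A i p.2 + p.1 • ∑ j ∈ Finset.univ.erase i, (p.1 + p.2 i - p.2 j)⁻¹ • A j p.2

/-- The change of coordinates `(x, u) ↦ (x + uᵢ, u)`. -/
def shiftMap (i : Fin N) (p : ℂ × Par N) : ℂ × Par N := (p.1 + p.2 i, p.2)

theorem hasFDerivAt_shiftMap (i : Fin N) (p : ℂ × Par N) :
    HasFDerivAt (shiftMap i) ((dz N + du i).prod (ContinuousLinearMap.snd ℂ ℂ (Par N))) p :=
  HasFDerivAt.prodMk ((dz N).hasFDerivAt.fun_add (du i).hasFDerivAt) hasFDerivAt_snd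

theorem differentiableAt_polarTerm {i : Fin N} {ρ : ℝ}
    (hsep : ∀ u ∈ polydisc u₀ r, ∀ x : ℂ, ‖x‖ < ρ → ∀ j ≠ i, x + u i - u j ≠ 0)
    (hA : ∀ i, DifferentiableOn ℂ (A i) (polydisc u₀ r))
    {p : ℂ × Par N} (hp : p ∈ ball (0 : ℂ) ρ ×ˢ polydisc u₀ r) {j : Fin N} (hj : j ≠ i) :
    DifferentiableAt ℂ (fun p : ℂ × Par N => (p.1 + p.2 i - p.2 j)⁻¹ • A j p.2) p := by
  have h1 : DifferentiableAt ℂ (fun p : ℂ × Par N => p.1 + p.2 i - p.2 j) p := by fun_prop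
  have h2 : DifferentiableAt ℂ (fun p : ℂ × Par N => A j p.2) p :=
    DifferentiableAt.comp p ((hA j).differentiableAt ((isOpen_polydisc u₀ r).mem_nhds hp.2))
      differentiableAt_snd
  exact (h1.inv (hsep p.2 hp.2 p.1 (mem_ball_zero_iff.1 hp.1) j hj)).smul h2

theorem tangentConnection_apply (A γ : Fin N → Par N → Mat n) (i : Fin N) (p : ℂ × Par N)
    (v : Par N) : tangentConnection A γ i p v =
      (∑ j ∈ Finset.univ.erase i, (v i - v j) • (p.1 + p.2 i - p.2 j)⁻¹ • A j p.2) +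
        ∑ k, v k • γ k p.2 := by
  simp [tangentConnection]

theorem differentiableOn_tangentConnection {i : Fin N} {ρ : ℝ}
    (hsep : ∀ u ∈ polydisc u₀ r, ∀ x : ℂ, ‖x‖ < ρ → ∀ j ≠ i, x + u i - u j ≠ 0)
    (hA : ∀ i, DifferentiableOn ℂ (A i) (polydisc u₀ r))
    (hγ : ∀ i, DifferentiableOn ℂ (γ i) (polydisc u₀ r)) :
    DifferentiableOn ℂ (tangentConnection A γ i) (ball (0 : ℂ) ρ ×ˢ polydisc u₀ r) := by
  refine DifferentiableOn.of_clm_apply fun v p hp => DifferentiableAt.differentiableWithinAt ?_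
  simp only [tangentConnection_apply]
  refine DifferentiableAt.add ?_ ?_
  · refine DifferentiableAt.fun_sum fun j hj => ?_
    exact (differentiableAt_polarTerm hsep hA hp (Finset.ne_of_mem_erase hj)).const_smul (v i - v j)
  · refine DifferentiableAt.fun_sum fun k _ => ?_
    have h2 : DifferentiableAt ℂ (fun p : ℂ × Par N => γ k p.2) p :=
      DifferentiableAt.comp p ((hγ k).differentiableAt ((isOpen_polydisc u₀ r).mem_nhds hp.2))
        differentiableAt_snd
    exact h2.const_smul (v k)

theorem differentiableOn_residualCoeff {i : Fin N} {ρ : ℝ}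
    (hsep : ∀ u ∈ polydisc u₀ r, ∀ x : ℂ, ‖x‖ < ρ → ∀ j ≠ i, x + u i - u j ≠ 0)
    (hA : ∀ i, DifferentiableOn ℂ (A i) (polydisc u₀ r)) :
    DifferentiableOn ℂ (residualCoeff A i) (ball (0 : ℂ) ρ ×ˢ polydisc u₀ r) := by
  intro p hp
  refine DifferentiableAt.differentiableWithinAt (DifferentiableAt.add ?_ ?_)
  · exact DifferentiableAt.comp p ((hA i).differentiableAt
      ((isOpen_polydisc u₀ r).mem_nhds hp.2)) differentiableAt_snd
  · have h1 : DifferentiableAt ℂ (fun p : ℂ × Par N => p.1) p := differentiableAt_fst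
    refine h1.smul (DifferentiableAt.fun_sum fun j hj => ?_)
    exact differentiableAt_polarTerm hsep hA hp (Finset.ne_of_mem_erase hj)

theorem shiftMap_mem_affinePart {i : Fin N} {ρ : ℝ}
    (hsep : ∀ u ∈ polydisc u₀ r, ∀ x : ℂ, ‖x‖ < ρ → ∀ j ≠ i, x + u i - u j ≠ 0)
    {p : ℂ × Par N} (hp : p ∈ ball (0 : ℂ) ρ ×ˢ polydisc u₀ r) (hp0 : p.1 ≠ 0) :
    shiftMap i p ∈ affinePart u₀ r := by
  refine mem_affinePart.2 ⟨hp.2, fun j => ?_⟩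
  by_cases hj : j = i
  · simp [shiftMap, hj, hp0]
  · exact sub_ne_zero.1 (hsep p.2 hp.2 p.1 (mem_ball_zero_iff.1 hp.1) j hj)

/-- On vectors tangent to the pole `d(z - uᵢ)` vanishes, so the only singular term of the
Schlesinger form disappears. -/
theorem form_shiftMap_tangent (hω : ∀ p ∈ affinePart u₀ r,
      ω p = schlesingerForm A p + normalizationForm γ p) {i : Fin N} {p : ℂ × Par N}
    (hp : shiftMap i p ∈ affinePart u₀ r) (v : Par N) :
    ω (shiftMap i p) (v i, v) = tangentConnection A γ i p v := by
  rw [hω _ hp, tangentConnection_apply]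
  simp only [schlesingerForm, normalizationForm, _root_.add_apply, _root_.sum_apply,
    ContinuousLinearMap.smulRight_apply, _root_.sub_apply]
  congr 1
  rw [← Finset.add_sum_erase _ _ (Finset.mem_univ i)]
  simp [dz, du, shiftMap]

theorem form_shiftMap_normal (hω : ∀ p ∈ affinePart u₀ r,
      ω p (1, 0) = ∑ i, (p.1 - p.2 i)⁻¹ • A i p.2) {i : Fin N} {p : ℂ × Par N}
    (hp : shiftMap i p ∈ affinePart u₀ r) (hp0 : p.1 ≠ 0) (c : ℂ) :
    ω (shiftMap i p) (p.1 * c, 0) = c • residualCoeff A i p := by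
  have h1 : ((p.1 * c, 0) : ℂ × Par N) = (p.1 * c) • (1, 0) := by simp
  rw [h1, map_smul, hω _ hp, residualCoeff, ← Finset.add_sum_erase _ _ (Finset.mem_univ i)]
  simp only [shiftMap, add_sub_cancel_right, smul_add, smul_smul]
  congr 2
  · field_simp
  · ring

/-- Off `x = 0` the connection is the restriction to the `u` directions of a pull-back of `ω`, hence
flat; being holomorphic at `x = 0`, it is flat there by continuity. -/
theorem isFlatOn_tangentConnection {i : Fin N} {ρ : ℝ}
    (hsep : ∀ u ∈ polydisc u₀ r, ∀ x : ℂ, ‖x‖ < ρ → ∀ j ≠ i, x + u i - u j ≠ 0)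
    (hA : ∀ i, DifferentiableOn ℂ (A i) (polydisc u₀ r))
    (hγ : ∀ i, DifferentiableOn ℂ (γ i) (polydisc u₀ r))
    (hωd : DifferentiableOn ℂ ω (affinePart u₀ r)) (hflat : IsFlatForm ω (affinePart u₀ r))
    (hω : ∀ p ∈ affinePart u₀ r, ω p = schlesingerForm A p + normalizationForm γ p) :
    IsFlatOn (tangentConnection A γ i) (ball (0 : ℂ) ρ ×ˢ polydisc u₀ r) := by
  set U := ball (0 : ℂ) ρ ×ˢ polydisc u₀ r with hU
  have hUo : IsOpen U := isOpen_ball.prod (isOpen_polydisc u₀ r)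
  set Θ := tangentConnection A γ i with hΘ
  have hΘd : DifferentiableOn ℂ Θ U := differentiableOn_tangentConnection hsep hA hγ
  set T := U ∩ {p : ℂ × Par N | p.1 ≠ 0} with hT
  have hTo : IsOpen T := hUo.inter isOpen_fst_ne_zero
  set η : ℂ × Par N → (ℂ × Par N) →L[ℂ] Mat n := fun p =>
    (ω (shiftMap i p)).comp (fderiv ℂ (shiftMap i) p) with hη
  have hshift : DifferentiableOn ℂ (shiftMap i) T := fun p _ =>
    (hasFDerivAt_shiftMap i p).differentiableAt.differentiableWithinAt
  have hmaps : MapsTo (shiftMap i) T (affinePart u₀ r) := fun p hp =>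
    shiftMap_mem_affinePart hsep hp.1 hp.2
  have hηflat : IsFlatForm η T := hflat.pullback (isOpen_affinePart u₀ r) hωd hTo hshift hmaps
    fun p _ v => rfl
  have hηd : DifferentiableOn ℂ η T := by
    refine DifferentiableOn.clm_comp (hωd.comp hshift hmaps) ?_
    exact hshift.fderiv_of_isOpen hTo
  have heq : ∀ p ∈ T, ∀ v : Par N, η p (0, v) = Θ p v := fun p hp v => by
    rw [hη]
    simp only [ContinuousLinearMap.comp_apply]
    rw [(hasFDerivAt_shiftMap i p).fderiv, hΘ, ← form_shiftMap_tangent hω (hmaps hp)]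
    simp [dz, du]
  have hder : ∀ p ∈ T, ∀ a (v : Par N), fderiv ℂ η p a (0, v) = fderiv ℂ Θ p a v := by
    intro p hp a v
    have h1 := (((hηd.differentiableAt (hTo.mem_nhds hp)).hasFDerivAt).clm_apply
      (hasFDerivAt_const ((0 : ℂ), v) p))
    have h2 := (((hΘd.differentiableAt (hUo.mem_nhds hp.1)).hasFDerivAt).clm_apply
      (hasFDerivAt_const v p))
    have h3 : (fun p => η p (0, v)) =ᶠ[𝓝 p] fun p => Θ p v := by
      filter_upwards [hTo.mem_nhds hp] with q hq using heq q hq v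
    have h4 := h3.fderiv_eq (𝕜 := ℂ)
    rw [h1.fderiv, h2.fderiv] at h4
    simpa using congrArg (fun f => f a) h4
  intro p hp v w
  have hc : ∀ v, ContinuousOn (fun p => Θ p v) U := fun v =>
    hΘd.continuousOn.clm_apply continuousOn_const
  have hc' : ∀ v w, ContinuousOn (fun p => fderiv ℂ Θ p (0, v) w) U := fun v w =>
    ((hΘd.fderiv_of_isOpen hUo).continuousOn.clm_apply continuousOn_const).clm_apply
      continuousOn_const
  refine sub_eq_zero.1 (ContinuousOn.eq_zero_of_eq_zero_off_hyperplane hUo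
    (((hc' v w).sub (hc' w v)).sub (((hc v).mul (hc w)).sub ((hc w).mul (hc v))))
    (fun q hq hq0 => sub_eq_zero.2 ?_) hp)
  have hqT : q ∈ T := ⟨hq, hq0⟩
  have := hηflat q hqT (0, v) (0, w)
  rwa [hder q hqT, hder q hqT, heq q hqT, heq q hqT] at this

/-- In the logarithmic coordinate, `x ^ D * x ^ L` is a fundamental matrix of the normal form
system. -/
theorem hasDerivAt_leveltFactor (D : Fin n → ℤ) (L : Mat n) (x : ℂ) :
    HasDerivAt (fun x : ℂ => intPow (Complex.exp x) D * NormedSpace.exp (x • L))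
      ((Matrix.diagonal (fun a => (D a : ℂ)) +
        intPow (Complex.exp x) D * L * intPow (Complex.exp x) (-D)) *
        (intPow (Complex.exp x) D * NormedSpace.exp (x • L))) x := by
  have h1 : HasDerivAt (fun x : ℂ => intPow (Complex.exp x) D)
      (Matrix.diagonal (fun a => (D a : ℂ)) * intPow (Complex.exp x) D) x := by
    have h2 : HasDerivAt (fun x : ℂ => fun a => Complex.exp x ^ D a)
        (fun a => (D a : ℂ) * Complex.exp x ^ D a) x := by
      rw [hasDerivAt_pi]
      intro a
      have h3 := (hasDerivAt_zpow (D a) (Complex.exp x) (Or.inl (Complex.exp_ne_zero x))).comp x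
        (Complex.hasDerivAt_exp x)
      refine h3.congr_deriv ?_
      rw [mul_assoc, ← zpow_add_one₀ (Complex.exp_ne_zero x), sub_add_cancel]
    have h4 := ((Matrix.diagonalLinearMap (Fin n) ℂ ℂ).toContinuousLinearMap.hasFDerivAt
      (x := fun a => Complex.exp x ^ D a)).comp_hasDerivAt x h2
    refine h4.congr_deriv ?_
    simp [intPow, Matrix.diagonal_mul_diagonal]
  have h5 := h1.mul (hasDerivAt_exp_smul_const' (𝕂 := ℂ) L x)
  refine h5.congr_deriv ?_
  have h6 : intPow (Complex.exp x) (-D) * intPow (Complex.exp x) D = 1 := by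
    simpa using intPow_mul_intPow_neg (Complex.exp_ne_zero x) (-D)
  rw [add_mul, mul_assoc, mul_assoc _ (intPow _ (-D)), ← mul_assoc (intPow _ (-D)), h6, one_mul,
    mul_assoc]

theorem hasDerivAt_mul_leveltFactor {G : ℂ → Mat n} (D : Fin n → ℤ) (L : Mat n) {x : ℂ}
    (hG : DifferentiableAt ℂ G (Complex.exp x)) :
    HasDerivAt (fun x : ℂ => G (Complex.exp x) *
        (intPow (Complex.exp x) D * NormedSpace.exp (x • L)))
      ((Complex.exp x • deriv G (Complex.exp x) + G (Complex.exp x) *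
        (Matrix.diagonal (fun a => (D a : ℂ)) +
          intPow (Complex.exp x) D * L * intPow (Complex.exp x) (-D))) *
        (intPow (Complex.exp x) D * NormedSpace.exp (x • L))) x := by
  have h1 := hG.hasDerivAt.scomp x (Complex.hasDerivAt_exp x)
  refine (h1.mul (hasDerivAt_leveltFactor D L x)).congr_deriv ?_
  simp only [Function.comp_apply, add_mul, mul_add, mul_assoc]

theorem isUnit_leveltFactor (D : Fin n → ℤ) (L : Mat n) (x : ℂ) :
    IsUnit (intPow (Complex.exp x) D * NormedSpace.exp (x • L)) :=
  (isUnit_intPow (Complex.exp_ne_zero x) D).mul (Matrix.isUnit_exp _)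

/-- A function is constant along a segment if its derivative along the segment vanishes. -/
theorem eq_of_fderiv_segment_eq_zero {E F : Type*} [NormedAddCommGroup E] [NormedSpace ℂ E]
    [NormedAddCommGroup F] [NormedSpace ℂ F] {S : Set E} (hS : Convex ℝ S) {K : E → F}
    (hK : ∀ p ∈ S, DifferentiableAt ℂ K p) {p q : E} (hp : p ∈ S) (hq : q ∈ S)
    (h0 : ∀ t ∈ Icc (0 : ℝ) 1, fderiv ℂ K (p + (t : ℂ) • (q - p)) (q - p) = 0) : K q = K p := by
  have hder : ∀ t ∈ Icc (0 : ℝ) 1,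
      HasDerivAt (fun t : ℝ => K (p + (t : ℂ) • (q - p))) 0 t := by
    intro t ht
    have hmem : p + (t : ℂ) • (q - p) ∈ S := by
      have := hS.add_smul_sub_mem hp hq ht
      rwa [← Complex.coe_smul] at this
    have h1 : HasDerivAt (fun t : ℝ => p + (t : ℂ) • (q - p)) (q - p) t := by
      have h2 : HasDerivAt (fun t : ℝ => (t : ℂ)) 1 t := Complex.ofRealCLM.hasDerivAt
      simpa using (h2.smul_const (q - p)).const_add p
    have h3 := ((hK _ hmem).hasFDerivAt.restrictScalars ℝ).comp_hasDerivAt t h1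
    exact h3.congr_deriv (h0 t ht)
  have := constant_of_has_deriv_right_zero (f := fun t : ℝ => K (p + (t : ℂ) • (q - p)))
    (fun t ht => (hder t ht).continuousAt.continuousWithinAt)
    (fun t ht => (hder t (Ico_subset_Icc_self ht)).hasDerivWithinAt) 1 (right_mem_Icc.2 zero_le_one)
  simpa using this

end SchlesingerNearPole

end Fuchsian

namespace Fuchsian

/-! ### Levelt forms of Schlesinger deformations -/

section LeveltForms

open Set Filter Metric
open scoped Matrix.Norms.L2Operator

variable {n N : ℕ} {u₀ : Par N} {r : Fin N → ℝ} {A γ : Fin N → Par N → Mat n} {ω : Form n N}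

/-- Flat sections of the connection along the pole `z = uᵢ`. -/
theorem exists_tangentTransport (hu₀ : u₀ ∈ polydisc u₀ r) {i : Fin N} {ρ : ℝ}
    (hsep : ∀ u ∈ polydisc u₀ r, ∀ x : ℂ, ‖x‖ < ρ → ∀ j ≠ i, x + u i - u j ≠ 0)
    (hA : ∀ i, DifferentiableOn ℂ (A i) (polydisc u₀ r))
    (hγ : ∀ i, DifferentiableOn ℂ (γ i) (polydisc u₀ r))
    (hωd : DifferentiableOn ℂ ω (affinePart u₀ r)) (hflat : IsFlatForm ω (affinePart u₀ r))
    (hω : ∀ p ∈ affinePart u₀ r, ω p = schlesingerForm A p + normalizationForm γ p) :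
    ∃ P : ℂ × Par N → Mat n, DifferentiableOn ℂ P (ball (0 : ℂ) ρ ×ˢ polydisc u₀ r) ∧
      (∀ x, P (x, u₀) = 1) ∧ ∀ p ∈ ball (0 : ℂ) ρ ×ˢ polydisc u₀ r, IsUnit (P p) ∧
        ∀ w, fderiv ℂ P p (0, w) = tangentConnection A γ i p w * P p := by
  have hU : IsOpen (ball (0 : ℂ) ρ ×ˢ polydisc u₀ r) := isOpen_ball.prod (isOpen_polydisc u₀ r)
  have hΘ := differentiableOn_tangentConnection hsep hA hγ
  have hfl := isFlatOn_tangentConnection hsep hA hγ hωd hflat hω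
  have hstar : ∀ p ∈ ball (0 : ℂ) ρ ×ˢ polydisc u₀ r, ∀ s ∈ Icc (0 : ℝ) 1,
      rayMap u₀ s p ∈ ball (0 : ℂ) ρ ×ˢ polydisc u₀ r := fun p hp s hs => by
    refine ⟨hp.1, ?_⟩
    have := (convex_polydisc u₀ r).add_smul_sub_mem hu₀ hp.2 hs
    rwa [← Complex.coe_smul] at this
  exact ⟨radialTransport (tangentConnection A γ i) u₀, differentiableOn_radialTransport hU hΘ hstar,
    radialTransport_base, fun p hp => ⟨isUnit_radialTransport hU hΘ hstar hfl hp,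
      fderiv_radialTransport hU hΘ hstar hfl hp⟩⟩

/-- The Levelt form at the centre is spread over the polydisc by transport along the pole. The
transport acts from the left and enters only `Ŷ`, so `D`, `L` and `C` stay those at the centre. -/
theorem exists_isLeveltForm (hu₀ : u₀ ∈ polydisc u₀ r) {i : Fin N} {ρ : ℝ} (hρ : 0 < ρ)
    (hsep : ∀ u ∈ polydisc u₀ r, ∀ x : ℂ, ‖x‖ < ρ → ∀ j ≠ i, x + u i - u j ≠ 0)
    (hA : ∀ i, DifferentiableOn ℂ (A i) (polydisc u₀ r))
    (hγ : ∀ i, DifferentiableOn ℂ (γ i) (polydisc u₀ r))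
    (hωd : DifferentiableOn ℂ ω (affinePart u₀ r)) (hflat : IsFlatForm ω (affinePart u₀ r))
    (hres : ∀ p ∈ affinePart u₀ r, ω p (1, 0) = ∑ i, (p.1 - p.2 i)⁻¹ • A i p.2)
    (hω : ∀ p ∈ affinePart u₀ r, ω p = schlesingerForm A p + normalizationForm γ p)
    {e₀ : totalSpace u₀ r} {Y : UCover e₀ → Mat n} (hY : IsFundamentalMatrix ω Y) :
    ∃ (D : Fin n → ℤ) (L C : Mat n),
      IsLeveltForm A Y i (fun _ => D) (fun _ => L) (fun _ => C) := by
  classical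
  obtain ⟨P, hPd, hP1, hP⟩ := exists_tangentTransport hu₀ hsep hA hγ hωd hflat hω
  obtain ⟨S, J, hS, hSJ, hJ, hcons, hanti⟩ := exists_sorted_jordanForm (A i u₀)
  have hSi : Ring.inverse S * S = 1 := Ring.inverse_mul_cancel _ hS
  have hSi' : S * Ring.inverse S = 1 := Ring.mul_inverse_cancel _ hS
  set B : ℂ → Mat n := fun x => Ring.inverse S * residualCoeff A i (x, u₀) * S with hB
  have hBd : DifferentiableOn ℂ B (ball 0 ρ) := by
    have h1 : DifferentiableOn ℂ (fun x : ℂ => residualCoeff A i (x, u₀)) (ball 0 ρ) :=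
      (differentiableOn_residualCoeff hsep hA).comp (f := fun x : ℂ => (x, u₀))
        (by fun_prop) fun x hx => ⟨hx, hu₀⟩
    exact (h1.const_mul _).mul_const _
  have hB0 : B 0 = J := by
    simp only [hB, residualCoeff, zero_smul, add_zero]
    rw [mul_assoc, hSJ, ← mul_assoc, hSi, one_mul]
  obtain ⟨D, L, δ, T, hexp, hδ, hδρ, hTd, hT0, hTu, hTeq, hlim⟩ :=
    exists_leveltNormalForm hρ hBd (hB0 ▸ hJ) (hB0 ▸ hcons) (hB0 ▸ hanti)
  rw [hB0] at hlim
  set R : ℂ → Mat n := fun x => Matrix.diagonal (fun a => (D a : ℂ)) +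
    intPow x D * L * intPow x (-D) with hR
  set Ex : ℂ → Mat n := fun x => intPow (Complex.exp x) D * NormedSpace.exp (x • L) with hEx
  set G : ℂ → Mat n := fun x => S * T x with hG
  have hTdiff : ∀ x ∈ ball (0 : ℂ) δ, DifferentiableAt ℂ T x := fun x hx =>
    hTd.differentiableAt (isOpen_ball.mem_nhds hx)
  have hGdiff : ∀ x ∈ ball (0 : ℂ) δ, DifferentiableAt ℂ G x := fun x hx =>
    (hTdiff x hx).const_mul S
  have hGu : ∀ x ∈ ball (0 : ℂ) δ, IsUnit (G x) := fun x hx => hS.mul (hTu x hx)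
  have hGeq : ∀ x ∈ ball (0 : ℂ) δ, x ≠ 0 →
      x • deriv G x + G x * R x = residualCoeff A i (x, u₀) * G x := fun x hx hx0 => by
    have h1 : deriv G x = S * deriv T x := deriv_const_mul S (hTdiff x hx)
    rw [h1, ← mul_smul_comm, hTeq x hx hx0, hG, hB]
    simp only [mul_sub, ← mul_assoc, hSi', one_mul]
    exact sub_add_cancel _ _
  set U := ball (0 : ℂ) ρ ×ˢ polydisc u₀ r with hU
  have hUo : IsOpen U := isOpen_ball.prod (isOpen_polydisc u₀ r)
  have hball : ball (0 : ℂ) δ ⊆ ball 0 ρ := ball_subset_ball hδρ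
  -- the holomorphic factor, in the coordinates `x = z - uᵢ`, `u`
  set Q : ℂ × Par N → Mat n := fun p => P p * G p.1 with hQ
  have hQd : ∀ p ∈ ball (0 : ℂ) δ ×ˢ polydisc u₀ r, DifferentiableAt ℂ Q p := fun p hp => by
    have h1 : DifferentiableAt ℂ (fun p : ℂ × Par N => G p.1) p :=
      DifferentiableAt.comp (g := G) p (hGdiff p.1 hp.1) differentiableAt_fst
    exact (hPd.differentiableAt (hUo.mem_nhds ⟨hball hp.1, hp.2⟩)).mul h1
  have hQu : ∀ p ∈ ball (0 : ℂ) δ ×ˢ polydisc u₀ r, IsUnit (Q p) := fun p hp =>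
    (hP p ⟨hball hp.1, hp.2⟩).1.mul (hGu p.1 hp.1)
  have hQw : ∀ p ∈ ball (0 : ℂ) δ ×ˢ polydisc u₀ r, ∀ w,
      fderiv ℂ Q p (0, w) = tangentConnection A γ i p w * Q p := fun p hp w => by
    have hpU : p ∈ U := ⟨hball hp.1, hp.2⟩
    have h1 := (hPd.differentiableAt (hUo.mem_nhds hpU)).hasFDerivAt
    have h2 : HasFDerivAt (fun p : ℂ × Par N => G p.1) _ p :=
      (hGdiff p.1 hp.1).hasFDerivAt.comp p hasFDerivAt_fst
    have h3 : HasFDerivAt Q _ p := h1.mul' h2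
    rw [h3.fderiv]
    simp [(hP p hpU).2 w, hQ, mul_assoc]
  have hQ0 : ∀ x, Q (x, u₀) = G x := fun x => by simp [hQ, hP1]
  -- the fundamental matrix in logarithmic coordinates
  obtain ⟨φ, ℓ, hφ, hℓ⟩ := exists_tube_lift e₀ hδ fun u hu x hx => hsep u hu x (hx.trans_le hδρ)
  set Ψ : ℂ × Par N → Mat n := fun h =>
    if hh : h ∈ logTube u₀ r δ then Y ⟨φ ⟨h, hh⟩, ℓ ⟨h, hh⟩⟩ else 1 with hΨ
  have hΨY : ∀ h : logTube u₀ r δ, Ψ h = Y ⟨φ h, ℓ h⟩ := fun h => dif_pos h.2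
  set q : ℂ × Par N → ℂ × Par N := fun h => (Complex.exp h.1, h.2) with hq
  have hqmem : ∀ h ∈ logTube u₀ r δ, q h ∈ ball (0 : ℂ) δ ×ˢ polydisc u₀ r := fun h hh =>
    ⟨mem_ball_zero_iff.2 (norm_exp_lt hδ hh.1), hh.2⟩
  have hqt : ∀ h, tubeMap i h = shiftMap i (q h) := fun h => by
    simp [tubeMap, shiftMap, hq, add_comm]
  have hqA : ∀ h ∈ logTube u₀ r δ, shiftMap i (q h) ∈ affinePart u₀ r := fun h hh =>
    shiftMap_mem_affinePart hsep ⟨hball (hqmem h hh).1, hh.2⟩ (Complex.exp_ne_zero _)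
  have hΨd : ∀ h ∈ logTube u₀ r δ, DifferentiableAt ℂ Ψ h := fun h hh =>
    (hY.hasFDerivAt_lift hφ hℓ hΨY hh).1
  have hΨw : ∀ h ∈ logTube u₀ r δ, ∀ w,
      fderiv ℂ Ψ h (0, w) = tangentConnection A γ i (q h) w * Ψ h := fun h hh w => by
    rw [(hY.hasFDerivAt_lift hφ hℓ hΨY hh).2, hqt, ← form_shiftMap_tangent hω (hqA h hh)]
    simp
  have hΨx : ∀ h ∈ logTube u₀ r δ, ∀ c : ℂ,
      fderiv ℂ Ψ h (c, 0) = c • residualCoeff A i (q h) * Ψ h := fun h hh c => by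
    rw [(hY.hasFDerivAt_lift hφ hℓ hΨY hh).2, hqt,
      ← form_shiftMap_normal hres (hqA h hh) (Complex.exp_ne_zero _)]
    simp [hq]
  set Φ : ℂ × Par N → Mat n := fun h => Q (q h) * Ex h.1 with hΦ
  have hqd : ∀ h, HasFDerivAt q ((Complex.exp h.1 • dz N).prod
      (ContinuousLinearMap.snd ℂ ℂ (Par N))) h := fun h =>
    HasFDerivAt.prodMk ((Complex.hasDerivAt_exp h.1).comp_hasFDerivAt h hasFDerivAt_fst)
      hasFDerivAt_snd
  have hΦder : ∀ h ∈ logTube u₀ r δ, DifferentiableAt ℂ Φ h ∧ ∀ w,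
      fderiv ℂ Φ h (0, w) = tangentConnection A γ i (q h) w * Φ h := fun h hh => by
    have h1 : HasFDerivAt (fun h => Q (q h)) _ h :=
      (hQd (q h) (hqmem h hh)).hasFDerivAt.comp h (hqd h)
    have h2 : HasFDerivAt (fun h : ℂ × Par N => Ex h.1) _ h :=
      (hasDerivAt_leveltFactor D L h.1).hasFDerivAt.comp h hasFDerivAt_fst
    have h3 : HasFDerivAt Φ _ h := h1.mul' h2
    refine ⟨h3.differentiableAt, fun w => ?_⟩
    rw [h3.fderiv]
    simp [hQw (q h) (hqmem h hh) w, hΦ, mul_assoc, dz]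
  have hΦu : ∀ h ∈ logTube u₀ r δ, IsUnit (Φ h) := fun h hh =>
    (hQu _ (hqmem h hh)).mul (isUnit_leveltFactor D L h.1)
  have hΦx : ∀ h ∈ logTube u₀ r δ, ∀ c : ℂ, fderiv ℂ Φ h (c, 0) = c • ((Complex.exp h.1 •
      deriv (fun x => Q (x, h.2)) (Complex.exp h.1) + Q (q h) * R (Complex.exp h.1)) *
        Ex h.1) := fun h hh c => by
    have hQx : DifferentiableAt ℂ (fun x => Q (x, h.2)) (Complex.exp h.1) :=
      DifferentiableAt.comp (𝕜 := ℂ) (Complex.exp h.1) (hQd (q h) (hqmem h hh))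
        (f := fun x => (x, h.2)) (by fun_prop)
    have h1 := hasDerivAt_mul_leveltFactor D L hQx
    have h2 : HasDerivAt (fun x : ℂ => ((x, h.2) : ℂ × Par N)) (1, 0) h.1 :=
      (hasDerivAt_id h.1).prodMk (hasDerivAt_const h.1 h.2)
    have h3 := (hΦder h hh).1.hasFDerivAt.comp_hasDerivAt h.1 h2
    have h4 : ((c, 0) : ℂ × Par N) = c • (1, 0) := by simp
    rw [h4, map_smul]
    congr 1
    exact h3.unique h1
  -- the ratio is constant
  set K : ℂ × Par N → Mat n := fun h => Ring.inverse (Φ h) * Ψ h with hK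
  have hKd : ∀ h ∈ logTube u₀ r δ, DifferentiableAt ℂ K h := fun h hh =>
    differentiableAt_inverse_mul (hΨd h hh) (hΦder h hh).1 (hΦu h hh)
  have hconv := convex_logTube u₀ r δ
  -- Constancy is obtained first along `u` and then along `x` at `u₀`: at this point `Φ` is known to
  -- satisfy the transversal equation only there.
  have hK1 : ∀ h ∈ logTube u₀ r δ, K h = K (h.1, u₀) := fun h hh => by
    have hh0 : (h.1, u₀) ∈ logTube u₀ r δ := ⟨hh.1, hu₀⟩
    refine eq_of_fderiv_segment_eq_zero hconv hKd hh0 hh fun t ht => ?_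
    have hmem := hconv.add_smul_sub_mem hh0 hh ht
    rw [← Complex.coe_smul] at hmem
    have h1 : h - (h.1, u₀) = (0, h.2 - u₀) := by ext <;> simp
    rw [h1] at hmem ⊢
    exact fderiv_inverse_mul_eq_zero (hΨd _ hmem) (hΦder _ hmem).1 (hΦu _ hmem)
      (hΨw _ hmem _) ((hΦder _ hmem).2 _)
  have hK2 : ∀ x ∈ {x : ℂ | x.re < Real.log δ}, ∀ y ∈ {x : ℂ | x.re < Real.log δ},
      K (y, u₀) = K (x, u₀) := fun x hx y hy => by
    refine eq_of_fderiv_segment_eq_zero hconv hKd (p := (x, u₀)) ⟨hx, hu₀⟩ ⟨hy, hu₀⟩ fun t ht => ?_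
    have hmem := hconv.add_smul_sub_mem (x := (x, u₀)) (y := (y, u₀)) ⟨hx, hu₀⟩ ⟨hy, hu₀⟩ ht
    rw [← Complex.coe_smul] at hmem
    have h1 : ((y, u₀) : ℂ × Par N) - (x, u₀) = (y - x, 0) := by ext <;> simp
    rw [h1] at hmem ⊢
    have h2 : ((x, u₀) : ℂ × Par N) + (t : ℂ) • (y - x, 0) = (x + t * (y - x), u₀) := by
      ext <;> simp
    rw [h2] at hmem ⊢
    refine fderiv_inverse_mul_eq_zero (hΨd _ hmem) (hΦder _ hmem).1 (hΦu _ hmem)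
      (hΨx _ hmem _) ?_
    rw [hΦx _ hmem, hΦ]
    simp only [hq, hQ0]
    rw [hGeq _ (hqmem _ hmem).1 (Complex.exp_ne_zero _), smul_mul_assoc, mul_assoc]
  obtain ⟨x₀, hx₀⟩ : ∃ x₀ : ℂ, x₀.re < Real.log δ := ⟨((Real.log δ - 1 : ℝ) : ℂ), by simp⟩
  set C : Mat n := K (x₀, u₀) with hC
  have hCu : IsUnit C := by
    have hmem : (x₀, u₀) ∈ logTube u₀ r δ := ⟨hx₀, hu₀⟩
    refine (hΦu _ hmem).ringInverse.mul ?_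
    rw [hΨY ⟨_, hmem⟩]
    exact hY.invertible _
  have hΨC : ∀ h ∈ logTube u₀ r δ, Ψ h = Φ h * C := fun h hh => by
    rw [hC, ← hK2 x₀ hx₀ h.1 hh.1, ← hK1 h hh, hK]
    simp only
    rw [← mul_assoc, Ring.mul_inverse_cancel _ (hΦu h hh), one_mul]
  -- the equation of the holomorphic factor in the direction transversal to the pole
  have hQx : ∀ u ∈ polydisc u₀ r, ∀ x ∈ ball (0 : ℂ) δ, x ≠ 0 →
      x • deriv (fun x => Q (x, u)) x + Q (x, u) * R x = residualCoeff A i (x, u) * Q (x, u) := by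
    intro u hu x hx hx0
    have hmem : (Complex.log x, u) ∈ logTube u₀ r δ := by
      refine ⟨?_, hu⟩
      rw [Complex.log_re]
      exact Real.log_lt_log (norm_pos_iff.2 hx0) (mem_ball_zero_iff.1 hx)
    have h1 : Φ =ᶠ[𝓝 (Complex.log x, u)] fun h => Ψ h * Ring.inverse C := by
      filter_upwards [(isOpen_logTube u₀ r δ).mem_nhds hmem] with h hh
      rw [hΨC h hh, mul_assoc, Ring.mul_inverse_cancel _ hCu, mul_one]
    have h2 : fderiv ℂ Φ (Complex.log x, u) (1, 0) =
        residualCoeff A i (x, u) * Φ (Complex.log x, u) := by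
      have h3 : HasFDerivAt (fun h => Ψ h * Ring.inverse C) _ (Complex.log x, u) :=
        (hΨd _ hmem).hasFDerivAt.mul_const' (Ring.inverse C)
      rw [h1.fderiv_eq, h3.fderiv, h1.eq_of_nhds, ← mul_assoc]
      have h4 := hΨx _ hmem 1
      rw [one_smul] at h4
      simp only [hq, Complex.exp_log hx0] at h4
      rw [← h4]
      rfl
    rw [hΦx _ hmem 1, one_smul] at h2
    simp only [hΦ, hq, Complex.exp_log hx0] at h2
    rw [← mul_assoc (residualCoeff A i (x, u))] at h2
    exact (isUnit_leveltFactor D L (Complex.log x)).mul_right_cancel h2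
  -- Letting `x → 0` in the transversal equation shows that every `Aᵢ(u)` is conjugate to the same
  -- Jordan matrix `J`, the one found at the centre.
  have hQJ : ∀ u ∈ polydisc u₀ r, Q (0, u) * J = A i u * Q (0, u) := by
    intro u hu
    have h0 : (0 : ℂ) ∈ ball (0 : ℂ) δ := mem_ball_self hδ
    have hQd' : DifferentiableOn ℂ (fun x => Q (x, u)) (ball 0 δ) := fun x hx =>
      (DifferentiableAt.comp (𝕜 := ℂ) x (hQd (x, u) ⟨hx, hu⟩)
        (f := fun x => (x, u)) (by fun_prop)).differentiableWithinAt
    have hcQ : Tendsto (fun x => Q (x, u)) (𝓝[≠] 0) (𝓝 (Q (0, u))) :=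
      (hQd'.continuousOn.continuousAt (isOpen_ball.mem_nhds h0)).tendsto.mono_left
        nhdsWithin_le_nhds
    have hcQ' : Tendsto (fun x => x • deriv (fun x => Q (x, u)) x) (𝓝[≠] 0) (𝓝 0) := by
      have h1 := ((hQd'.deriv isOpen_ball).continuousOn.continuousAt
        (isOpen_ball.mem_nhds h0)).tendsto
      have h2 : Tendsto (fun x : ℂ => x) (𝓝 0) (𝓝 0) := tendsto_id
      have h3 := h2.smul h1
      rw [zero_smul] at h3
      exact h3.mono_left nhdsWithin_le_nhds
    have hcB : Tendsto (fun x => residualCoeff A i (x, u)) (𝓝[≠] 0) (𝓝 (A i u)) := by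
      have h1 : ContinuousAt (fun x => residualCoeff A i (x, u)) 0 :=
        ContinuousAt.comp (g := residualCoeff A i) (f := fun x : ℂ => (x, u))
          (((differentiableOn_residualCoeff hsep hA).differentiableAt
            (hUo.mem_nhds ⟨hball h0, hu⟩)).continuousAt) (by fun_prop)
      have h2 : residualCoeff A i (0, u) = A i u := by simp [residualCoeff]
      rw [← h2]
      exact h1.tendsto.mono_left nhdsWithin_le_nhds
    have h1 := hcQ'.add (hcQ.mul hlim)
    rw [zero_add] at h1
    refine tendsto_nhds_unique h1 ((hcB.mul hcQ).congr' ?_)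
    filter_upwards [nhdsWithin_le_nhds (isOpen_ball.mem_nhds h0), self_mem_nhdsWithin]
      with x hx hx0 using (hQx u hu x hx hx0).symm
  have hinv : ∀ M : Mat n, M⁻¹ = Ring.inverse M := Matrix.nonsing_inv_eq_ringInverse
  refine ⟨D, L, C, differentiableOn_const _, differentiableOn_const _, fun _ _ => hCu,
    fun _ _ => hexp, δ, fun p => Q (p.1 - p.2 i, p.2), hδ, fun p hp => ?_, fun p hp => ?_,
    fun u hu => ?_, fun u hu => ?_, φ, ℓ, hφ, hℓ, fun h => ?_⟩
  · have h1 : (p.1 - p.2 i, p.2) ∈ ball (0 : ℂ) δ ×ˢ polydisc u₀ r :=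
      ⟨mem_ball_zero_iff.2 hp.1, hp.2⟩
    exact (DifferentiableAt.comp (𝕜 := ℂ) p (hQd _ h1)
      (f := fun p : ℂ × Par N => (p.1 - p.2 i, p.2)) (by fun_prop)).differentiableWithinAt
  · exact hQu _ ⟨mem_ball_zero_iff.2 hp.1, hp.2⟩
  · have h1 : (0, u) ∈ ball (0 : ℂ) δ ×ˢ polydisc u₀ r := ⟨mem_ball_self hδ, hu⟩
    have h2 : (Q (0, u))⁻¹ * A i u * Q (0, u) = J := by
      rw [mul_assoc, ← hQJ u hu, ← mul_assoc, hinv, Ring.inverse_mul_cancel _ (hQu _ h1), one_mul]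
    simpa [h2] using hJ
  · have h1 : (0, u) ∈ ball (0 : ℂ) δ ×ˢ polydisc u₀ r := ⟨mem_ball_self hδ, hu⟩
    have h2 : A i u = Q (0, u) * J * Ring.inverse (Q (0, u)) := by
      rw [hQJ u hu, mul_assoc, Ring.mul_inverse_cancel _ (hQu _ h1), mul_one]
    have hsub : Tendsto (fun z : ℂ => z - u i) (𝓝[≠] (u i)) (𝓝[≠] 0) := by
      refine tendsto_nhdsWithin_iff.2 ⟨?_, ?_⟩
      · have : Continuous fun z : ℂ => z - u i := by fun_prop
        have h3 := (this.tendsto (u i)).mono_left (nhdsWithin_le_nhds (s := {u i}ᶜ))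
        rwa [sub_self] at h3
      · filter_upwards [self_mem_nhdsWithin] with z hz using sub_ne_zero.2 hz
    have hQc : ContinuousAt (fun x => Q (x, u)) 0 :=
      ContinuousAt.comp (g := Q) (f := fun x : ℂ => (x, u)) (hQd _ h1).continuousAt (by fun_prop)
    have hQi : ContinuousAt (fun x => Ring.inverse (Q (x, u))) 0 :=
      ContinuousAt.comp (g := Ring.inverse) (f := fun x => Q (x, u))
        (differentiableAt_inverse (𝕜 := ℂ) (hQu _ h1)).continuousAt hQc
    have h3 := ((hQc.tendsto.mono_left (nhdsWithin_le_nhds (s := {0}ᶜ))).mul hlim).mul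
      (hQi.tendsto.mono_left (nhdsWithin_le_nhds (s := {0}ᶜ)))
    rw [← h2] at h3
    simp only [hinv]
    exact h3.comp hsub
  · rw [← hΨY, hΨC _ h.2, hΦ]
    simp only [hq, hEx, add_sub_cancel_left, mul_assoc]

end LeveltForms

theorem isStrongDeformation_of_isSchlesinger {n N : ℕ} {u₀ : Par N} {r : Fin N → ℝ}
    (hr : ∀ i, 0 < r i)
    (hdisj : ∀ i j, i ≠ j →
      Disjoint (Metric.closedBall (u₀ i) (r i)) (Metric.closedBall (u₀ j) (r j)))
    {A : Fin N → Par N → Mat n} (hA : ∀ i, DifferentiableOn ℂ (A i) (polydisc u₀ r))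
    {ω : Form n N} (hω : IsDeformationForm u₀ r A ω) (e₀ : totalSpace u₀ r)
    (h : IsSchlesinger u₀ r A ω) : IsStrongDeformation e₀ A ω := by
  obtain ⟨γ, hγ, hωγ⟩ := h
  have hflat := isFlatForm_of_integrable hω.holomorphic hω.integrable
  obtain ⟨Y, hY⟩ := exists_isIsomonodromicFundamentalMatrix hω.holomorphic hflat e₀
  refine ⟨Y, hY, fun i => ?_⟩
  obtain ⟨ρ, hρ, hsep⟩ := exists_tube_radius hr hdisj i
  obtain ⟨D, L, C, hLev⟩ := exists_isLeveltForm (fun i => Metric.mem_ball_self (hr i)) hρ hsep hA hγ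
    hω.holomorphic.differentiableOn hflat hω.restriction hωγ hY.fundamental
  exact ⟨fun _ => D, fun _ => L, fun _ => C, hLev, fun _ _ _ _ => rfl, fun _ _ _ _ => rfl,
    fun _ _ _ _ => rfl⟩

end Fuchsian

theorem mainTheorem11 {n N : ℕ} (u₀ : Fuchsian.Par N) (r : Fin N → ℝ) (hr : ∀ i, 0 < r i)
    (hdisj : ∀ i j, i ≠ j →
      Disjoint (Metric.closedBall (u₀ i) (r i)) (Metric.closedBall (u₀ j) (r j)))
    (A : Fin N → Fuchsian.Par N → Fuchsian.Mat n)
    (hA : ∀ i, DifferentiableOn ℂ (A i) (Fuchsian.polydisc u₀ r))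
    (hsum : ∀ u ∈ Fuchsian.polydisc u₀ r, ∑ i, A i u = 0)
    (ω : Fuchsian.Form n N) (hω : Fuchsian.IsDeformationForm u₀ r A ω)
    (e₀ : Fuchsian.totalSpace u₀ r) :
    (Fuchsian.IsSchlesinger u₀ r A ω ↔
      ∃ Y : Fuchsian.UCover e₀ → Fuchsian.Mat n,
        Fuchsian.IsIsomonodromicFundamentalMatrix ω Y ∧
          Fuchsian.HasConstantExponentsAndConnection A Y) ∧
    (Fuchsian.IsStrongDeformation e₀ A ω ↔ Fuchsian.IsSchlesinger u₀ r A ω) := by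
  have hstrong : Fuchsian.IsSchlesinger u₀ r A ω → Fuchsian.IsStrongDeformation e₀ A ω :=
    Fuchsian.isStrongDeformation_of_isSchlesinger hr hdisj hA hω e₀
  have hconst : Fuchsian.IsStrongDeformation e₀ A ω →
      ∃ Y : Fuchsian.UCover e₀ → Fuchsian.Mat n,
        Fuchsian.IsIsomonodromicFundamentalMatrix ω Y ∧
          Fuchsian.HasConstantExponentsAndConnection A Y := by
    rintro ⟨Y, hY, hLev⟩
    refine ⟨Y, hY, fun i => ?_⟩
    obtain ⟨D, L, C, h, -, hL, hC⟩ := hLev i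
    exact ⟨D, L, C, h, hL, hC⟩
  have hconv : (∃ Y : Fuchsian.UCover e₀ → Fuchsian.Mat n,
        Fuchsian.IsIsomonodromicFundamentalMatrix ω Y ∧
          Fuchsian.HasConstantExponentsAndConnection A Y) → Fuchsian.IsSchlesinger u₀ r A ω := by
    rintro ⟨Y, hY, hLev⟩
    exact Fuchsian.isSchlesinger_of_constant hdisj hA hω hY.fundamental hLev
  exact ⟨⟨fun h => hconst (hstrong h), hconv⟩, fun h => hconv (hconst h), hstrong⟩
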